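/- Let $Z(t)$ be a Markov branching process with $Z(0)=1$: particles evolve independently, live an exponential time with parameter $\mu>0$, and at death produce a random number of children with probability generating function (p.g.f.) $f$. Put $F(t;s)=\mathbf E[s^{Z(t)}\mid Z(0)=1]$. Let $S_1<S_2<\cdots$ be the jump points of a Poisson process $\nu(t)$, $\nu(0)=0$, with intensity $r\ge 0$ that is integrable on bounded intervals $[0,t]$; let $I_1,I_2,\dots$ be i.i.d. non-negative integers with p.g.f. $g$; let $Z^{(k,j)}$ be i.i.d. copies of $Z$; suppose that $\nu$, $(I_k)$ and $(Z^{(k,j)})$ are independent, and set $$Y(t)=\sum_{k=1}^{\nu(t)}\sum_{j=1}^{I_k}Z^{(k,j)}(t-S_k),\qquad t\ge 0 .$$ Assume that for some $\theta>0$, $\gamma\in(0,1]$, $\alpha\in(0,1]$ and functions $L_R,L,l$ slowly varying at infinity, $$r(t)=t^{-\theta}L_R(t)\ (t>0),\quad f(s)=s+(1-s)^{\gamma+1}L\Big(\frac1{1-s}\Big),\quad g(s)=1-(1-s)^{\alpha}\,l\Big(\frac1{1-s}\Big)\quad (0\le s<1).$$ Let $W:[0,\infty)\to[1,\infty)$ be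 the inverse of $V(x)=\int_0^{1-1/x}\frac{du}{f(u)-u}$, $x\ge1$, and put $q(t;s)=1-g(F(t;s))$, $Q=\int_0^\infty q(u;0)\,du$, $\Delta(s)=\int_0^\infty q(u;s)\,du$. (i) If $\theta\ge1$ and $0<\alpha/\gamma<1$, then there is a probability distribution on $[0,\infty)$, with distribution function $D(\alpha,\gamma;x)$, whose Laplace transform is $$\int_0^\infty e^{-\lambda x}\,dD(\alpha,\gamma;x)=1-\frac{\lambda^\alpha}{(1+\lambda^\gamma)^{\alpha/\gamma}},\qquad \lambda>0,$$ and for every $x\ge0$ $$\mathbf P\{Y(t)/W(\mu t)\le x\mid Y(t)>0\}\to D(\alpha,\gamma;x),\qquad t\to\infty .$$ (ii) If $0<\theta<1$, $\alpha/\gamma\ge1$ and $Q<\infty$, then $Q>0$ and, for every $s\in[0,1]$, $\Delta(s)<\infty$ and $$\mathbf E[s^{Y(t)}\mid Y(t)>0]\to 1-\frac{\Delta(s)}{Q},\qquad t\to\infty .$$ -/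

import Mathlib

open MeasureTheory ProbabilityTheory Filter Set
open scoped Topology NNReal

noncomputable section

/-- `L` is slowly varying at infinity: defined, measurable and positive on some `[X, ∞)`, with
`L (c x) / L x → 1` as `x → ∞` for every `c > 0`. -/
structure SlowlyVarying (L : ℝ → ℝ) : Prop where
  pos_measurable : ∃ X : ℝ, (∀ x, X ≤ x → 0 < L x) ∧ Measurable (fun x : Set.Ici X => L x)
  tendsto_ratio : ∀ c : ℝ, 0 < c → Tendsto (fun x => L (c * x) / L x) atTop (𝓝 1)

/-- Probability generating function `∑ pₙ sⁿ` of a law on the nonnegative integers. -/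
def pgf (p : PMF ℕ) (s : ℝ) : ℝ := ∑' n : ℕ, (p n).toReal * s ^ n

/-! ### The Markov branching process started from one particle

Particles carry labels in `List ℕ`: the initial particle is `[]`, and `j :: v` is the particle
with label `v` in the family tree of the child number `j = 0, 1, …` of the initial particle. Every
label `v` carries a pair (lifetime, number of children produced at the end of its life). -/

/-- The lifetimes and offspring numbers attached to all the labels. -/
abbrev LifeTree : Type := List ℕ → ℝ × ℕ

/-- The subtree of labels below the child number `j` of the initial particle. -/
def LifeTree.child (T : LifeTree) (j : ℕ) : LifeTree := fun v => T (j :: v)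

/-- The particle with the given label is born at some time. -/
def LifeTree.IsBorn : LifeTree → List ℕ → Prop
  | _, [] => True
  | T, j :: v => j < (T []).2 ∧ (T.child j).IsBorn v

/-- Birth time of the particle with the given label: the sum of the lifetimes of its ancestors. -/
def LifeTree.birth : LifeTree → List ℕ → ℝ
  | _, [] => 0
  | T, j :: v => (T []).1 + (T.child j).birth v

/-- Labels of the particles that live at time `t`. -/
def LifeTree.alive (T : LifeTree) (t : ℝ) : Set (List ℕ) :=
  {v | T.IsBorn v ∧ T.birth v ≤ t ∧ t < T.birth v + (T v).1}

/-- The number of particles `Z(t)` living at time `t`. (For a critical offspring law the set of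
living particles is almost surely finite.) -/
def LifeTree.Z (T : LifeTree) (t : ℝ) : ℕ := (T.alive t).ncard

/-- The law of the family tree: all lifetimes are exponential with parameter `μ`, all offspring
numbers have law `p`, and everything is independent. -/
def treeLaw (μ : ℝ) (p : PMF ℕ) : Measure LifeTree :=
  Measure.infinitePi (fun _ : List ℕ => (expMeasure μ).prod p.toMeasure)

/-- `F(t; s) = E[s ^ Z(t) | Z(0) = 1]`. -/
def branchingF (μ : ℝ) (p : PMF ℕ) (t s : ℝ) : ℝ :=
  ∫ T : LifeTree, s ^ T.Z t ∂(treeLaw μ p)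

/-! ### Poisson immigration -/

section
variable {Ω : Type*} [MeasurableSpace Ω]

/-- `ν` is a Poisson process with intensity `r`: it starts at `0`, has nondecreasing
right-continuous paths and independent increments, and `ν t - ν s` has the Poisson law with mean
`∫ u in s..t, r u` for `s ≤ t`. -/
structure IsPoissonProcess (r : ℝ → ℝ) (ν : ℝ≥0 → Ω → ℕ) (P : Measure Ω) : Prop where
  measurable : ∀ t, Measurable (ν t)
  zero : ∀ ω, ν 0 ω = 0
  mono : ∀ ω, Monotone (fun t => ν t ω)
  rightCont : ∀ ω t, ContinuousWithinAt (fun u => ν u ω) (Set.Ici t) t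
  indepIncrements : HasIndepIncrements ν P
  law : ∀ s t : ℝ≥0, s ≤ t →
    P.map (fun ω => ν t ω - ν s ω) = poissonMeasure (∫ u in (s : ℝ)..t, r u).toNNReal

/-- The `k`-th jump point `S_k` of `ν`, for `k ≥ 1` (relevant only if `ν` reaches `k`). -/
def jumpTime (ν : ℝ≥0 → Ω → ℕ) (k : ℕ) (ω : Ω) : ℝ≥0 := sInf {u : ℝ≥0 | k ≤ ν u ω}

/-- The ingredients of a Markov branching process with Poisson immigration: the Poisson process
`ν` of immigration times, the numbers `I k` of immigrants, i.i.d. with law `b`, and the family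
trees `T (k, j)` of the immigrants, i.i.d. with law `treeLaw μ p`; the process `ν`, the sequence
`I` and the family `T` are independent. -/
structure IsImmigrationModel (μ : ℝ) (p b : PMF ℕ) (r : ℝ → ℝ) (ν : ℝ≥0 → Ω → ℕ)
    (I : ℕ → Ω → ℕ) (T : ℕ × ℕ → Ω → LifeTree) (P : Measure Ω) : Prop where
  poisson : IsPoissonProcess r ν P
  measurable_I : ∀ k, Measurable (I k)
  law_I : ∀ k, P.map (I k) = b.toMeasure
  indep_I : iIndepFun I P
  measurable_T : ∀ kj, Measurable (T kj)
  law_T : ∀ kj, P.map (T kj) = treeLaw μ p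
  indep_T : iIndepFun T P
  indep_I_T : IndepFun (fun ω k => I k ω) (fun ω kj => T kj ω) P
  indep_ν : IndepFun (fun ω t => ν t ω) (fun ω => ((fun k => I k ω), (fun kj => T kj ω))) P

/-- `Y(t) = ∑_{k=1}^{ν(t)} ∑_{j=1}^{I_k} Z^{(k,j)}(t - S_k)`. -/
def immigrationY (ν : ℝ≥0 → Ω → ℕ) (I : ℕ → Ω → ℕ) (T : ℕ × ℕ → Ω → LifeTree)
    (t : ℝ≥0) (ω : Ω) : ℕ :=
  ∑ k ∈ Finset.Icc 1 (ν t ω), ∑ j ∈ Finset.Icc 1 (I k ω),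
    (T (k, j) ω).Z ((t : ℝ) - (jumpTime ν k ω : ℝ))

end

/-! ### The analytic quantities -/

/-- `V(x) = ∫_0^{1-1/x} du / (f(u) - u)` for `x ≥ 1`, with `f` the offspring p.g.f. -/
def Vfun (p : PMF ℕ) (x : ℝ) : ℝ := ∫ u in (0 : ℝ)..(1 - 1 / x), 1 / (pgf p u - u)

/-- `W`, the inverse function of `V : [1, ∞) → [0, ∞)`. -/
def Wfun (p : PMF ℕ) (y : ℝ) : ℝ := Function.invFunOn (Vfun p) (Set.Ici 1) y

/-- `q(t; s) = 1 - g(F(t; s))`, with `g` the p.g.f. of the immigrants. -/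
def qfun (μ : ℝ) (p b : PMF ℕ) (t s : ℝ) : ℝ := 1 - pgf b (branchingF μ p t s)

/-- `Δ(s) = ∫_0^∞ q(u; s) du`. -/
def Deltafun (μ : ℝ) (p b : PMF ℕ) (s : ℝ) : ℝ := ∫ u in Set.Ioi (0 : ℝ), qfun μ p b u s

/-- `Q = ∫_0^∞ q(u; 0) du`. -/
def Qconst (μ : ℝ) (p b : PMF ℕ) : ℝ := ∫ u in Set.Ioi (0 : ℝ), qfun μ p b u 0

end

/-! Let A(t;s) = ∫_0^t r(u) q(t-u;s) du. Given the immigration times, the immigrants are independent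
families, so the generating functional of the Poisson process gives E[s^Y(t)] = exp(-A(t;s))
(`IsImmigrationModel.integral_pow_Y`). Conditioning on Y(t) > 0 gives 1 - (1 - exp(-A(t;s))) / (1 -
exp(-A(t;0))). If A(t;0) → 0 and A(t;s)/A(t;0) → κ, this tends to 1 - κ
(`IsImmigrationModel.tendsto_integral_pow_cond`). Everything else is the asymptotics of two
convolutions.

The branching input is the backward equation F' = μ(f(F) - F), obtained by conditioning on the death
of the initial particle. Integrated, it says V(1/(1-F(t;s))) = V(1/(1-s)) + μt (`Vfun_branchingF`);
in particular W(μt) = 1/(1-F(t;0)). Since V varies regularly with index γ, this determines 1-F up to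
asymptotic equivalence, and q(t;0) varies regularly with index -α/γ (`tendsto_qfun_div`).

(i) For θ ≥ 1 one has t r(t) = o(R(t)) with R(t) = ∫_0^t r, so the mass of r sits at times o(t), and
A(t;s) behaves like R(t) q(t;s), even when s varies with t (`tendsto_convolution_div_of_one_le`).
The times near t contribute O(t r(t) q(t;0)), because α/γ < 1. With s = exp(-λ/W(μt)), V(1/(1-s)) is
asymptotic to λ^(-γ) μt, whence κ = (1 + λ^(-γ))^(-α/γ). The continuity theorem for Laplace
transforms then gives convergence at every continuity point of D. That D has no atoms, not even at
0, follows by continuing its Laplace transform to the imaginary axis, where it tends to 0 at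
infinity.

(ii) For θ < 1 the roles are exchanged: q(·;0) is integrable and decreasing while r is almost
constant on bounded windows near t, so A(t;s) is asymptotic to r(t) Δ(s)
(`tendsto_convolution_div_of_lt_one`). As r(t) → 0, the ratio of exponents tends to Δ(s)/Q. -/

/-! ### Uniform convergence for slowly varying functions -/

/-- Uniform convergence theorem for additively slowly varying measurable functions. -/
lemma eventually_forall_abs_sub_lt_of_tendsto {h : ℝ → ℝ} (hm : Measurable h)
    (hh : ∀ u, Tendsto (fun x => h (x + u) - h x) atTop (𝓝 0)) (K : ℝ) {ε : ℝ} (hε : 0 < ε) :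
    ∀ᶠ x in atTop, ∀ u ∈ Icc (-K) K, |h (x + u) - h x| < ε := by
  rcases lt_or_ge K 0 with hK | hK
  · refine Eventually.of_forall fun x u hu => ?_
    have := hu.1.trans hu.2
    linarith
  by_contra hcon
  rw [not_eventually] at hcon
  obtain ⟨x, hx, hx'⟩ := exists_seq_forall_of_frequently hcon
  push Not at hx'
  choose u hu hxu using hx'
  -- M is positive, and the window J of half-width 2M contains [-M, M] even after a shift by u n,
  -- since |u n| ≤ K < M.
  set M := K + 1 with hM
  have hxu' : Tendsto (fun n => x n + u n) atTop atTop := by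
    refine tendsto_atTop_mono (fun n => ?_) (tendsto_atTop_add_const_right _ (-K) hx)
    linarith [(hu n).1]
  set J := Icc (-(2 * M)) (2 * M) with hJ
  have key : ∀ y : ℕ → ℝ, Tendsto y atTop atTop →
      Tendsto (fun n => (volume.restrict J) {z | ε / 2 ≤ |h (y n + z) - h (y n)|}) atTop (𝓝 0) := by
    intro y hy
    have := tendstoInMeasure_of_tendsto_ae (μ := volume.restrict J)
      (f := fun n z => h (y n + z) - h (y n)) (g := fun _ => 0)
      (fun n => by
        apply Measurable.aestronglyMeasurable
        fun_prop) (ae_of_all _ fun z => (hh z).comp hy)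
    rw [tendstoInMeasure_iff_dist] at this
    simpa [Real.dist_eq] using this (ε / 2) (by positivity)
  have hMpos : 0 < ENNReal.ofReal M := by
    rw [ENNReal.ofReal_pos]; linarith
  obtain ⟨n, hA, hB⟩ := (((key x hx).eventually (gt_mem_nhds hMpos)).and
    ((key _ hxu').eventually (gt_mem_nhds hMpos))).exists
  set A := {z | ε / 2 ≤ |h (x n + z) - h (x n)|} with hAdef
  set B := {z | ε / 2 ≤ |h (x n + u n + z) - h (x n + u n)|} with hBdef
  -- A y outside both bad sets would give two errors below ε/2 that add up to less than ε, against
  -- the choice of u n. So two sets of measure less than M cover an interval of length 2M, which is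
  -- absurd.
  have hsub : Icc (-M) M ⊆ (A ∩ J) ∪ ((fun z => z + -u n) ⁻¹' (B ∩ J)) := by
    intro y hy
    have h1 := hu n
    by_contra hc
    simp only [mem_union, mem_inter_iff, mem_preimage, not_or, not_and'] at hc
    have h2 := hc.1 ⟨by linarith [hy.1], by linarith [hy.2]⟩
    have h3 := hc.2 ⟨by linarith [hy.1, h1.1, h1.2], by linarith [hy.2, h1.1, h1.2]⟩
    simp only [hAdef, hBdef, mem_ofPred_eq, not_le] at h2 h3
    have e : x n + u n + (y + -u n) = x n + y := by ring
    rw [e] at h3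
    have h4 := hxu n
    rw [abs_lt] at h2 h3
    have : |h (x n + u n) - h (x n)| < ε := by
      rw [abs_lt]; constructor <;> linarith [h2.1, h2.2, h3.1, h3.2]
    linarith
  have hJm : MeasurableSet J := measurableSet_Icc
  have hvol : volume (Icc (-M) M) < ENNReal.ofReal M + ENNReal.ofReal M := by
    calc volume (Icc (-M) M) ≤ volume (A ∩ J) + volume ((fun z => z + -u n) ⁻¹' (B ∩ J)) :=
          (measure_mono hsub).trans (measure_union_le _ _)
      _ = volume (A ∩ J) + volume (B ∩ J) := by rw [measure_preimage_add_right]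
      _ < _ := by
          rw [Measure.restrict_apply' hJm] at hA hB
          exact ENNReal.add_lt_add hA hB
  rw [Real.volume_Icc, ← ENNReal.ofReal_add (by linarith) (by linarith)] at hvol
  have : M - -M = M + M := by ring
  rw [this] at hvol
  exact lt_irrefl _ hvol

namespace SlowlyVarying
variable {L : ℝ → ℝ}

lemma eventually_pos (hL : SlowlyVarying L) : ∀ᶠ x in atTop, 0 < L x := by
  obtain ⟨X, hX, -⟩ := hL.pos_measurable
  filter_upwards [eventually_ge_atTop X] with x hx using hX x hx

/-- The uniform convergence theorem for slowly varying functions. -/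
lemma eventually_forall_abs_sub_one_lt (hL : SlowlyVarying L) {a b : ℝ} (ha : 0 < a) {ε : ℝ}
    (hε : 0 < ε) : ∀ᶠ x in atTop, ∀ c ∈ Icc a b, |L (c * x) / L x - 1| < ε := by
  obtain ⟨X, hX, hXm⟩ := hL.pos_measurable
  -- Measurability of `L` is only known on [X, ∞). Filling in the constant 1 gives a globally
  -- measurable function with the same tail, and log ∘ Λ ∘ exp turns the ratio condition into the
  -- additive one.
  set Λ : ℝ → ℝ := (Ici X).piecewise L (fun _ => 1) with hΛ
  have hΛm : Measurable Λ := by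
    refine measurable_of_restrict_of_restrict_compl (measurableSet_Ici (a := X)) ?_ ?_
    · convert hXm using 1
      ext x
      simp [hΛ, Set.domRestrict]
    · convert measurable_const (a := (1 : ℝ)) using 1
      ext x
      have : ¬ X ≤ (x : ℝ) := x.2
      simp [hΛ, Set.domRestrict, this]
  have hΛeq : ∀ᶠ x in atTop, Λ x = L x := by
    filter_upwards [eventually_ge_atTop X] with x hx
    simp [hΛ, hx]
  have hev : ∀ c : ℝ, 0 < c → ∀ᶠ x in atTop, Λ (c * x) = L (c * x) ∧ 0 < L (c * x) := fun c hc =>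
    (tendsto_id.const_mul_atTop hc).eventually (hΛeq.and hL.eventually_pos)
  have hlim : ∀ u, Tendsto (fun x => Real.log (Λ (Real.exp (x + u))) - Real.log (Λ (Real.exp x)))
      atTop (𝓝 0) := by
    intro u
    have h1 := (hL.tendsto_ratio _ (Real.exp_pos u)).comp Real.tendsto_exp_atTop
    have h2 := (Real.continuousAt_log one_ne_zero).tendsto.comp h1
    rw [Real.log_one] at h2
    refine h2.congr' ?_
    filter_upwards [Real.tendsto_exp_atTop.eventually (hev _ (Real.exp_pos u)),
      Real.tendsto_exp_atTop.eventually (hΛeq.and hL.eventually_pos)] with x hx hx'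
    rw [Real.exp_add, mul_comm (Real.exp x), hx.1, hx'.1, ← Real.log_div hx.2.ne' hx'.2.ne']
    rfl
  have hmeas : Measurable fun x => Real.log (Λ (Real.exp x)) := by fun_prop
  obtain ⟨δ, hδ, hδε⟩ : ∃ δ > 0, ∀ y : ℝ, |y| < δ → |Real.exp y - 1| < ε := by
    have := Metric.continuousAt_iff.1 (Real.continuous_exp.continuousAt (x := 0)) ε hε
    obtain ⟨δ, hδ, H⟩ := this
    refine ⟨δ, hδ, fun y hy => ?_⟩
    have := H (x := y) (by simpa [Real.dist_eq] using hy)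
    simpa [Real.dist_eq] using this
  have := eventually_forall_abs_sub_lt_of_tendsto hmeas hlim (max (-Real.log a) (Real.log b)) hδ
  have htail : ∀ᶠ x in atTop, X ≤ x ∧ X ≤ a * x ∧ 0 < x := by
    filter_upwards [eventually_ge_atTop X, eventually_gt_atTop 0,
      (tendsto_id.const_mul_atTop ha).eventually_ge_atTop X] with x h1 h2 h3
    exact ⟨h1, h3, h2⟩
  filter_upwards [Real.tendsto_log_atTop.eventually this, htail] with x hx ⟨h1, h2, h3⟩ c hc
  have hc0 : 0 < c := ha.trans_le hc.1
  have hcx : X ≤ c * x := h2.trans (mul_le_mul_of_nonneg_right hc.1 h3.le)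
  have h4 := hx (Real.log c) ⟨by
    have := Real.log_le_log ha hc.1
    have := le_max_left (-Real.log a) (Real.log b)
    linarith, (Real.log_le_log hc0 hc.2).trans (le_max_right _ _)⟩
  rw [← Real.log_mul h3.ne' hc0.ne', Real.exp_log (by positivity), Real.exp_log h3,
    mul_comm x c] at h4
  have e1 : Λ (c * x) = L (c * x) := by simp [hΛ, hcx]
  have e2 : Λ x = L x := by simp [hΛ, h1]
  rw [e1, e2, ← Real.log_div (hX _ hcx).ne' (hX _ h1).ne'] at h4
  have h5 := hδε _ h4
  rwa [Real.exp_log (div_pos (hX _ hcx) (hX _ h1))] at h5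

end SlowlyVarying

/-! ### Monotone regularly varying functions and dyadic estimates -/

section RegularVariation
variable {ι : Type*} {F : Filter ι} {f : ℝ → ℝ} {X α : ℝ} {w w' : ι → ℝ}

/-- Monotonicity replaces uniform convergence: w' is squeezed between c·w for constants c slightly
below and slightly above ρ, and c ↦ c^(-α) is continuous. -/
lemma tendsto_div_of_tendsto_ratio_of_antitoneOn (hf : AntitoneOn f (Ici X))
    (hpos : ∀ᶠ x in atTop, 0 < f x)
    (hrv : ∀ c : ℝ, 0 < c → Tendsto (fun x => f (c * x) / f x) atTop (𝓝 (c ^ (-α))))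
    (hw : Tendsto w F atTop) {ρ : ℝ} (hρ : 0 < ρ)
    (hw' : Tendsto (fun i => w' i / w i) F (𝓝 ρ)) :
    Tendsto (fun i => f (w' i) / f (w i)) F (𝓝 (ρ ^ (-α))) := by
  have hcont : ContinuousAt (fun c : ℝ => c ^ (-α)) ρ :=
    Real.continuousAt_rpow_const _ _ (Or.inl hρ.ne')
  have hge : ∀ c : ℝ, 0 < c → ∀ᶠ i in F, X ≤ c * w i := fun c hc =>
    (hw.const_mul_atTop hc).eventually_ge_atTop X
  have hwpos := hw.eventually hpos
  have hw0 := hw.eventually_gt_atTop 0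
  have hX' : ∀ᶠ i in F, X ≤ w' i := by
    filter_upwards [hge (ρ / 2) (by positivity), hw0,
      hw'.eventually (lt_mem_nhds (half_lt_self hρ))] with i h1 h2 h3
    rw [lt_div_iff₀ h2] at h3
    linarith
  refine tendsto_order.2 ⟨fun a ha => ?_, fun a ha => ?_⟩
  · obtain ⟨c, hc1, hc2⟩ : ∃ c, ρ < c ∧ a < c ^ (-α) := by
      have h1 : ∀ᶠ c in 𝓝[>] ρ, a < c ^ (-α) :=
        (hcont.tendsto.mono_left nhdsWithin_le_nhds).eventually (lt_mem_nhds ha)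
      obtain ⟨c, h⟩ := (h1.and self_mem_nhdsWithin).exists
      exact ⟨c, h.2, h.1⟩
    have hc0 := hρ.trans hc1
    filter_upwards [((hrv c hc0).comp hw).eventually (lt_mem_nhds hc2), hge c hc0, hwpos, hw0,
      hw'.eventually (gt_mem_nhds hc1), hX'] with i h1 h2 h3 h4 h5 h6
    refine lt_of_lt_of_le h1 ?_
    have : w' i ≤ c * w i := by
      rw [div_lt_iff₀ h4] at h5; exact h5.le
    exact div_le_div_of_nonneg_right (hf h6 h2 this) h3.le
  · obtain ⟨c, ⟨hc1, hc0⟩, hc2⟩ : ∃ c, (c < ρ ∧ 0 < c) ∧ c ^ (-α) < a := by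
      have h1 : ∀ᶠ c in 𝓝[<] ρ, c ^ (-α) < a :=
        (hcont.tendsto.mono_left nhdsWithin_le_nhds).eventually (gt_mem_nhds ha)
      have h2 : ∀ᶠ c in 𝓝[<] ρ, 0 < c := nhdsWithin_le_nhds (lt_mem_nhds hρ)
      obtain ⟨c, h⟩ := ((h1.and h2).and self_mem_nhdsWithin).exists
      exact ⟨c, ⟨h.2, h.1.2⟩, h.1.1⟩
    filter_upwards [((hrv c hc0).comp hw).eventually (gt_mem_nhds hc2), hge c hc0, hwpos, hw0,
      hw'.eventually (lt_mem_nhds hc1), hX'] with i h1 h2 h3 h4 h5 h6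
    refine lt_of_le_of_lt ?_ h1
    have : c * w i ≤ w' i := by
      rw [lt_div_iff₀ h4] at h5; exact h5.le
    exact div_le_div_of_nonneg_right (hf h2 h6 this) h3.le

/-- Asymptotic inversion: because c ↦ c^(-α) is strictly decreasing, comparing f(w') with f(c·w) for
c on either side of ρ locates w' relative to c·w. -/
lemma tendsto_div_of_tendsto_div_of_antitoneOn (hα : 0 < α) (hf : AntitoneOn f (Ici X))
    (hpos : ∀ᶠ x in atTop, 0 < f x)
    (hrv : ∀ c : ℝ, 0 < c → Tendsto (fun x => f (c * x) / f x) atTop (𝓝 (c ^ (-α))))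
    (hw : Tendsto w F atTop) (hX' : ∀ᶠ i in F, X ≤ w' i) {ρ : ℝ} (hρ : 0 < ρ)
    (hw' : Tendsto (fun i => f (w' i) / f (w i)) F (𝓝 (ρ ^ (-α)))) :
    Tendsto (fun i => w' i / w i) F (𝓝 ρ) := by
  have hge : ∀ c : ℝ, 0 < c → ∀ᶠ i in F, X ≤ c * w i := fun c hc =>
    (hw.const_mul_atTop hc).eventually_ge_atTop X
  have hwpos := hw.eventually hpos
  have hw0 := hw.eventually_gt_atTop 0
  refine tendsto_order.2 ⟨fun a ha => ?_, fun a ha => ?_⟩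
  · obtain ⟨c, hc1, hc2⟩ := exists_between (max_lt ha hρ)
    obtain ⟨hac, hc0⟩ := max_lt_iff.1 hc1
    obtain ⟨m, hm1, hm2⟩ := exists_between (Real.rpow_lt_rpow_of_neg hc0 hc2 (neg_lt_zero.2 hα))
    filter_upwards [((hrv c hc0).comp hw).eventually (lt_mem_nhds hm2),
      hw'.eventually (gt_mem_nhds hm1), hge c hc0, hwpos, hw0, hX'] with i h1 h2 h3 h4 h5 h6
    have h7 : f (w' i) < f (c * w i) := by
      have := h2.trans h1
      exact (div_lt_div_iff_of_pos_right h4).1 this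
    have h8 : c * w i < w' i := by
      by_contra hcon
      exact absurd (hf h6 h3 (not_lt.1 hcon)) (not_le.2 h7)
    exact hac.trans ((lt_div_iff₀ h5).2 h8)
  · obtain ⟨c, hc1, hc2⟩ := exists_between ha
    have hc0 : 0 < c := hρ.trans hc1
    obtain ⟨m, hm1, hm2⟩ := exists_between (Real.rpow_lt_rpow_of_neg hρ hc1 (neg_lt_zero.2 hα))
    filter_upwards [((hrv c hc0).comp hw).eventually (gt_mem_nhds hm1),
      hw'.eventually (lt_mem_nhds hm2), hge c hc0, hwpos, hw0, hX'] with i h1 h2 h3 h4 h5 h6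
    have h7 : f (c * w i) < f (w' i) := by
      have := h1.trans h2
      exact (div_lt_div_iff_of_pos_right h4).1 this
    have h8 : w' i < c * w i := by
      by_contra hcon
      exact absurd (hf h3 h6 (not_lt.1 hcon)) (not_le.2 h7)
    exact ((div_lt_iff₀ h5).2 h8).trans hc2

/-- The easy half of Karamata's theorem, by dyadic induction. The block [t/2, t] contributes at most
C t a(t), and passing from t to t/2 shrinks t a(t) by a factor close to k/2 < 1, so the
contributions sum geometrically. -/
lemma eventually_integral_le_of_tendsto_ratio {a : ℝ → ℝ} (ha0 : ∀ t, 0 ≤ t → 0 ≤ a t)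
    (hint : ∀ t, 0 ≤ t → IntervalIntegrable a volume 0 t) (hpos : ∀ᶠ t in atTop, 0 < a t)
    {C : ℝ} (hC : ∀ᶠ t in atTop, ∀ c ∈ Icc (1 / 2 : ℝ) 1, a (c * t) ≤ C * a t) {k : ℝ} (hk : k < 2)
    (hhalf : Tendsto (fun t => a (1 / 2 * t) / a t) atTop (𝓝 k)) :
    ∃ M, 0 ≤ M ∧ ∀ᶠ t in atTop, ∫ u in (0 : ℝ)..t, a u ≤ M * (t * a t) := by
  obtain ⟨k', hk1, hk2⟩ := exists_between (max_lt hk (show (0 : ℝ) < 2 by norm_num))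
  obtain ⟨hk1, hk0⟩ := max_lt_iff.1 hk1
  obtain ⟨X, hX⟩ := eventually_atTop.1 (hpos.and (hC.and
    ((hhalf.eventually (gt_mem_nhds hk1)).and (eventually_gt_atTop 0))))
  have hX0 : 0 < X := (hX X le_rfl).2.2.2
  have hC0 : 0 ≤ C := by
    have h1 := hX X le_rfl
    have := h1.2.1 1 (by norm_num)
    rw [one_mul] at this
    nlinarith [h1.1]
  set R : ℝ → ℝ := fun t => ∫ u in (0 : ℝ)..t, a u with hR
  have hRmono : ∀ s t, 0 ≤ s → s ≤ t → R s ≤ R t := by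
    intro s t hs hst
    refine intervalIntegral.integral_mono_interval le_rfl hs hst ?_ (hint t (hs.trans hst))
    exact (ae_restrict_iff' measurableSet_Ioc).2 (ae_of_all _ fun u hu => ha0 u hu.1.le)
  have hstep : ∀ t, X ≤ t → R t ≤ R (1 / 2 * t) + C * (t * a t) := by
    intro t ht
    have ht0 : 0 < t := hX0.trans_le ht
    have h1 : IntervalIntegrable a volume 0 (1 / 2 * t) := hint _ (by positivity)
    have h2 : IntervalIntegrable a volume (1 / 2 * t) t := h1.symm.trans (hint t ht0.le)
    have h3 : R t = R (1 / 2 * t) + ∫ u in (1 / 2 * t)..t, a u :=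
      (intervalIntegral.integral_add_adjacent_intervals h1 h2).symm
    have h4 : ∫ u in (1 / 2 * t)..t, a u ≤ ∫ u in (1 / 2 * t)..t, C * a t := by
      refine intervalIntegral.integral_mono_on (by linarith) h2 (by simp) fun u hu => ?_
      have := (hX t ht).2.1 (u / t) ⟨by rw [le_div_iff₀ ht0]; exact hu.1,
        by rw [div_le_one ht0]; exact hu.2⟩
      rwa [div_mul_cancel₀ _ ht0.ne'] at this
    rw [h3]
    rw [intervalIntegral.integral_const, smul_eq_mul] at h4
    have h5 : (t - 1 / 2 * t) * (C * a t) ≤ C * (t * a t) := by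
      have : 0 ≤ C * (t * a t) := mul_nonneg hC0 (mul_nonneg ht0.le (hX t ht).1.le)
      nlinarith
    linarith
  have haX := (hX X le_rfl).1
  have hR0 : 0 ≤ R (2 * X) :=
    intervalIntegral.integral_nonneg (by positivity) fun u hu => ha0 u hu.1
  set K := R (2 * X) * C / (X * a X) with hK
  -- `K` settles the first block [X, 2X], where a(X) ≤ C a(t); the second entry is the smallest M
  -- with M k'/2 + C ≤ M, which closes the induction.
  set M := max K (C / (1 - k' / 2)) with hM
  have hk'' : 0 < 1 - k' / 2 := by linarith
  have hM0 : 0 ≤ M := le_max_of_le_right (div_nonneg hC0 hk''.le)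
  have hind : ∀ n : ℕ, ∀ t, X ≤ t → t ≤ 2 ^ n * (2 * X) → R t ≤ M * (t * a t) := by
    intro n
    induction n with
    | zero =>
      intro t ht ht2
      have ht0 : 0 < t := hX0.trans_le ht
      rw [pow_zero, one_mul] at ht2
      have h1 := (hX t ht).2.1 (X / t) ⟨by rw [le_div_iff₀ ht0]; linarith,
        by rw [div_le_one ht0]; exact ht⟩
      rw [div_mul_cancel₀ _ ht0.ne'] at h1
      have h2 : R t ≤ K * (t * a t) := by
        rw [hK, div_mul_eq_mul_div, le_div_iff₀ (by positivity)]
        calc R t * (X * a X) ≤ R (2 * X) * (t * (C * a t)) := by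
              have := hRmono t (2 * X) ht0.le ht2
              gcongr
          _ = _ := by ring
      exact h2.trans (mul_le_mul_of_nonneg_right (le_max_left _ _)
        (mul_nonneg ht0.le (hX t ht).1.le))
    | succ n ih =>
      intro t ht ht2
      have ht0 : 0 < t := hX0.trans_le ht
      by_cases hcase : t ≤ 2 * X
      · refine ih t ht (hcase.trans ?_)
        have : (1 : ℝ) ≤ 2 ^ n := one_le_pow₀ (by norm_num)
        nlinarith
      · push Not at hcase
        have h1 := ih (1 / 2 * t) (by linarith) (by rw [pow_succ] at ht2; linarith)
        have h2 := hstep t ht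
        have hat := (hX t ht).1
        have h3 : a (1 / 2 * t) ≤ k' * a t := ((div_lt_iff₀ hat).1 (hX t ht).2.2.1).le
        have h4 : C ≤ M * (1 - k' / 2) := by
          rw [← div_le_iff₀ hk'']; exact le_max_right _ _
        have h5 : M * (1 / 2 * t * a (1 / 2 * t)) ≤ M * (1 / 2 * t * (k' * a t)) := by gcongr
        have h6 : C * (t * a t) ≤ M * (1 - k' / 2) * (t * a t) := by gcongr
        calc R t ≤ M * (1 / 2 * t * (k' * a t)) + M * (1 - k' / 2) * (t * a t) := by linarith
          _ = M * (t * a t) := by ring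
  refine ⟨M, hM0, ?_⟩
  filter_upwards [eventually_ge_atTop X] with t ht
  obtain ⟨n, hn⟩ := pow_unbounded_of_one_lt (t / (2 * X)) (show (1 : ℝ) < 2 by norm_num)
  exact hind n t ht (by rw [div_lt_iff₀ (by positivity)] at hn; exact hn.le)

/-- A function that eventually loses a fixed factor over each doubling of the argument, and is
controlled on dyadic blocks, tends to zero. -/
lemma tendsto_zero_of_tendsto_ratio {h : ℝ → ℝ} (hpos : ∀ᶠ t in atTop, 0 < h t)
    {C : ℝ} (hC : ∀ᶠ t in atTop, ∀ c ∈ Icc (1 : ℝ) 2, h (c * t) ≤ C * h t) {k : ℝ} (hk : k < 1)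
    (hdouble : Tendsto (fun t => h (2 * t) / h t) atTop (𝓝 k)) :
    Tendsto h atTop (𝓝 0) := by
  obtain ⟨k', hk1, hk2⟩ := exists_between (max_lt hk (show (0 : ℝ) < 1 by norm_num))
  obtain ⟨hk1, hk0⟩ := max_lt_iff.1 hk1
  obtain ⟨X, hX⟩ := eventually_atTop.1 (hpos.and (hC.and
    ((hdouble.eventually (gt_mem_nhds hk1)).and (eventually_gt_atTop 0))))
  have hX0 : 0 < X := (hX X le_rfl).2.2.2
  have hpow : ∀ n : ℕ, h (2 ^ n * X) ≤ k' ^ n * h X := by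
    intro n
    induction n with
    | zero => simp
    | succ n ih =>
      have hge : X ≤ 2 ^ n * X := le_mul_of_one_le_left hX0.le (one_le_pow₀ (by norm_num))
      have h1 := hX _ hge
      have h2 := ((div_lt_iff₀ h1.1).1 h1.2.2.1).le
      rw [pow_succ', pow_succ', mul_assoc, mul_assoc]
      exact h2.trans (mul_le_mul_of_nonneg_left ih hk0.le)
  have hC0 : 0 ≤ C := by
    have h1 := hX X le_rfl
    have := h1.2.1 1 (by norm_num)
    rw [one_mul] at this
    nlinarith [h1.1]
  rw [Metric.tendsto_atTop]
  intro ε hε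
  have hlim : Tendsto (fun n : ℕ => C * (k' ^ n * h X)) atTop (𝓝 0) := by
    have := ((tendsto_pow_atTop_nhds_zero_of_lt_one hk0.le hk2).mul_const (h X)).const_mul C
    simpa using this
  obtain ⟨N, hN⟩ := eventually_atTop.1 (hlim.eventually (gt_mem_nhds hε))
  refine ⟨2 ^ N * X, fun t ht => ?_⟩
  have htX : 1 ≤ t / X := by
    rw [le_div_iff₀ hX0]
    have : (1 : ℝ) ≤ 2 ^ N := one_le_pow₀ (by norm_num)
    nlinarith
  obtain ⟨n, hn1, hn2⟩ := exists_nat_pow_near htX (show (1 : ℝ) < 2 by norm_num)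
  rw [le_div_iff₀ hX0] at hn1
  rw [div_lt_iff₀ hX0] at hn2
  have hNn : N ≤ n := by
    by_contra hcon
    have h1 : n + 1 ≤ N := by omega
    have h2 : (2 : ℝ) ^ (n + 1) ≤ 2 ^ N := pow_le_pow_right₀ (by norm_num) h1
    nlinarith
  have hge : X ≤ 2 ^ n * X := le_mul_of_one_le_left hX0.le (one_le_pow₀ (by norm_num))
  have h2n : 0 < 2 ^ n * X := by positivity
  have h1 := (hX _ hge).2.1 (t / (2 ^ n * X)) ⟨by rw [le_div_iff₀ h2n]; linarith,
    by rw [div_le_iff₀ h2n]; rw [pow_succ] at hn2; linarith⟩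
  rw [div_mul_cancel₀ _ h2n.ne'] at h1
  have htX' : X ≤ t := hge.trans hn1
  rw [Real.dist_eq, sub_zero, abs_of_pos (hX t htX').1]
  calc h t ≤ C * (k' ^ n * h X) := h1.trans (mul_le_mul_of_nonneg_left (hpow n) hC0)
    _ < ε := hN n hNn

end RegularVariation

/-! ### The intensity r(t) = t^(-θ) LR(t) -/

section RegularlyVaryingIntensity
variable {θ : ℝ} {r LR : ℝ → ℝ}

lemma SlowlyVarying.eventually_rpow_mul_pos (hLR : SlowlyVarying LR)
    (hr : ∀ t : ℝ, 0 < t → r t = t ^ (-θ) * LR t) : ∀ᶠ t in atTop, 0 < r t := by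
  filter_upwards [hLR.eventually_pos, eventually_gt_atTop 0] with t h1 h2
  rw [hr t h2]
  exact mul_pos (Real.rpow_pos_of_pos h2 _) h1

/-- The power factor scales exactly, so the only error is that of `LR`, multiplied by c^(-θ) ≤
a^(-θ). -/
lemma SlowlyVarying.eventually_forall_abs_sub_rpow_lt (hLR : SlowlyVarying LR) (hθ : 0 ≤ θ)
    (hr : ∀ t : ℝ, 0 < t → r t = t ^ (-θ) * LR t) {a b ε : ℝ} (ha : 0 < a) (hε : 0 < ε) :
    ∀ᶠ t in atTop, ∀ c ∈ Icc a b, |r (c * t) / r t - c ^ (-θ)| < ε := by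
  have hM : 0 < a ^ (-θ) := Real.rpow_pos_of_pos ha _
  filter_upwards [hLR.eventually_forall_abs_sub_one_lt (b := b) ha (div_pos hε hM),
    hLR.eventually_pos, eventually_gt_atTop 0] with t h1 h2 h3 c hc
  have hc0 := ha.trans_le hc.1
  have h4 := h1 c hc
  have hcθ : 0 < c ^ (-θ) := Real.rpow_pos_of_pos hc0 _
  have hca : c ^ (-θ) ≤ a ^ (-θ) :=
    Real.rpow_le_rpow_of_nonpos ha hc.1 (neg_nonpos.2 hθ)
  have htθ : 0 < t ^ (-θ) := Real.rpow_pos_of_pos h3 _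
  have e : r (c * t) / r t - c ^ (-θ) = c ^ (-θ) * (LR (c * t) / LR t - 1) := by
    rw [hr _ (by positivity), hr _ h3, Real.mul_rpow hc0.le h3.le]
    field_simp
  rw [e, abs_mul, abs_of_pos hcθ]
  calc c ^ (-θ) * |LR (c * t) / LR t - 1| < c ^ (-θ) * (ε / a ^ (-θ)) := by gcongr
    _ ≤ a ^ (-θ) * (ε / a ^ (-θ)) := by gcongr
    _ = ε := by field_simp

lemma SlowlyVarying.eventually_forall_le_const_mul (hLR : SlowlyVarying LR) (hθ : 0 ≤ θ)
    (hr : ∀ t : ℝ, 0 < t → r t = t ^ (-θ) * LR t) {a b : ℝ} (ha : 0 < a) :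
    ∃ C, 0 < C ∧ ∀ᶠ t in atTop, ∀ c ∈ Icc a b, r (c * t) ≤ C * r t := by
  refine ⟨a ^ (-θ) + 1, by positivity, ?_⟩
  filter_upwards [hLR.eventually_forall_abs_sub_rpow_lt hθ hr (b := b) ha one_pos,
    hLR.eventually_rpow_mul_pos hr] with t h1 h2 c hc
  have h3 := (abs_lt.1 (h1 c hc)).2
  have hca : c ^ (-θ) ≤ a ^ (-θ) :=
    Real.rpow_le_rpow_of_nonpos ha hc.1 (neg_nonpos.2 hθ)
  rw [← div_le_iff₀ h2]
  linarith

lemma SlowlyVarying.tendsto_ratio_rpow (hLR : SlowlyVarying LR) (hθ : 0 ≤ θ)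
    (hr : ∀ t : ℝ, 0 < t → r t = t ^ (-θ) * LR t) {c : ℝ} (hc : 0 < c) :
    Tendsto (fun t => r (c * t) / r t) atTop (𝓝 (c ^ (-θ))) := by
  rw [Metric.tendsto_nhds]
  intro ε hε
  filter_upwards [hLR.eventually_forall_abs_sub_rpow_lt hθ hr (b := c) hc hε] with t ht
  exact ht c ⟨le_rfl, le_rfl⟩

end RegularlyVaryingIntensity

/-! ### Probability generating functions -/

section Pgf
variable (p : PMF ℕ)

lemma hasSum_toReal_pmf : HasSum (fun n => (p n).toReal) 1 := by
  have h := ENNReal.hasSum_toReal (f := fun n => p n) (by rw [p.tsum_coe]; simp)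
  rwa [← ENNReal.tsum_toReal_eq p.apply_ne_top, p.tsum_coe, ENNReal.toReal_one] at h

variable {s t : ℝ}

lemma summable_pgf (hs : 0 ≤ s) (hs1 : s ≤ 1) : Summable fun n => (p n).toReal * s ^ n :=
  (hasSum_toReal_pmf p).summable.of_nonneg_of_le (fun n => by positivity)
    fun n => mul_le_of_le_one_right ENNReal.toReal_nonneg (pow_le_one₀ hs hs1)

lemma pgf_one : pgf p 1 = 1 := by
  simpa [pgf] using (hasSum_toReal_pmf p).tsum_eq

lemma pgf_nonneg (hs : 0 ≤ s) : 0 ≤ pgf p s := tsum_nonneg fun n => by positivity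

lemma pgf_mono (hs : 0 ≤ s) (hst : s ≤ t) (ht : t ≤ 1) : pgf p s ≤ pgf p t :=
  (summable_pgf p hs (hst.trans ht)).tsum_le_tsum
    (fun n => by gcongr) (summable_pgf p (hs.trans hst) ht)

lemma pgf_le_one (hs : 0 ≤ s) (hs1 : s ≤ 1) : pgf p s ≤ 1 :=
  (pgf_mono p hs hs1 le_rfl).trans_eq (pgf_one p)

lemma continuousOn_pgf : ContinuousOn (pgf p) (Icc 0 1) := by
  refine continuousOn_tsum (fun n => by fun_prop) (hasSum_toReal_pmf p).summable
    fun n s hs => ?_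
  rw [Real.norm_eq_abs, abs_of_nonneg (mul_nonneg ENNReal.toReal_nonneg (pow_nonneg hs.1 _))]
  exact mul_le_of_le_one_right ENNReal.toReal_nonneg (pow_le_one₀ hs.1 hs.2)

lemma integral_pow_toMeasure (hs : 0 ≤ s) (hs1 : s ≤ 1) :
    ∫ n, s ^ n ∂p.toMeasure = pgf p s := by
  rw [PMF.integral_eq_tsum]
  · simp [pgf]
  · refine Integrable.of_bound (C := 1) (by fun_prop) (ae_of_all _ fun n => ?_)
    rw [Real.norm_eq_abs, abs_of_nonneg (by positivity)]
    exact pow_le_one₀ hs hs1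

lemma hasSum_one_sub_pgf (hs : 0 ≤ s) (hs1 : s ≤ 1) :
    HasSum (fun n => (p n).toReal * (1 - s ^ n)) (1 - pgf p s) := by
  have := (hasSum_toReal_pmf p).sub (summable_pgf p hs hs1).hasSum
  simpa [mul_sub, pgf] using this

/-- The chord slope (1 - f(s))/(1 - s) is a positive combination of the geometric sums 1 + s + ⋯ +
s^(n-1), hence nondecreasing. Cross-multiplied, it also covers t = 1. -/
lemma one_sub_pgf_mul_le (hs : 0 ≤ s) (hst : s ≤ t) (ht : t ≤ 1) :
    (1 - pgf p s) * (1 - t) ≤ (1 - pgf p t) * (1 - s) := by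
  refine hasSum_le (fun n => ?_) ((hasSum_one_sub_pgf p hs (hst.trans ht)).mul_right (1 - t))
    ((hasSum_one_sub_pgf p (hs.trans hst) ht).mul_right (1 - s))
  rw [mul_assoc, mul_assoc]
  refine mul_le_mul_of_nonneg_left ?_ ENNReal.toReal_nonneg
  rw [← geom_sum_mul_neg s n, ← geom_sum_mul_neg t n, mul_assoc, mul_assoc, mul_comm (1 - s)]
  have h1 : 0 ≤ 1 - t := by linarith
  have h2 : 0 ≤ 1 - s := by linarith
  gcongr

/-- If `f(s) > s` near `1` then `f(s) > s` on `[0, 1)`. -/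
lemma lt_pgf_of_frequently (h : ∃ᶠ t in 𝓝[<] 1, t < pgf p t) (hs : 0 ≤ s) (hs1 : s < 1) :
    s < pgf p s := by
  have h2 : ∀ᶠ t in 𝓝[<] (1 : ℝ), s < t := nhdsWithin_le_nhds (lt_mem_nhds hs1)
  obtain ⟨t, ht, hst, ht1⟩ := (h.and_eventually (h2.and self_mem_nhdsWithin)).exists
  have ht1 : t < 1 := ht1
  -- At t the chord slope to 1 is below 1, and it can only be smaller at s.
  have := one_sub_pgf_mul_le p hs hst.le ht1.le
  nlinarith

lemma pgf_lt_one_of_frequently (h : ∃ᶠ t in 𝓝[<] 1, pgf p t < 1) (hs : 0 ≤ s) (hs1 : s < 1) :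
    pgf p s < 1 := by
  have h2 : ∀ᶠ t in 𝓝[<] (1 : ℝ), s < t := nhdsWithin_le_nhds (lt_mem_nhds hs1)
  obtain ⟨t, ht, hst, ht1⟩ := (h.and_eventually (h2.and self_mem_nhdsWithin)).exists
  exact (pgf_mono p hs hst.le (le_of_lt ht1)).trans_lt ht

/-- The mean is the limit at t = 1 of the chord slope (1 - f(t))/(1 - t), which is at most 1 here.
It rules out explosion: the number of living particles will be almost surely finite. -/
lemma lintegral_natCast_le_one (h : ∀ t : ℝ, 0 ≤ t → t < 1 → t ≤ pgf p t) :
    ∫⁻ n, (n : ENNReal) ∂p.toMeasure ≤ 1 := by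
  rw [lintegral_countable']
  simp only [PMF.toMeasure_apply_singleton _ _ (measurableSet_singleton _)]
  rw [ENNReal.tsum_eq_iSup_nat]
  refine iSup_le fun N => ?_
  have key : ∑ n ∈ Finset.range N, (n : ℝ) * (p n).toReal ≤ 1 := by
    -- For a truncated sum the passage t → 1 is mere continuity of a polynomial, and every
    -- truncation of the slope is at most 1.
    have hcont : Tendsto (fun t : ℝ => ∑ n ∈ Finset.range N,
        (∑ i ∈ Finset.range n, t ^ i) * (p n).toReal) (𝓝[<] 1)
        (𝓝 (∑ n ∈ Finset.range N, (∑ i ∈ Finset.range n, (1 : ℝ) ^ i) * (p n).toReal)) := by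
      apply Tendsto.mono_left _ nhdsWithin_le_nhds
      exact Continuous.tendsto (by fun_prop) _
    simp only [one_pow, Finset.sum_const, Finset.card_range, nsmul_eq_mul, mul_one] at hcont
    refine le_of_tendsto hcont ?_
    have h2 : ∀ᶠ t in 𝓝[<] (1 : ℝ), 0 < t := nhdsWithin_le_nhds (lt_mem_nhds one_pos)
    filter_upwards [h2, self_mem_nhdsWithin] with t ht0 ht1
    have ht1 : t < 1 := ht1
    have h3 : ∑ n ∈ Finset.range N, (p n).toReal * (1 - t ^ n) ≤ 1 - pgf p t :=
      sum_le_hasSum _ (fun n _ => mul_nonneg ENNReal.toReal_nonneg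
        (sub_nonneg.2 (pow_le_one₀ ht0.le ht1.le))) (hasSum_one_sub_pgf p ht0.le ht1.le)
    have h4 : ∑ n ∈ Finset.range N, (p n).toReal * (1 - t ^ n) =
        (∑ n ∈ Finset.range N, (∑ i ∈ Finset.range n, t ^ i) * (p n).toReal) * (1 - t) := by
      rw [Finset.sum_mul]
      refine Finset.sum_congr rfl fun n _ => ?_
      rw [← geom_sum_mul_neg t n]; ring
    rw [h4] at h3
    have := h t ht0.le ht1
    by_contra hcon
    push Not at hcon
    nlinarith
  have : ∑ n ∈ Finset.range N, (n : ENNReal) * p n =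
      ENNReal.ofReal (∑ n ∈ Finset.range N, (n : ℝ) * (p n).toReal) := by
    rw [ENNReal.ofReal_sum_of_nonneg (fun n _ => by positivity)]
    refine Finset.sum_congr rfl fun n _ => ?_
    rw [ENNReal.ofReal_mul (by positivity), ENNReal.ofReal_toReal (p.apply_ne_top n)]
    simp
  rw [this]
  exact ENNReal.ofReal_le_one.2 key

end Pgf

/-! ### Recursive structure and measurability of the family tree -/

namespace LifeTree

/-- The family tree with given data of the initial particle and given trees of its children. -/
def glue (a : ℝ × ℕ) (c : ℕ → LifeTree) : LifeTree
  | [] => a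
  | j :: v => c j v

@[simp] lemma glue_nil (a : ℝ × ℕ) (c : ℕ → LifeTree) : glue a c [] = a := rfl

@[simp] lemma child_glue (a : ℝ × ℕ) (c : ℕ → LifeTree) (j : ℕ) : (glue a c).child j = c j := rfl

lemma measurable_glue : Measurable fun x : (ℝ × ℕ) × (ℕ → LifeTree) => glue x.1 x.2 := by
  refine measurable_pi_lambda _ fun v => ?_
  cases v with
  | nil => exact measurable_fst
  | cons j v =>
    exact (measurable_pi_apply v).comp ((measurable_pi_apply j).comp measurable_snd)

lemma measurable_child (j : ℕ) : Measurable fun T : LifeTree => T.child j :=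
  measurable_pi_lambda _ fun v => measurable_pi_apply (j :: v)

lemma measurableSet_isBorn (v : List ℕ) : MeasurableSet {T : LifeTree | T.IsBorn v} := by
  induction v with
  | nil => simp [IsBorn]
  | cons j v ih =>
    have h1 : MeasurableSet {T : LifeTree | j < (T []).2} :=
      measurableSet_lt measurable_const (measurable_snd.comp (measurable_pi_apply []))
    exact h1.inter (measurable_child j ih)

lemma measurable_birth (v : List ℕ) : Measurable fun T : LifeTree => T.birth v := by
  induction v with
  | nil => exact measurable_const
  | cons j v ih =>
    exact (measurable_fst.comp (measurable_pi_apply [])).add (ih.comp (measurable_child j))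

lemma measurableSet_alive (v : List ℕ) :
    MeasurableSet {x : LifeTree × ℝ | v ∈ x.1.alive x.2} := by
  have h1 : Measurable fun x : LifeTree × ℝ => x.1.birth v :=
    (measurable_birth v).comp measurable_fst
  have h2 : Measurable fun x : LifeTree × ℝ => (x.1 v).1 :=
    measurable_fst.comp ((measurable_pi_apply v).comp measurable_fst)
  exact (measurable_fst (measurableSet_isBorn v)).inter
    ((measurableSet_le h1 measurable_snd).inter (measurableSet_lt measurable_snd (h1.add h2)))

lemma indicator_one_congr {α β : Type*} {A : Set α} {B : Set β} {a : α} {b : β}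
    (h : a ∈ A ↔ b ∈ B) : A.indicator (1 : α → ENNReal) a = B.indicator 1 b := by
  by_cases ha : a ∈ A
  · rw [indicator_of_mem ha, indicator_of_mem (h.1 ha)]; rfl
  · rw [indicator_of_notMem ha, indicator_of_notMem (fun hb => ha (h.2 hb))]

/-- The number of living particles as an extended nonnegative number. -/
noncomputable def count (T : LifeTree) (t : ℝ) : ENNReal := ∑' v, (T.alive t).indicator 1 v

lemma measurable_count : Measurable fun x : LifeTree × ℝ => x.1.count x.2 := by
  refine Measurable.tsum fun v => ?_
  have : (fun x : LifeTree × ℝ => (x.1.alive x.2).indicator (1 : List ℕ → ENNReal) v) =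
      {x : LifeTree × ℝ | v ∈ x.1.alive x.2}.indicator 1 := by
    ext x; exact indicator_one_congr Iff.rfl
  rw [this]
  exact measurable_one.indicator (measurableSet_alive v)

lemma count_eq_encard (T : LifeTree) (t : ℝ) : T.count t = (T.alive t).encard := by
  rw [count, ← tsum_subtype, ← ENNReal.tsum_set_one]
  rfl

lemma natCast_Z (T : LifeTree) (t : ℝ) : (T.Z t : ℝ) = (T.count t).toReal := by
  rw [count_eq_encard, Z, Set.ncard]
  -- For an infinite set both sides are 0 by convention: `ncard` is 0 and `⊤.toReal` is 0.
  cases h : (T.alive t).encard <;> simp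

/-- Gives measurability of `Z`, because `count` is a countable sum of indicators of measurable
events. -/
lemma Z_eq_floor (T : LifeTree) (t : ℝ) : T.Z t = ⌊(T.count t).toReal⌋₊ := by
  rw [← natCast_Z, Nat.floor_natCast]

lemma measurable_Z : Measurable fun x : LifeTree × ℝ => x.1.Z x.2 := by
  simp_rw [Z_eq_floor]
  exact Nat.measurable_floor.comp measurable_count.ennreal_toReal

lemma tsum_option' {α : Type*} (f : Option α → ENNReal) :
    ∑' o, f o = f none + ∑' a, f (some a) := by
  rw [← (Equiv.optionEquivSumPUnit.{0} α).symm.tsum_eq,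
    ENNReal.summable.tsum_sum ENNReal.summable, add_comm]
  simp

/-- Splitting a sum over all labels according to the first letter. -/
lemma tsum_list (f : List ℕ → ENNReal) : ∑' v, f v = f [] + ∑' j, ∑' v, f (j :: v) := by
  let e : Option (ℕ × List ℕ) ≃ List ℕ :=
    { toFun := fun o => o.elim [] fun x => x.1 :: x.2
      invFun := fun l => match l with
        | [] => none
        | j :: v => some (j, v)
      left_inv := fun o => by cases o <;> rfl
      right_inv := fun l => by cases l <;> rfl }
  rw [← e.tsum_eq, ← ENNReal.tsum_prod, tsum_option']
  rfl

lemma cons_mem_alive (T : LifeTree) (t : ℝ) (j : ℕ) (v : List ℕ) :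
    j :: v ∈ T.alive t ↔ j < (T []).2 ∧ v ∈ (T.child j).alive (t - (T []).1) := by
  simp only [alive, IsBorn, birth, mem_ofPred_eq, and_assoc]
  refine and_congr_right fun _ => and_congr_right fun _ => and_congr ?_ ?_
  · rw [add_comm, ← le_sub_iff_add_le]
  · rw [add_assoc, ← sub_lt_iff_lt_add']; rfl

lemma nil_mem_alive (T : LifeTree) (t : ℝ) : [] ∈ T.alive t ↔ 0 ≤ t ∧ t < (T []).1 := by
  simp [alive, IsBorn, birth]

/-- The number of living particles of the first `n` generations. -/
noncomputable def countLT (n : ℕ) (T : LifeTree) (t : ℝ) : ENNReal :=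
  ∑' v, {v | v ∈ T.alive t ∧ v.length < n}.indicator 1 v

lemma measurable_countLT (n : ℕ) : Measurable fun x : LifeTree × ℝ => countLT n x.1 x.2 := by
  refine Measurable.tsum fun v => ?_
  have : (fun x : LifeTree × ℝ =>
      {v | v ∈ x.1.alive x.2 ∧ v.length < n}.indicator (1 : List ℕ → ENNReal) v) =
      ({x : LifeTree × ℝ | v ∈ x.1.alive x.2} ∩ {_x | v.length < n}).indicator 1 := by
    ext x; exact indicator_one_congr Iff.rfl
  rw [this]
  exact measurable_one.indicator ((measurableSet_alive v).inter (by simp))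

lemma tsum_ite_lt (N : ℕ) (g : ℕ → ENNReal) :
    ∑' j, (if j < N then g j else 0) = ∑ j ∈ Finset.range N, g j := by
  rw [tsum_eq_sum (s := Finset.range N)]
  · exact Finset.sum_congr rfl fun j hj => if_pos (Finset.mem_range.1 hj)
  · intro j hj
    exact if_neg (by simpa using hj)

/-- The recursion at the death of the initial particle. With values in `ENNReal` it holds for every
tree; for `Z` it could fail when infinitely many particles live. -/
lemma count_eq (T : LifeTree) (t : ℝ) : T.count t =
    (if 0 ≤ t ∧ t < (T []).1 then 1 else 0) +
      ∑ j ∈ Finset.range (T []).2, (T.child j).count (t - (T []).1) := by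
  rw [count, tsum_list, ← tsum_ite_lt]
  congr 1
  · simp [indicator, nil_mem_alive]
  · refine tsum_congr fun j => ?_
    split_ifs with hj
    · exact tsum_congr fun v => indicator_one_congr (by simp [cons_mem_alive, hj])
    · refine ENNReal.tsum_eq_zero.2 fun v => indicator_of_notMem ?_ _
      simp [cons_mem_alive, hj]

/-- Truncating by generation makes the recursion well founded, so that expectations can be bounded
by induction on n. -/
lemma countLT_succ (n : ℕ) (T : LifeTree) (t : ℝ) : countLT (n + 1) T t =
    (if 0 ≤ t ∧ t < (T []).1 then 1 else 0) +
      ∑ j ∈ Finset.range (T []).2, countLT n (T.child j) (t - (T []).1) := by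
  rw [countLT, tsum_list, ← tsum_ite_lt]
  congr 1
  · simp [indicator, nil_mem_alive]
  · refine tsum_congr fun j => ?_
    split_ifs with hj
    · exact tsum_congr fun v => indicator_one_congr (by simp [cons_mem_alive, hj])
    · refine ENNReal.tsum_eq_zero.2 fun v => indicator_of_notMem ?_ _
      simp [cons_mem_alive, hj]

lemma birth_nonneg {T : LifeTree} (hT : ∀ v, 0 ≤ (T v).1) (v : List ℕ) : 0 ≤ T.birth v := by
  induction v generalizing T with
  | nil => exact le_rfl
  | cons j v ih => exact add_nonneg (hT []) (ih fun v => hT (j :: v))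

/-- Needed because the recursion evaluates the children at the time t minus the lifetime, which is
negative while the initial particle lives. A tree with negative lifetimes could have living
particles there. -/
lemma count_of_neg {T : LifeTree} (hT : ∀ v, 0 ≤ (T v).1) {t : ℝ} (ht : t < 0) :
    T.count t = 0 := by
  have : T.alive t = ∅ := by
    ext v
    simp only [alive, mem_ofPred_eq, mem_empty_iff_false, iff_false, not_and]
    intro _ h
    exact absurd (birth_nonneg hT v) (not_le.2 (h.trans_lt ht))
  simp [count, this]

end LifeTree

/-! ### Self-similarity of the tree law and finiteness of Z -/

section TreeLaw
variable {μ : ℝ} (p : PMF ℕ)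

lemma isProbabilityMeasure_treeLaw (hμ : 0 < μ) : IsProbabilityMeasure (treeLaw μ p) := by
  have := isProbabilityMeasure_expMeasure hμ
  unfold treeLaw
  infer_instance

/-- The data of the initial particle and the trees of its children are independent. -/
lemma map_glue_treeLaw (hμ : 0 < μ) :
    (((expMeasure μ).prod p.toMeasure).prod (Measure.infinitePi fun _ : ℕ => treeLaw μ p)).map
      (fun x => LifeTree.glue x.1 x.2) = treeLaw μ p := by
  classical
  have := isProbabilityMeasure_expMeasure hμ
  have := isProbabilityMeasure_treeLaw p hμ
  set m : Measure (ℝ × ℕ) := (expMeasure μ).prod p.toMeasure with hm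
  refine Measure.eq_infinitePi _ fun s t ht => ?_
  have hinj : InjOn (fun x : ℕ × List ℕ => x.1 :: x.2)
      ((fun x : ℕ × List ℕ => x.1 :: x.2) ⁻¹' (s : Set (List ℕ))) := by
    intro x _ y _ h
    simp only [List.cons.injEq] at h
    exact Prod.ext h.1 h.2
  set s' : Finset (ℕ × List ℕ) := s.preimage (fun x => x.1 :: x.2) hinj with hs'
  -- An infinite product measure is determined by finite boxes. Pulled back by `glue`, a box splits
  -- into a condition on the root and a box in the coordinates (j, v), which currying identifies
  -- with labels in the child trees.
  have hpre : (fun x : (ℝ × ℕ) × (ℕ → LifeTree) => LifeTree.glue x.1 x.2) ⁻¹' (Set.pi s t) =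
      (if [] ∈ s then t [] else univ) ×ˢ
        ((MeasurableEquiv.curry ℕ (List ℕ) (ℝ × ℕ)).symm ⁻¹'
          (Set.pi (s' : Set (ℕ × List ℕ)) fun x => t (x.1 :: x.2))) := by
    ext ⟨a, c⟩
    simp only [mem_preimage, Set.mem_pi, SetLike.mem_coe, mem_prod, hs', Finset.mem_preimage,
      Prod.forall]
    constructor
    · intro h
      refine ⟨?_, fun j v hv => h _ hv⟩
      split_ifs with h0
      · exact h [] h0
      · trivial
    · rintro ⟨h0, h⟩ v hv
      cases v with
      | nil => simpa [hv] using h0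
      | cons j v => exact h j v hv
  have hmeas : MeasurableSet (Set.pi (s' : Set (ℕ × List ℕ)) fun x => t (x.1 :: x.2)) :=
    MeasurableSet.pi s'.countable_toSet fun x _ => ht _
  rw [Measure.map_apply LifeTree.measurable_glue
    (MeasurableSet.pi s.countable_toSet fun v _ => ht v), hpre, Measure.prod_prod,
    ← Measure.map_apply (MeasurableEquiv.measurable _) hmeas]
  have hcurry := Measure.infinitePi_map_curry_symm (fun (_ : ℕ) (_ : List ℕ) => m)
  rw [show (Measure.infinitePi fun _ : ℕ => treeLaw μ p) =
    Measure.infinitePi fun _ : ℕ => Measure.infinitePi fun _ : List ℕ => m from rfl, hcurry,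
    Measure.infinitePi_pi _ fun x _ => ht _]
  have hfilter : ∏ x ∈ s', m (t (x.1 :: x.2)) = ∏ v ∈ s.filter (· ≠ []), m (t v) := by
    rw [hs', Finset.prod_preimage' (fun x : ℕ × List ℕ => x.1 :: x.2) s _ (fun v => m (t v))]
    refine Finset.prod_congr (Finset.filter_congr fun v _ => ?_) fun _ _ => rfl
    cases v with
    | nil => simp
    | cons j v => simp
  rw [hfilter, ← Finset.prod_filter_mul_prod_filter_not s (· = [])]
  congr 1
  by_cases h : [] ∈ s
  · have : s.filter (· = []) = {[]} := by
      ext v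
      simp only [Finset.mem_filter, Finset.mem_singleton]
      exact ⟨fun hv => hv.2, fun hv => ⟨hv ▸ h, hv⟩⟩
    rw [this, Finset.prod_singleton, if_pos h]
  · have : s.filter (· = []) = ∅ := by
      ext v
      simp only [Finset.mem_filter, Finset.notMem_empty, iff_false]
      exact fun hv => h (hv.2 ▸ hv.1)
    rw [this, Finset.prod_empty, if_neg h, measure_univ]

lemma integral_treeLaw (hμ : 0 < μ) {E : Type*} [NormedAddCommGroup E] [NormedSpace ℝ E]
    {g : LifeTree → E} (hg : StronglyMeasurable g) : ∫ T, g T ∂(treeLaw μ p) =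
    ∫ x, g (LifeTree.glue x.1 x.2) ∂(((expMeasure μ).prod p.toMeasure).prod
      (Measure.infinitePi fun _ : ℕ => treeLaw μ p)) := by
  rw [← map_glue_treeLaw p hμ, integral_map LifeTree.measurable_glue.aemeasurable
    hg.aestronglyMeasurable, map_glue_treeLaw p hμ]

lemma lintegral_treeLaw (hμ : 0 < μ) {g : LifeTree → ENNReal} (hg : Measurable g) :
    ∫⁻ T, g T ∂(treeLaw μ p) =
    ∫⁻ x, g (LifeTree.glue x.1 x.2) ∂(((expMeasure μ).prod p.toMeasure).prod
      (Measure.infinitePi fun _ : ℕ => treeLaw μ p)) := by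
  rw [← map_glue_treeLaw p hμ, lintegral_map hg LifeTree.measurable_glue, map_glue_treeLaw p hμ]

end TreeLaw

section TreeLaw
variable {μ : ℝ} (p : PMF ℕ)

lemma ae_nonneg_expMeasure (μ : ℝ) : ∀ᵐ x ∂(expMeasure μ), 0 ≤ x := by
  have h : expMeasure μ (Iio 0) = 0 := by
    rw [expMeasure, gammaMeasure, withDensity_apply _ measurableSet_Iio]
    exact lintegral_gammaPDF_of_nonpos le_rfl
  rw [ae_iff]
  convert h using 2
  ext x
  simp

lemma ae_nonneg_treeLaw (hμ : 0 < μ) : ∀ᵐ T ∂(treeLaw μ p), ∀ v, 0 ≤ (T v).1 := by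
  have := isProbabilityMeasure_expMeasure hμ
  rw [ae_all_iff]
  intro v
  have h1 : ∀ᵐ x ∂((expMeasure μ).prod p.toMeasure), 0 ≤ x.1 :=
    Measure.quasiMeasurePreserving_fst.ae (ae_nonneg_expMeasure μ)
  exact (measurePreserving_eval_infinitePi
    (fun _ : List ℕ => (expMeasure μ).prod p.toMeasure) v).quasiMeasurePreserving.ae h1

lemma LifeTree.measurable_countLT_left (n : ℕ) (t : ℝ) :
    Measurable fun T => LifeTree.countLT n T t :=
  (LifeTree.measurable_countLT n).comp measurable_prodMk_right

/-- Induction on generations: before its death the initial particle counts for 1, afterwards its at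
most one child on average contributes at most 1 each. The bound by 0 for t < 0 prevents both
contributions from occurring at once. -/
lemma lintegral_countLT_le (hμ : 0 < μ) (hp : ∫⁻ n, (n : ENNReal) ∂p.toMeasure ≤ 1) (n : ℕ)
    (t : ℝ) : ∫⁻ T, LifeTree.countLT n T t ∂(treeLaw μ p) ≤ if 0 ≤ t then 1 else 0 := by
  have := isProbabilityMeasure_expMeasure hμ
  have := isProbabilityMeasure_treeLaw p hμ
  induction n generalizing t with
  | zero => simp [LifeTree.countLT]
  | succ n ih =>
    split_ifs with ht
    swap
    · rw [nonpos_iff_eq_zero, lintegral_eq_zero_iff'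
        (LifeTree.measurable_countLT_left (n + 1) t).aemeasurable]
      filter_upwards [ae_nonneg_treeLaw p hμ] with T hT
      refine le_antisymm ?_ bot_le
      calc LifeTree.countLT (n + 1) T t ≤ T.count t :=
            ENNReal.tsum_le_tsum fun v => indicator_le_indicator_of_subset
              (fun v hv => hv.1) (by simp) v
        _ = 0 := LifeTree.count_of_neg hT (not_le.1 ht)
    have hmeas : Measurable fun x : (ℝ × ℕ) × (ℕ → LifeTree) =>
        LifeTree.countLT (n + 1) (LifeTree.glue x.1 x.2) t :=
      (LifeTree.measurable_countLT_left (n + 1) t).comp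
        LifeTree.measurable_glue
    rw [lintegral_treeLaw p hμ
      (LifeTree.measurable_countLT_left (n + 1) t),
      lintegral_prod _ hmeas.aemeasurable]
    have hinner : ∀ x : ℝ × ℕ, ∫⁻ c, LifeTree.countLT (n + 1) (LifeTree.glue x c) t
        ∂(Measure.infinitePi fun _ : ℕ => treeLaw μ p) ≤
        (if t < x.1 then 1 else 0) + x.2 * (if x.1 ≤ t then 1 else 0) := by
      intro x
      have hex : ∀ c, LifeTree.countLT (n + 1) (LifeTree.glue x c) t =
          (if 0 ≤ t ∧ t < x.1 then 1 else 0) +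
            ∑ j ∈ Finset.range x.2, LifeTree.countLT n (c j) (t - x.1) :=
        fun c => LifeTree.countLT_succ n _ t
      rw [lintegral_congr hex, lintegral_add_left measurable_const]
      refine add_le_add ?_ ?_
      · simp [ht]
      · have hmj : ∀ j ∈ Finset.range x.2, AEMeasurable
            (fun c : ℕ → LifeTree => LifeTree.countLT n (c j) (t - x.1))
            (Measure.infinitePi fun _ : ℕ => treeLaw μ p) := fun j _ =>
          ((LifeTree.measurable_countLT_left n _).comp (measurable_pi_apply j)).aemeasurable
        rw [lintegral_finsetSum' _ hmj]
        calc ∑ j ∈ Finset.range x.2, ∫⁻ c, LifeTree.countLT n (c j) (t - x.1)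
              ∂(Measure.infinitePi fun _ : ℕ => treeLaw μ p)
            = ∑ j ∈ Finset.range x.2, ∫⁻ T, LifeTree.countLT n T (t - x.1) ∂(treeLaw μ p) := by
              refine Finset.sum_congr rfl fun j _ => ?_
              exact (measurePreserving_eval_infinitePi (fun _ : ℕ => treeLaw μ p) j).lintegral_comp
                (LifeTree.measurable_countLT_left n _)
          _ ≤ ∑ j ∈ Finset.range x.2, (if 0 ≤ t - x.1 then 1 else 0) :=
              Finset.sum_le_sum fun j _ => ih _
          _ = x.2 * (if x.1 ≤ t then 1 else 0) := by
              simp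
    refine (lintegral_mono hinner).trans ?_
    have hm1 : Measurable fun x : ℝ => if t < x then (1 : ENNReal) else 0 :=
      Measurable.ite measurableSet_Ioi measurable_const measurable_const
    have hm2 : Measurable fun x : ℝ => if x ≤ t then (1 : ENNReal) else 0 :=
      Measurable.ite measurableSet_Iic measurable_const measurable_const
    have hm3 : Measurable fun n : ℕ => (n : ENNReal) := measurable_from_top
    have h2 : ∀ x : ℝ, ∫⁻ k, ((if t < x then 1 else 0) + (k : ENNReal) * (if x ≤ t then 1 else 0))
        ∂p.toMeasure ≤ 1 := by
      intro x
      rw [lintegral_add_left measurable_const, lintegral_mul_const _ hm3]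
      by_cases hx : t < x
      · simp [hx, hx.not_ge]
      · simpa [hx, not_lt.1 hx] using hp
    have hm4 : Measurable fun x : ℝ × ℕ => (if t < x.1 then (1 : ENNReal) else 0) +
        (x.2 : ENNReal) * (if x.1 ≤ t then 1 else 0) :=
      (hm1.comp measurable_fst).add ((hm3.comp measurable_snd).mul (hm2.comp measurable_fst))
    rw [lintegral_prod _ hm4.aemeasurable]
    exact (lintegral_mono h2).trans (by rw [lintegral_one, measure_univ])

/-- Any finite set of labels lies in finitely many generations, so the bound for truncated counts
passes to the supremum. -/
lemma lintegral_count_le_one (hμ : 0 < μ) (hp : ∫⁻ n, (n : ENNReal) ∂p.toMeasure ≤ 1) (t : ℝ) :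
    ∫⁻ T, LifeTree.count T t ∂(treeLaw μ p) ≤ 1 := by
  have hm : ∀ v, Measurable fun T : LifeTree =>
      (T.alive t).indicator (1 : List ℕ → ENNReal) v := by
    intro v
    have : (fun T : LifeTree => (T.alive t).indicator (1 : List ℕ → ENNReal) v) =
        {T : LifeTree | v ∈ T.alive t}.indicator 1 := by
      ext x; exact LifeTree.indicator_one_congr Iff.rfl
    rw [this]
    exact measurable_one.indicator (measurable_prodMk_right (LifeTree.measurableSet_alive v))
  unfold LifeTree.count
  rw [lintegral_tsum fun v => (hm v).aemeasurable, ENNReal.tsum_eq_iSup_sum]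
  refine iSup_le fun s => ?_
  rw [← lintegral_finsetSum' _ fun v _ => (hm v).aemeasurable]
  set n := s.sup List.length + 1
  calc _ ≤ ∫⁻ T, LifeTree.countLT n T t ∂(treeLaw μ p) := by
        refine lintegral_mono fun T => ?_
        calc ∑ v ∈ s, (T.alive t).indicator (1 : List ℕ → ENNReal) v
            = ∑ v ∈ s, {v | v ∈ T.alive t ∧ v.length < n}.indicator 1 v := by
              refine Finset.sum_congr rfl fun v hv => LifeTree.indicator_one_congr ?_
              have : v.length < n := Nat.lt_succ_of_le (Finset.le_sup hv)
              simp [this]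
          _ ≤ _ := ENNReal.sum_le_tsum s
    _ ≤ 1 := (lintegral_countLT_le p hμ hp n t).trans (by split_ifs <;> simp)

lemma ae_count_ne_top (hμ : 0 < μ) (hp : ∫⁻ n, (n : ENNReal) ∂p.toMeasure ≤ 1) (t : ℝ) :
    ∀ᵐ T ∂(treeLaw μ p), LifeTree.count T t ≠ ⊤ :=
  (ae_lt_top (LifeTree.measurable_count.comp measurable_prodMk_right)
    ((lintegral_count_le_one p hμ hp t).trans_lt ENNReal.one_lt_top).ne).mono fun _ h => h.ne

/-- The branching property: decomposition of `Z` at the death of the initial particle. -/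
lemma ae_Z_eq (hμ : 0 < μ) (hp : ∫⁻ n, (n : ENNReal) ∂p.toMeasure ≤ 1) {t : ℝ} (ht : 0 ≤ t) :
    ∀ᵐ T ∂(treeLaw μ p), T.Z t = if t < (T []).1 then 1 else
      ∑ j ∈ Finset.range (T []).2, (T.child j).Z (t - (T []).1) := by
  filter_upwards [ae_count_ne_top p hμ hp t, ae_nonneg_treeLaw p hμ] with T h1 h2
  have h3 := T.count_eq t
  have h4 : (T.Z t : ℝ) = ((if t < (T []).1 then 1 else
      ∑ j ∈ Finset.range (T []).2, (T.child j).Z (t - (T []).1) : ℕ) : ℝ) := by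
    split_ifs with h
    -- While the initial particle lives its children are unborn, so their subtrees are observed at a
    -- negative time.
    · have : ∑ j ∈ Finset.range (T []).2, (T.child j).count (t - (T []).1) = 0 :=
        Finset.sum_eq_zero fun j _ =>
          LifeTree.count_of_neg (fun v => h2 (j :: v)) (sub_neg.2 h)
      rw [LifeTree.natCast_Z, h3, this]
      simp [ht, h]
    · rw [if_neg (fun h' => h h'.2), zero_add] at h3
      rw [h3] at h1
      rw [LifeTree.natCast_Z, h3, ENNReal.toReal_sum fun j hj => by
        exact ne_top_of_le_ne_top h1 (Finset.single_le_sum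
          (f := fun j => (T.child j).count (t - (T []).1)) (fun _ _ => bot_le) hj)]
      push_cast
      exact Finset.sum_congr rfl fun j _ => (LifeTree.natCast_Z _ _).symm
  exact_mod_cast h4

end TreeLaw

/-! ### The function F(t; s) and the backward equation -/

section BranchingF
variable {μ : ℝ} (p : PMF ℕ) {s t : ℝ}

lemma pow_mem_Icc_zero_one (hs : 0 ≤ s) (hs1 : s ≤ 1) (n : ℕ) : s ^ n ∈ Icc (0 : ℝ) 1 :=
  ⟨pow_nonneg hs n, pow_le_one₀ hs hs1⟩

lemma LifeTree.measurable_pow_Z (s : ℝ) : Measurable fun x : LifeTree × ℝ => s ^ x.1.Z x.2 :=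
  (measurable_from_top (f := fun n : ℕ => s ^ n)).comp LifeTree.measurable_Z

lemma LifeTree.measurable_pow_Z_left (s t : ℝ) : Measurable fun T : LifeTree => s ^ T.Z t :=
  (LifeTree.measurable_pow_Z s).comp measurable_prodMk_right

lemma integrable_of_mem_Icc {Ω : Type*} [MeasurableSpace Ω] {P : Measure Ω} [IsFiniteMeasure P]
    {f : Ω → ℝ} (hf : Measurable f) (h : ∀ ω, f ω ∈ Icc (0 : ℝ) 1) : Integrable f P :=
  Integrable.of_bound (C := 1) hf.aestronglyMeasurable (ae_of_all _ fun ω => by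
    rw [Real.norm_eq_abs, abs_of_nonneg (h ω).1]; exact (h ω).2)

lemma integral_mem_Icc {Ω : Type*} [MeasurableSpace Ω] {P : Measure Ω} [IsProbabilityMeasure P]
    {f : Ω → ℝ} (hf : Measurable f) (h : ∀ ω, f ω ∈ Icc (0 : ℝ) 1) :
    ∫ ω, f ω ∂P ∈ Icc (0 : ℝ) 1 := by
  refine ⟨integral_nonneg fun ω => (h ω).1, ?_⟩
  calc ∫ ω, f ω ∂P ≤ ∫ _, (1 : ℝ) ∂P :=
        integral_mono (integrable_of_mem_Icc hf h) (by simp) fun ω => (h ω).2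
    _ = 1 := by simp

lemma branchingF_mem_Icc (hμ : 0 < μ) (hs : 0 ≤ s) (hs1 : s ≤ 1) :
    branchingF μ p t s ∈ Icc (0 : ℝ) 1 := by
  have := isProbabilityMeasure_treeLaw p hμ
  exact integral_mem_Icc (LifeTree.measurable_pow_Z_left s t)
    fun T => pow_mem_Icc_zero_one hs hs1 _

lemma branchingF_mono_right (hμ : 0 < μ) {s' : ℝ} (hs : 0 ≤ s) (hss : s ≤ s') (hs1 : s' ≤ 1) :
    branchingF μ p t s ≤ branchingF μ p t s' := by
  have := isProbabilityMeasure_treeLaw p hμ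
  exact integral_mono (integrable_of_mem_Icc (LifeTree.measurable_pow_Z_left s t)
    fun T => pow_mem_Icc_zero_one hs (hss.trans hs1) _)
    (integrable_of_mem_Icc (LifeTree.measurable_pow_Z_left s' t)
    fun T => pow_mem_Icc_zero_one (hs.trans hss) hs1 _) fun T => pow_le_pow_left₀ hs hss _

lemma measurable_branchingF (hμ : 0 < μ) (s : ℝ) : Measurable fun t => branchingF μ p t s := by
  have := isProbabilityMeasure_treeLaw p hμ
  have h := ((LifeTree.measurable_pow_Z s).comp measurable_swap).stronglyMeasurable
  exact (h.integral_prod_right' (ν := treeLaw μ p)).measurable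

/-- Independence of the children's trees makes the generating function of n families an n-th power;
averaging over n then produces f(F). -/
lemma integral_prod_child (hμ : 0 < μ) (n : ℕ) {g : LifeTree → ℝ} (hg : Measurable g) :
    ∫ c, ∏ j ∈ Finset.range n, g (c j) ∂(Measure.infinitePi fun _ : ℕ => treeLaw μ p) =
      (∫ T, g T ∂(treeLaw μ p)) ^ n := by
  have := isProbabilityMeasure_treeLaw p hμ
  have hind := (iIndepFun_infinitePi (P := fun _ : ℕ => treeLaw μ p)
    (X := fun _ => g) (fun _ => hg)).precomp (g := fun j : Fin n => (j : ℕ)) Fin.val_injective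
  have h := hind.integral_fun_prod_eq_prod_integral
    (fun j => (hg.comp (measurable_pi_apply _)).aestronglyMeasurable)
  simp only [← Fin.prod_univ_eq_prod_range]
  rw [h]
  have : ∀ j : ℕ, ∫ c : ℕ → LifeTree, g (c j) ∂(Measure.infinitePi fun _ : ℕ => treeLaw μ p) =
      ∫ T, g T ∂(treeLaw μ p) := fun j => by
    conv_rhs => rw [← (measurePreserving_eval_infinitePi (fun _ : ℕ => treeLaw μ p) j).map_eq]
    rw [integral_map (measurable_pi_apply j).aemeasurable hg.aestronglyMeasurable]
  simp [this]

lemma measurable_pgf_branchingF (b : PMF ℕ) (hμ : 0 < μ) (hs : 0 ≤ s) (hs1 : s ≤ 1) :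
    Measurable fun t => pgf b (branchingF μ p t s) := by
  unfold pgf
  refine measurable_of_tendsto_metrizable (f := fun N t => ∑ n ∈ Finset.range N,
    (b n).toReal * branchingF μ p t s ^ n) (fun N => ?_) ?_
  · have := measurable_branchingF p hμ s
    fun_prop
  · rw [tendsto_pi_nhds]
    intro t
    have h := branchingF_mem_Icc p (t := t) hμ hs hs1
    exact (summable_pgf b h.1 h.2).hasSum.tendsto_sum_nat

lemma LifeTree.measurable_prod_pow_Z_child (s t : ℝ) : Measurable fun x : LifeTree × ℕ =>
    ∏ j ∈ Finset.range x.2, s ^ (x.1.child j).Z (t - (x.1 []).1) := by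
  have hτ : Measurable fun T : LifeTree => t - (T []).1 :=
    measurable_const.sub (measurable_fst.comp (measurable_pi_apply []))
  have hj : ∀ j, Measurable fun T : LifeTree => s ^ (T.child j).Z (t - (T []).1) := fun j => by
    have := (LifeTree.measurable_pow_Z s).comp ((LifeTree.measurable_child j).prodMk hτ)
    exact this
  exact measurable_from_prod_countable_left fun n =>
    Finset.measurable_fun_prod (Finset.range n) fun j _ => hj j

/-- `s ^ Z(t)`, written in terms of the trees of the children. -/
noncomputable def LifeTree.powZ (s t : ℝ) (T : LifeTree) : ℝ :=
  if t < (T []).1 then s else ∏ j ∈ Finset.range (T []).2, s ^ (T.child j).Z (t - (T []).1)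

lemma LifeTree.measurable_powZ (s t : ℝ) : Measurable (LifeTree.powZ s t) := by
  have hτ : Measurable fun T : LifeTree => (T []).1 :=
    measurable_fst.comp (measurable_pi_apply [])
  have hN : Measurable fun T : LifeTree => (T, (T []).2) :=
    measurable_id.prodMk (measurable_snd.comp (measurable_pi_apply []))
  have := (LifeTree.measurable_prod_pow_Z_child s t).comp hN
  exact Measurable.ite (measurableSet_lt measurable_const hτ) measurable_const this

lemma LifeTree.powZ_mem_Icc (hs : 0 ≤ s) (hs1 : s ≤ 1) (T : LifeTree) :
    LifeTree.powZ s t T ∈ Icc (0 : ℝ) 1 := by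
  unfold LifeTree.powZ
  split_ifs
  · exact ⟨hs, hs1⟩
  · exact ⟨Finset.prod_nonneg fun j _ => pow_nonneg hs _,
      Finset.prod_le_one (fun j _ => pow_nonneg hs _) fun j _ => pow_le_one₀ hs hs1⟩

/-- The renewal equation obtained by conditioning on the life of the initial particle. -/
lemma branchingF_eq_integral (hμ : 0 < μ) (hp : ∫⁻ n, (n : ENNReal) ∂p.toMeasure ≤ 1)
    (hs : 0 ≤ s) (hs1 : s ≤ 1) (ht : 0 ≤ t) : branchingF μ p t s =
      ∫ x, (if t < x then s else pgf p (branchingF μ p (t - x) s)) ∂(expMeasure μ) := by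
  have := isProbabilityMeasure_expMeasure hμ
  have := isProbabilityMeasure_treeLaw p hμ
  have hm := LifeTree.measurable_powZ s t
  have h1 : branchingF μ p t s = ∫ T, LifeTree.powZ s t T ∂(treeLaw μ p) := by
    refine integral_congr_ae ?_
    filter_upwards [ae_Z_eq p hμ hp ht] with T hT
    rw [hT, LifeTree.powZ]
    split_ifs
    · exact pow_one s
    · exact (Finset.prod_pow_eq_pow_sum _ _ _).symm
  have hint := integrable_of_mem_Icc
    (P := ((expMeasure μ).prod p.toMeasure).prod (Measure.infinitePi fun _ : ℕ => treeLaw μ p))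
    (hm.comp LifeTree.measurable_glue) fun x => LifeTree.powZ_mem_Icc hs hs1 _
  rw [h1, integral_treeLaw p hμ hm.stronglyMeasurable]
  refine (integral_prod _ hint).trans ((integral_prod _ hint.integral_prod_left).trans ?_)
  refine integral_congr_ae (ae_of_all _ fun x => ?_)
  by_cases hx : t < x
  · have h2 : ∀ (n : ℕ) c, LifeTree.powZ s t (LifeTree.glue (x, n) c) = s :=
      fun n c => if_pos hx
    simp [hx, h2]
  · have h2 : ∀ (n : ℕ) c, LifeTree.powZ s t (LifeTree.glue (x, n) c) =
        ∏ j ∈ Finset.range n, s ^ (c j).Z (t - x) := fun n c => if_neg hx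
    have h3 : ∀ n : ℕ, ∫ c, LifeTree.powZ s t (LifeTree.glue (x, n) c)
        ∂(Measure.infinitePi fun _ : ℕ => treeLaw μ p) = branchingF μ p (t - x) s ^ n := by
      intro n
      simp only [h2]
      exact integral_prod_child p hμ n (LifeTree.measurable_pow_Z_left s (t - x))
    have h := branchingF_mem_Icc p (t := t - x) hμ hs hs1
    simp only [Function.comp, h3, if_neg hx]
    exact integral_pow_toMeasure p h.1 h.2

lemma integral_expMeasure (hμ : 0 < μ) (g : ℝ → ℝ) :
    ∫ x, g x ∂(expMeasure μ) = ∫ x in Ioi 0, μ * Real.exp (-(μ * x)) * g x := by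
  have h1 : expMeasure μ =
      volume.withDensity fun x => ENNReal.ofReal (exponentialPDFReal μ x) := rfl
  rw [h1, integral_withDensity_eq_integral_toReal_smul
    (measurable_exponentialPDFReal μ).ennreal_ofReal
    (ae_of_all _ fun x => ENNReal.ofReal_lt_top), ← integral_Ici_eq_integral_Ioi,
    ← integral_indicator measurableSet_Ici]
  refine integral_congr_ae (ae_of_all _ fun x => ?_)
  have h2 : exponentialPDF μ x = ENNReal.ofReal (exponentialPDFReal μ x) := rfl
  simp only [← h2]
  by_cases hx : 0 ≤ x
  · simp only [exponentialPDF_of_nonneg hx, indicator_of_mem (mem_Ici.2 hx), smul_eq_mul]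
    rw [ENNReal.toReal_ofReal (by positivity)]
  · simp [exponentialPDF_of_neg (not_le.1 hx), hx]

/-- The substitution v = t - x and the factor exp(μt) remove t from the integrand of the renewal
equation. F thus becomes an exponential times a primitive, which gives regularity in t without any
path argument. -/
lemma exp_mul_branchingF (hμ : 0 < μ) (hp : ∫⁻ n, (n : ENNReal) ∂p.toMeasure ≤ 1)
    (hs : 0 ≤ s) (hs1 : s ≤ 1) (ht : 0 ≤ t) : Real.exp (μ * t) * branchingF μ p t s =
      s + ∫ v in (0 : ℝ)..t, μ * Real.exp (μ * v) * pgf p (branchingF μ p v s) := by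
  have hmeas := measurable_pgf_branchingF p p hμ hs hs1
  have hbd : ∀ v, pgf p (branchingF μ p v s) ∈ Icc (0 : ℝ) 1 := fun v => by
    have h := branchingF_mem_Icc p (t := v) hμ hs hs1
    exact ⟨pgf_nonneg p h.1, pgf_le_one p h.1 h.2⟩
  rw [branchingF_eq_integral p hμ hp hs hs1 ht, integral_expMeasure hμ]
  set G : ℝ → ℝ := fun x => μ * Real.exp (-(μ * x)) *
    (if t < x then s else pgf p (branchingF μ p (t - x) s)) with hG
  have hGm : Measurable G := by
    refine Measurable.mul (by fun_prop) (Measurable.ite measurableSet_Ioi measurable_const ?_)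
    exact hmeas.comp (measurable_const.sub measurable_id)
  have hexp : IntegrableOn (fun x => μ * Real.exp (-(μ * x))) (Ioi 0) := by
    have := (exp_neg_integrableOn_Ioi 0 hμ).const_mul μ
    simp only [neg_mul] at this
    exact this
  have hGi : IntegrableOn G (Ioi 0) := by
    refine hexp.mono' hGm.aestronglyMeasurable (ae_of_all _ fun x => ?_)
    rw [hG, Real.norm_eq_abs, abs_mul, abs_of_nonneg (by positivity)]
    refine mul_le_of_le_one_right (by positivity) ?_
    split_ifs
    · rw [abs_of_nonneg hs]; exact hs1
    · rw [abs_of_nonneg (hbd _).1]; exact (hbd _).2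
  have hsplit : ∫ x in Ioi 0, G x = (∫ x in (0 : ℝ)..t, G x) + ∫ x in Ioi t, G x := by
    rw [intervalIntegral.integral_of_le ht, ← setIntegral_union (Ioc_disjoint_Ioi le_rfl)
      measurableSet_Ioi (hGi.mono_set Ioc_subset_Ioi_self)
      (hGi.mono_set (Ioi_subset_Ioi ht)), Ioc_union_Ioi_eq_Ioi ht]
  -- The event that the initial particle outlives t contributes s times its probability.
  have htail : ∫ x in Ioi t, G x = s * Real.exp (-(μ * t)) := by
    have h1 : ∫ x in Ioi t, G x = ∫ x in Ioi t, s * μ * Real.exp (-μ * x) := by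
      refine setIntegral_congr_fun measurableSet_Ioi fun x hx => ?_
      have hx : t < x := hx
      simp only [hG, if_pos hx, neg_mul]
      ring
    rw [h1, integral_const_mul, integral_exp_mul_Ioi (neg_lt_zero.2 hμ)]
    field_simp
  have hhead : ∫ x in (0 : ℝ)..t, G x = Real.exp (-(μ * t)) *
      ∫ v in (0 : ℝ)..t, μ * Real.exp (μ * v) * pgf p (branchingF μ p v s) := by
    rw [← intervalIntegral.integral_const_mul]
    have h2 := intervalIntegral.integral_comp_sub_left (a := 0) (b := t) (fun v =>
      Real.exp (-(μ * t)) * (μ * Real.exp (μ * v) * pgf p (branchingF μ p v s))) t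
    rw [sub_self, sub_zero] at h2
    rw [← h2]
    refine intervalIntegral.integral_congr fun x hx => ?_
    rw [uIcc_of_le ht] at hx
    simp only [hG, if_neg (not_lt.2 hx.2)]
    have : Real.exp (-(μ * x)) = Real.exp (-(μ * t)) * Real.exp (μ * (t - x)) := by
      rw [← Real.exp_add]; congr 1; ring
    rw [this]
    ring
  rw [hsplit, htail, hhead]
  have he : Real.exp (μ * t) * Real.exp (-(μ * t)) = 1 := by
    rw [← Real.exp_add]; simp
  linear_combination (s + ∫ v in (0 : ℝ)..t, μ * Real.exp (μ * v) *
    pgf p (branchingF μ p v s)) * he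

end BranchingF

section BranchingF
variable {μ : ℝ} (p : PMF ℕ) {s t : ℝ}

lemma pgf_branchingF_mem_Icc (hμ : 0 < μ) (hs : 0 ≤ s) (hs1 : s ≤ 1) (v : ℝ) :
    pgf p (branchingF μ p v s) ∈ Icc (0 : ℝ) 1 := by
  have h := branchingF_mem_Icc p (t := v) hμ hs hs1
  exact ⟨pgf_nonneg p h.1, pgf_le_one p h.1 h.2⟩

lemma intervalIntegrable_pgf_branchingF (hμ : 0 < μ) (hs : 0 ≤ s) (hs1 : s ≤ 1) (a b : ℝ) :
    IntervalIntegrable (fun v => μ * Real.exp (μ * v) * pgf p (branchingF μ p v s))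
      volume a b := by
  have hc : IntervalIntegrable (fun v => μ * Real.exp (μ * v)) volume a b :=
    Continuous.intervalIntegrable (by fun_prop) _ _
  refine hc.mono_fun ?_ (ae_of_all _ fun v => ?_)
  · have := measurable_pgf_branchingF p p hμ hs hs1
    exact Measurable.aestronglyMeasurable (by fun_prop)
  · have h := pgf_branchingF_mem_Icc p hμ hs hs1 v
    dsimp only
    rw [norm_mul, Real.norm_eq_abs (pgf _ _), abs_of_nonneg h.1]
    exact mul_le_of_le_one_right (norm_nonneg _) h.2

lemma branchingF_eq (hμ : 0 < μ) (hp : ∫⁻ n, (n : ENNReal) ∂p.toMeasure ≤ 1)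
    (hs : 0 ≤ s) (hs1 : s ≤ 1) (ht : 0 ≤ t) : branchingF μ p t s = Real.exp (-(μ * t)) *
      (s + ∫ v in (0 : ℝ)..t, μ * Real.exp (μ * v) * pgf p (branchingF μ p v s)) := by
  rw [← exp_mul_branchingF p hμ hp hs hs1 ht, ← mul_assoc, ← Real.exp_add]
  simp

lemma branchingF_zero (hμ : 0 < μ) (hp : ∫⁻ n, (n : ENNReal) ∂p.toMeasure ≤ 1)
    (hs : 0 ≤ s) (hs1 : s ≤ 1) : branchingF μ p 0 s = s := by
  simp [branchingF_eq p hμ hp hs hs1 le_rfl]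

/-- Bounding f by 1 in the integral equation leaves exp(μt) F ≤ s + exp(μt) - 1, which is less than
exp(μt). -/
lemma branchingF_lt_one (hμ : 0 < μ) (hp : ∫⁻ n, (n : ENNReal) ∂p.toMeasure ≤ 1)
    (hs : 0 ≤ s) (hs1 : s < 1) (ht : 0 ≤ t) : branchingF μ p t s < 1 := by
  have h1 := exp_mul_branchingF p hμ hp hs hs1.le ht
  have h2 : ∫ v in (0 : ℝ)..t, μ * Real.exp (μ * v) * pgf p (branchingF μ p v s) ≤
      ∫ v in (0 : ℝ)..t, μ * Real.exp (μ * v) :=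
    intervalIntegral.integral_mono_on ht (intervalIntegrable_pgf_branchingF p hμ hs hs1.le 0 t)
      (Continuous.intervalIntegrable (by fun_prop) _ _) fun v _ =>
      mul_le_of_le_one_right (by positivity) (pgf_branchingF_mem_Icc p hμ hs hs1.le v).2
  have h3 : ∫ v in (0 : ℝ)..t, μ * Real.exp (μ * v) = Real.exp (μ * t) - 1 := by
    rw [intervalIntegral.integral_eq_sub_of_hasDerivAt (f := fun v => Real.exp (μ * v))]
    · simp
    · intro v _
      have := ((hasDerivAt_id v).const_mul μ).exp
      simpa [mul_comm] using this
    · exact Continuous.intervalIntegrable (by fun_prop) _ _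
  rw [h3] at h2
  have h4 := Real.exp_pos (μ * t)
  by_contra hcon
  push Not at hcon
  nlinarith

lemma continuousOn_branchingF (hμ : 0 < μ) (hp : ∫⁻ n, (n : ENNReal) ∂p.toMeasure ≤ 1)
    (hs : 0 ≤ s) (hs1 : s ≤ 1) : ContinuousOn (fun t => branchingF μ p t s) (Ici 0) := by
  have h := intervalIntegral.continuous_primitive
    (fun a b => intervalIntegrable_pgf_branchingF p hμ hs hs1 a b) 0
  have h2 : Continuous fun t => Real.exp (-(μ * t)) *
      (s + ∫ v in (0 : ℝ)..t, μ * Real.exp (μ * v) * pgf p (branchingF μ p v s)) := by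
    fun_prop
  exact h2.continuousOn.congr fun t ht => branchingF_eq p hμ hp hs hs1 ht

/-- A bootstrap: the integrand is bounded, so F is continuous; then the integrand is continuous and
the primitive is differentiable. -/
lemma hasDerivAt_branchingF (hμ : 0 < μ) (hp : ∫⁻ n, (n : ENNReal) ∂p.toMeasure ≤ 1)
    (hs : 0 ≤ s) (hs1 : s ≤ 1) (ht : 0 < t) : HasDerivAt (fun t => branchingF μ p t s)
      (μ * (pgf p (branchingF μ p t s) - branchingF μ p t s)) t := by
  have hcont : ContinuousAt (fun v => μ * Real.exp (μ * v) * pgf p (branchingF μ p v s)) t := by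
    have h1 : ContinuousOn (fun v => pgf p (branchingF μ p v s)) (Ici 0) :=
      (continuousOn_pgf p).comp (continuousOn_branchingF p hμ hp hs hs1)
        fun v _ => branchingF_mem_Icc p hμ hs hs1
    have h2 := h1.continuousAt (Ici_mem_nhds ht)
    exact ContinuousAt.mul (by fun_prop) h2
  have hint := intervalIntegrable_pgf_branchingF p hμ hs hs1 0 t
  have hmeas : StronglyMeasurable fun v => μ * Real.exp (μ * v) * pgf p (branchingF μ p v s) := by
    have := measurable_pgf_branchingF p p hμ hs hs1
    exact Measurable.stronglyMeasurable (by fun_prop)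
  have h1 := intervalIntegral.integral_hasDerivAt_right hint
    (hmeas.stronglyMeasurableAtFilter) hcont
  have h2 : HasDerivAt (fun t => Real.exp (-(μ * t))) (-μ * Real.exp (-(μ * t))) t := by
    have := ((hasDerivAt_id t).const_mul μ).neg.exp
    simpa [mul_comm] using this
  have h3 := h2.mul (h1.const_add s)
  refine (h3.congr_of_eventuallyEq ?_).congr_deriv ?_
  · filter_upwards [Ioi_mem_nhds ht] with v hv
    exact branchingF_eq p hμ hp hs hs1 (le_of_lt hv)
  · have h4 := branchingF_eq p hμ hp hs hs1 ht.le
    have he : Real.exp (-(μ * t)) * Real.exp (μ * t) = 1 := by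
      rw [← Real.exp_add]; simp
    linear_combination μ * pgf p (branchingF μ p t s) * he + μ * h4

lemma monotoneOn_branchingF (hμ : 0 < μ) (hp : ∫⁻ n, (n : ENNReal) ∂p.toMeasure ≤ 1)
    (hf : ∀ u : ℝ, 0 ≤ u → u < 1 → u < pgf p u) (hs : 0 ≤ s) (hs1 : s < 1) :
    MonotoneOn (fun t => branchingF μ p t s) (Ici 0) := by
  refine monotoneOn_of_deriv_nonneg (convex_Ici 0) (continuousOn_branchingF p hμ hp hs hs1.le)
    ?_ ?_
  · rw [interior_Ici]
    exact fun t ht => (hasDerivAt_branchingF p hμ hp hs hs1.le ht).differentiableAt.differentiableWithinAt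
  · rw [interior_Ici]
    intro t ht
    have ht : 0 < t := ht
    rw [(hasDerivAt_branchingF p hμ hp hs hs1.le ht).deriv]
    have h := hf _ (branchingF_mem_Icc p (t := t) hμ hs hs1.le).1
      (branchingF_lt_one p hμ hp hs hs1 ht.le)
    exact mul_nonneg hμ.le (by linarith)

lemma continuousOn_one_div_pgf_sub (hf : ∀ u : ℝ, 0 ≤ u → u < 1 → u < pgf p u) :
    ContinuousOn (fun u => 1 / (pgf p u - u)) (Ico 0 1) := by
  have h : ContinuousOn (fun u => pgf p u - u) (Ico 0 1) :=
    ((continuousOn_pgf p).mono Ico_subset_Icc_self).sub continuousOn_id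
  exact continuousOn_const.div h fun u hu => (sub_pos.2 (hf u hu.1 hu.2)).ne'

lemma intervalIntegrable_one_div_pgf_sub (hf : ∀ u : ℝ, 0 ≤ u → u < 1 → u < pgf p u)
    {a b : ℝ} (ha : a ∈ Ico (0 : ℝ) 1) (hb : b ∈ Ico (0 : ℝ) 1) :
    IntervalIntegrable (fun u => 1 / (pgf p u - u)) volume a b :=
  ((continuousOn_one_div_pgf_sub p hf).mono
    (ordConnected_Ico.uIcc_subset ha hb)).intervalIntegrable

/-- The integrated form of the backward equation `∂F/∂t = μ (f(F) - F)`. -/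
lemma Vfun_branchingF (hμ : 0 < μ) (hp : ∫⁻ n, (n : ENNReal) ∂p.toMeasure ≤ 1)
    (hf : ∀ u : ℝ, 0 ≤ u → u < 1 → u < pgf p u) (hs : 0 ≤ s) (hs1 : s < 1) (ht : 0 ≤ t) :
    Vfun p (1 / (1 - branchingF μ p t s)) = Vfun p (1 / (1 - s)) + μ * t := by
  have hF : ∀ v ∈ Icc 0 t, branchingF μ p v s ∈ Ico (0 : ℝ) 1 := fun v hv =>
    ⟨(branchingF_mem_Icc p hμ hs hs1.le).1, branchingF_lt_one p hμ hp hs hs1 hv.1⟩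
  have hcF : ContinuousOn (fun t => branchingF μ p t s) (Icc 0 t) :=
    (continuousOn_branchingF p hμ hp hs hs1.le).mono Icc_subset_Ici_self
  -- Substituting u = F(v; s) in ∫ du/(f(u) - u) cancels f(F) - F against the derivative of F, so
  -- the integrand becomes the constant μ.
  have hsub := intervalIntegral.integral_comp_mul_deriv'' (a := 0) (b := t)
    (f := fun t => branchingF μ p t s)
    (f' := fun t => μ * (pgf p (branchingF μ p t s) - branchingF μ p t s))
    (g := fun u => 1 / (pgf p u - u))
    (by rwa [uIcc_of_le ht])
    (fun v hv => by
      rw [min_eq_left ht] at hv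
      exact (hasDerivAt_branchingF p hμ hp hs hs1.le hv.1).hasDerivWithinAt)
    (by
      rw [uIcc_of_le ht]
      exact continuousOn_const.mul (((continuousOn_pgf p).comp hcF
        fun v hv => Ico_subset_Icc_self (hF v hv)).sub hcF))
    (by
      rw [uIcc_of_le ht]
      refine (continuousOn_one_div_pgf_sub p hf).mono ?_
      rintro _ ⟨v, hv, rfl⟩
      exact hF v hv)
  have hleft : ∫ v in (0 : ℝ)..t, ((fun u => 1 / (pgf p u - u)) ∘ fun t => branchingF μ p t s) v *
      (μ * (pgf p (branchingF μ p v s) - branchingF μ p v s)) = ∫ v in (0 : ℝ)..t, μ := by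
    refine intervalIntegral.integral_congr fun v hv => ?_
    rw [uIcc_of_le ht] at hv
    have h := hF v hv
    have := (sub_pos.2 (hf _ h.1 h.2)).ne'
    simp only [Function.comp]
    field_simp
  rw [hleft, branchingF_zero p hμ hp hs hs1.le, intervalIntegral.integral_const, sub_zero,
    smul_eq_mul] at hsub
  have hFt := hF t ⟨ht, le_rfl⟩
  have e : ∀ x : ℝ, 1 - 1 / (1 / (1 - x)) = x := fun x => by rw [one_div_one_div]; ring
  rw [Vfun, Vfun, e, e, ← intervalIntegral.integral_add_adjacent_intervals
    (intervalIntegrable_one_div_pgf_sub p hf ⟨le_rfl, one_pos⟩ ⟨hs, hs1⟩)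
    (intervalIntegrable_one_div_pgf_sub p hf ⟨hs, hs1⟩ hFt), ← hsub]
  ring

/-! ### The function `V` -/

lemma one_sub_one_div_mem_Ico {x : ℝ} (hx : 1 ≤ x) : 1 - 1 / x ∈ Ico (0 : ℝ) 1 := by
  have h0 : 0 < x := by linarith
  have h1 : 1 / x ≤ 1 := (div_le_one h0).2 hx
  have h2 : 0 < 1 / x := by positivity
  constructor <;> linarith

lemma strictMonoOn_Vfun (hf : ∀ u : ℝ, 0 ≤ u → u < 1 → u < pgf p u) :
    StrictMonoOn (Vfun p) (Ici 1) := by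
  intro x hx y hy hxy
  have hx' := one_sub_one_div_mem_Ico (mem_Ici.1 hx)
  have hy' := one_sub_one_div_mem_Ico (mem_Ici.1 hy)
  have hlt : 1 - 1 / x < 1 - 1 / y := by
    have : 0 < x := by linarith [mem_Ici.1 hx]
    have := one_div_lt_one_div_of_lt this hxy
    linarith
  rw [Vfun, Vfun, ← intervalIntegral.integral_add_adjacent_intervals
    (intervalIntegrable_one_div_pgf_sub p hf ⟨le_rfl, one_pos⟩ hx')
    (intervalIntegrable_one_div_pgf_sub p hf hx' hy')]
  have : 0 < ∫ u in (1 - 1 / x)..(1 - 1 / y), 1 / (pgf p u - u) :=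
    intervalIntegral.intervalIntegral_pos_of_pos_on
      (intervalIntegrable_one_div_pgf_sub p hf hx' hy')
      (fun u hu => one_div_pos.2 (sub_pos.2 (hf u (hx'.1.trans hu.1.le) (hu.2.trans hy'.2)))) hlt
  linarith

lemma Vfun_one : Vfun p 1 = 0 := by simp [Vfun]

/-- Since V(1/(1-F(t;0))) = μt and V is injective on [1, ∞), the value picked by `invFunOn` is
forced. Thus W(μt) is the inverse survival probability. -/
lemma Wfun_mul (hμ : 0 < μ) (hp : ∫⁻ n, (n : ENNReal) ∂p.toMeasure ≤ 1)
    (hf : ∀ u : ℝ, 0 ≤ u → u < 1 → u < pgf p u) (ht : 0 ≤ t) :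
    Wfun p (μ * t) = 1 / (1 - branchingF μ p t 0) := by
  have hV := Vfun_branchingF p hμ hp hf le_rfl one_pos ht
  have h1 : Vfun p (1 / (1 - 0)) = 0 := by simp [Vfun_one]
  rw [h1, zero_add] at hV
  have hF1 := branchingF_lt_one p hμ hp le_rfl one_pos ht
  have hF0 := (branchingF_mem_Icc p (t := t) hμ le_rfl zero_le_one).1
  have hmem : 1 / (1 - branchingF μ p t 0) ∈ Ici (1 : ℝ) := by
    rw [mem_Ici, le_div_iff₀ (by linarith)]; linarith
  have hex : ∃ x ∈ Ici (1 : ℝ), Vfun p x = μ * t := ⟨_, hmem, hV⟩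
  have h2 := Function.invFunOn_mem hex
  have h3 := Function.invFunOn_eq hex
  exact (strictMonoOn_Vfun p hf).injOn h2 hmem (h3.trans hV.symm)

end BranchingF

/-! ### The generating functional of a Poisson process -/

lemma abs_mul_sub_mul_le {a b a' b' : ℝ} (ha : a ∈ Icc (0 : ℝ) 1) (hb' : b' ∈ Icc (0 : ℝ) 1) :
    |a * b - a' * b'| ≤ |a - a'| + |b - b'| := by
  have e : a * b - a' * b' = a * (b - b') + (a - a') * b' := by ring
  rw [e]
  refine (abs_add_le _ _).trans ?_
  rw [abs_mul, abs_mul, abs_of_nonneg ha.1, abs_of_nonneg hb'.1, add_comm]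
  exact add_le_add (mul_le_of_le_one_right (abs_nonneg _) hb'.2)
    (mul_le_of_le_one_left (abs_nonneg _) ha.2)

lemma prod_mem_Icc_zero_one {ι : Type*} {s : Finset ι} {a : ι → ℝ}
    (ha : ∀ i ∈ s, a i ∈ Icc (0 : ℝ) 1) : ∏ i ∈ s, a i ∈ Icc (0 : ℝ) 1 :=
  ⟨Finset.prod_nonneg fun i hi => (ha i hi).1,
    Finset.prod_le_one (fun i hi => (ha i hi).1) fun i hi => (ha i hi).2⟩

lemma abs_prod_sub_prod_le {ι : Type*} {s : Finset ι} {a b : ι → ℝ}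
    (ha : ∀ i ∈ s, a i ∈ Icc (0 : ℝ) 1) (hb : ∀ i ∈ s, b i ∈ Icc (0 : ℝ) 1) :
    |∏ i ∈ s, a i - ∏ i ∈ s, b i| ≤ ∑ i ∈ s, |a i - b i| := by
  classical
  induction s using Finset.induction_on with
  | empty => simp
  | insert i s hi ih =>
    rw [Finset.prod_insert hi, Finset.prod_insert hi, Finset.sum_insert hi]
    have ha' : ∀ j ∈ s, a j ∈ Icc (0 : ℝ) 1 := fun j hj => ha j (Finset.mem_insert_of_mem hj)
    have hb' : ∀ j ∈ s, b j ∈ Icc (0 : ℝ) 1 := fun j hj => hb j (Finset.mem_insert_of_mem hj)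
    exact (abs_mul_sub_mul_le (ha i (Finset.mem_insert_self i s)) (prod_mem_Icc_zero_one hb')).trans
      (add_le_add le_rfl (ih ha' hb'))

lemma integral_pow_poissonMeasure (m : ℝ≥0) (x : ℝ) :
    ∫ k, x ^ k ∂(poissonMeasure m) = Real.exp (-(m * (1 - x))) := by
  rw [integral_poissonMeasure]
  have h : ∀ k : ℕ, (Real.exp (-(m : ℝ)) * (m : ℝ) ^ k / (k.factorial : ℝ)) • x ^ k =
      Real.exp (-(m : ℝ)) * ((m * x) ^ k / (k.factorial : ℝ)) := by
    intro k
    rw [mul_pow, smul_eq_mul]; ring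
  simp_rw [h]
  rw [tsum_mul_left, ← NormedSpace.exp_eq_tsum_div (𝔸 := ℝ) |> congrFun <| (m * x : ℝ),
    ← Real.exp_eq_exp_ℝ, ← Real.exp_add]
  congr 1
  ring

lemma ProbabilityTheory.iIndepFun.integral_finsetProd {Ω ι : Type*} [MeasurableSpace Ω]
    {P : Measure Ω} {X : ι → Ω → ℝ} (hX : iIndepFun X P) (hm : ∀ i, Measurable (X i))
    (s : Finset ι) : ∫ ω, ∏ i ∈ s, X i ω ∂P = ∏ i ∈ s, ∫ ω, X i ω ∂P := by
  have h := (hX.precomp (g := fun i : s => (i : ι)) Subtype.val_injective).integral_fun_prod_eq_prod_integral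
    (fun i => (hm i).aestronglyMeasurable)
  rw [← Finset.prod_coe_sort s fun i => ∫ ω, X i ω ∂P, ← h]
  refine integral_congr_ae (ae_of_all _ fun ω => ?_)
  exact (Finset.prod_coe_sort s fun i => X i ω).symm

section Poisson
variable {Ω : Type*} {r : ℝ → ℝ} {ν : ℝ≥0 → Ω → ℕ}

/-- The left endpoint must be admitted: the infimum may be a if level k is reached immediately after
a, since only monotone paths are assumed. -/
lemma jumpTime_mem_Icc (hmono : ∀ ω, Monotone fun t => ν t ω) {a b : ℝ≥0} {k : ℕ} {ω : Ω}
    (hk : k ∈ Finset.Ioc (ν a ω) (ν b ω)) : jumpTime ν k ω ∈ Icc a b := by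
  rw [Finset.mem_Ioc] at hk
  have hmem : b ∈ {u : ℝ≥0 | k ≤ ν u ω} := hk.2
  refine ⟨le_csInf ⟨b, hmem⟩ fun u hu => ?_, csInf_le (OrderBot.bddBelow _) hmem⟩
  by_contra hcon
  have h1 : ν u ω ≤ ν a ω := hmono ω (not_le.1 hcon).le
  have h2 : k ≤ ν u ω := hu
  omega

/-- Approximation of the product over the jump points by a product over a partition. -/
lemma abs_prod_pow_sub_prod_jumpTime_le (hmono : ∀ ω, Monotone fun t => ν t ω)
    (hzero : ∀ ω, ν 0 ω = 0) {h : ℝ → ℝ} (hh : ∀ u, h u ∈ Icc (0 : ℝ) 1) {τ : ℕ → ℝ≥0}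
    (hτ : Monotone τ) (hτ0 : τ 0 = 0) {ε : ℝ} {n : ℕ}
    (hε : ∀ i < n, ∀ u ∈ Icc (τ i) (τ (i + 1)), |h (τ (i + 1)) - h u| ≤ ε) (ω : Ω) :
    |∏ i ∈ Finset.range n, h (τ (i + 1)) ^ (ν (τ (i + 1)) ω - ν (τ i) ω) -
      ∏ k ∈ Finset.Icc 1 (ν (τ n) ω), h (jumpTime ν k ω)| ≤ ν (τ n) ω * ε := by
  induction n with
  | zero => simp [hτ0, hzero]
  | succ n ih =>
    have hle : ν (τ n) ω ≤ ν (τ (n + 1)) ω := hmono ω (hτ n.le_succ)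
    have hsplit : ∏ k ∈ Finset.Icc 1 (ν (τ (n + 1)) ω), h (jumpTime ν k ω) =
        (∏ k ∈ Finset.Icc 1 (ν (τ n) ω), h (jumpTime ν k ω)) *
          ∏ k ∈ Finset.Ioc (ν (τ n) ω) (ν (τ (n + 1)) ω), h (jumpTime ν k ω) := by
      have e : ∀ m : ℕ, Finset.Icc 1 m = Finset.Ioc 0 m := fun m => rfl
      rw [e, e, Finset.prod_Ioc_consecutive _ (Nat.zero_le _) hle]
    have hpow : h (τ (n + 1)) ^ (ν (τ (n + 1)) ω - ν (τ n) ω) =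
        ∏ k ∈ Finset.Ioc (ν (τ n) ω) (ν (τ (n + 1)) ω), h (τ (n + 1)) := by
      simp
    rw [Finset.prod_range_succ, hsplit]
    refine (abs_mul_sub_mul_le (prod_mem_Icc_zero_one fun i _ => ⟨pow_nonneg (hh _).1 _,
      pow_le_one₀ (hh _).1 (hh _).2⟩) (prod_mem_Icc_zero_one fun k _ => hh _)).trans ?_
    have h1 := ih fun i hi => hε i (hi.trans n.lt_succ_self)
    have h2 : |h (τ (n + 1)) ^ (ν (τ (n + 1)) ω - ν (τ n) ω) -
        ∏ k ∈ Finset.Ioc (ν (τ n) ω) (ν (τ (n + 1)) ω), h (jumpTime ν k ω)| ≤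
        (ν (τ (n + 1)) ω - ν (τ n) ω : ℕ) * ε := by
      rw [hpow]
      refine (abs_prod_sub_prod_le (fun _ _ => hh _) fun _ _ => hh _).trans ?_
      refine (Finset.sum_le_card_nsmul _ _ ε fun k hk =>
        hε n n.lt_succ_self _ (jumpTime_mem_Icc hmono hk)).trans ?_
      simp
    rw [Nat.cast_sub hle] at h2
    linarith

/-- Error of a Riemann–Stieltjes sum against r(u) du: the oscillation of h on each cell, weighted by
the mass of r. -/
lemma abs_sum_integral_sub_le {t : ℝ} {h : ℝ → ℝ} {τ : ℕ → ℝ} (hτ : Monotone τ) (hτ0 : τ 0 = 0)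
    {ε : ℝ} {n : ℕ} (hτn : τ n = t) (hr0 : ∀ u, 0 ≤ u → 0 ≤ r u)
    (hr : IntervalIntegrable r volume 0 t) (hh : ContinuousOn h (Icc 0 t))
    (hε : ∀ i < n, ∀ u ∈ Icc (τ i) (τ (i + 1)), |h (τ (i + 1)) - h u| ≤ ε) :
    |∑ i ∈ Finset.range n, (∫ u in (τ i)..(τ (i + 1)), r u) * (1 - h (τ (i + 1))) -
      ∫ u in (0 : ℝ)..t, r u * (1 - h u)| ≤ ε * ∫ u in (0 : ℝ)..t, r u := by
  have hτnn : ∀ i, 0 ≤ τ i := fun i => hτ0 ▸ hτ (Nat.zero_le i)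
  have ht : 0 ≤ t := hτn ▸ hτnn n
  have hsub : ∀ i < n, uIcc (τ i) (τ (i + 1)) ⊆ uIcc 0 t := by
    intro i hi
    rw [uIcc_of_le (hτ i.le_succ), uIcc_of_le ht]
    exact Icc_subset_Icc (hτnn i) (hτn ▸ hτ hi)
  have hri : ∀ i < n, IntervalIntegrable r volume (τ i) (τ (i + 1)) := fun i hi =>
    hr.mono_set (hsub i hi)
  have hrh : IntervalIntegrable (fun u => r u * (1 - h u)) volume 0 t :=
    hr.mul_continuousOn (continuousOn_const.sub (by rwa [uIcc_of_le ht]))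
  have hrhi : ∀ i < n, IntervalIntegrable (fun u => r u * (1 - h u)) volume (τ i) (τ (i + 1)) :=
    fun i hi => hrh.mono_set (hsub i hi)
  have e1 := intervalIntegral.sum_integral_adjacent_intervals hri
  have e2 := intervalIntegral.sum_integral_adjacent_intervals hrhi
  rw [hτ0, hτn] at e1 e2
  rw [← e1, ← e2, ← Finset.sum_sub_distrib, Finset.mul_sum]
  refine (Finset.abs_sum_le_sum_abs _ _).trans (Finset.sum_le_sum fun i hi => ?_)
  have hi := Finset.mem_range.1 hi
  rw [← intervalIntegral.integral_mul_const, ← intervalIntegral.integral_sub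
    ((hri i hi).mul_const _) (hrhi i hi), ← intervalIntegral.integral_const_mul]
  refine (intervalIntegral.abs_integral_le_integral_abs (hτ i.le_succ)).trans ?_
  refine intervalIntegral.integral_mono_on (hτ i.le_succ)
    (((hri i hi).mul_const _).sub (hrhi i hi)).abs ((hri i hi).const_mul _) fun u hu => ?_
  have h1 := hε i hi u hu
  have h2 := hr0 u ((hτnn i).trans hu.1)
  have e : r u * (1 - h (τ (i + 1))) - r u * (1 - h u) = -(r u * (h (τ (i + 1)) - h u)) := by ring
  rw [e, abs_neg, abs_mul, abs_of_nonneg h2, mul_comm]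
  exact mul_le_mul_of_nonneg_right h1 h2

/-- The generating functional of a Poisson process. -/
theorem IsPoissonProcess.integral_prod_jumpTime [MeasurableSpace Ω] {P : Measure Ω}
    [IsProbabilityMeasure P]
    (hν : IsPoissonProcess r ν P) (hr0 : ∀ u, 0 ≤ u → 0 ≤ r u)
    (t : ℝ≥0) (hr : IntervalIntegrable r volume 0 t) {h : ℝ → ℝ} (hh : ∀ u, h u ∈ Icc (0 : ℝ) 1)
    (hc : ContinuousOn h (Icc 0 t)) :
    ∫ ω, ∏ k ∈ Finset.Icc 1 (ν t ω), h (jumpTime ν k ω) ∂P =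
      Real.exp (-∫ u in (0 : ℝ)..t, r u * (1 - h u)) := by
  -- The partition of [0, t] into n + 1 equal cells; beyond index n + 1 the points go on, which
  -- keeps `τ n` monotone on all of ℕ.
  set τ : ℕ → ℕ → ℝ≥0 := fun n i => i * (t / (n + 1)) with hτdef
  have hτ : ∀ n, Monotone (τ n) := fun n i j hij => by
    simp only [hτdef]; gcongr
  have hτ0 : ∀ n, τ n 0 = 0 := fun n => by simp [hτdef]
  have hτn : ∀ n, τ n (n + 1) = t := fun n => by
    simp only [hτdef]; push_cast; field_simp
  have hunif := isCompact_Icc.uniformContinuousOn_of_continuous hc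
  have hmesh : ∀ ε > 0, ∀ᶠ n : ℕ in atTop, ∀ i < n + 1, ∀ u : ℝ,
      (τ n i : ℝ) ≤ u → u ≤ τ n (i + 1) → |h (τ n (i + 1)) - h u| ≤ ε := by
    intro ε hε
    obtain ⟨δ, hδ, H⟩ := Metric.uniformContinuousOn_iff.1 hunif ε hε
    have hlim : Tendsto (fun n : ℕ => (t : ℝ) / (n + 1)) atTop (𝓝 0) := by
      have := tendsto_one_div_add_atTop_nhds_zero_nat.const_mul (t : ℝ)
      simpa [div_eq_mul_inv] using this
    filter_upwards [hlim.eventually (gt_mem_nhds hδ)] with n hn i hi u hu1 hu2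
    have h1 : (τ n (i + 1) : ℝ) ≤ t := by
      rw [← hτn n]; exact_mod_cast hτ n hi
    have h2 : (τ n (i + 1) : ℝ) = τ n i + t / (n + 1) := by
      simp only [hτdef]; push_cast; ring
    have h3 : (0 : ℝ) ≤ τ n i := NNReal.coe_nonneg _
    have := H (τ n (i + 1)) ⟨NNReal.coe_nonneg _, h1⟩ u ⟨by linarith, by linarith⟩
      (by rw [Real.dist_eq, abs_of_nonneg (by linarith)]; linarith)
    exact this.le
  -- Replacing h(S_k) by the value of h at the right end of its cell leaves a product over
  -- independent Poisson increments. The integral of A is computed exactly and its limit is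
  -- identified in two ways.
  set A : ℕ → Ω → ℝ := fun n ω => ∏ i ∈ Finset.range (n + 1),
    h (τ n (i + 1)) ^ (ν (τ n (i + 1)) ω - ν (τ n i) ω) with hA
  have hXm : ∀ n i, Measurable fun ω => ν (τ n (i + 1)) ω - ν (τ n i) ω := fun n i =>
    (hν.measurable _).sub (hν.measurable _)
  have hfm : ∀ n i, Measurable fun ω => h (τ n (i + 1)) ^ (ν (τ n (i + 1)) ω - ν (τ n i) ω) :=
    fun n i => by
      have := (measurable_from_top (f := fun m : ℕ => h (τ n (i + 1)) ^ m)).comp (hXm n i)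
      exact this
  have hAm : ∀ n, Measurable (A n) := fun n => Finset.measurable_fun_prod _ fun i _ => hfm n i
  have hAb : ∀ n ω, A n ω ∈ Icc (0 : ℝ) 1 := fun n ω => prod_mem_Icc_zero_one fun i _ =>
    ⟨pow_nonneg (hh _).1 _, pow_le_one₀ (hh _).1 (hh _).2⟩
  have hlim1 : Tendsto (fun n => ∫ ω, A n ω ∂P) atTop
      (𝓝 (∫ ω, ∏ k ∈ Finset.Icc 1 (ν t ω), h (jumpTime ν k ω) ∂P)) := by
    refine tendsto_integral_of_dominated_convergence (fun _ => 1)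
      (fun n => (hAm n).aestronglyMeasurable) (integrable_const 1)
      (fun n => ae_of_all _ fun ω => ?_) (ae_of_all _ fun ω => ?_)
    · rw [Real.norm_eq_abs, abs_of_nonneg (hAb n ω).1]; exact (hAb n ω).2
    · rw [Metric.tendsto_nhds]
      intro ε hε
      have hpos : (0 : ℝ) < ν t ω + 1 := by positivity
      -- The mesh may depend on ω: pointwise convergence is enough, because A is bounded by 1.
      filter_upwards [hmesh (ε / (ν t ω + 1)) (by positivity)] with n hn
      have h1 := abs_prod_pow_sub_prod_jumpTime_le hν.mono hν.zero hh (hτ n) (hτ0 n)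
        (ε := ε / (ν t ω + 1)) (n := n + 1)
        (fun i hi u hu => hn i hi u (by exact_mod_cast hu.1) (by exact_mod_cast hu.2)) ω
      rw [hτn n] at h1
      refine lt_of_le_of_lt h1 ?_
      rw [mul_div_assoc', div_lt_iff₀ hpos]
      nlinarith
  have hAint : ∀ n, ∫ ω, A n ω ∂P = Real.exp (-∑ i ∈ Finset.range (n + 1),
      (∫ u in (τ n i : ℝ)..(τ n (i + 1)), r u) * (1 - h (τ n (i + 1)))) := by
    intro n
    have hind := (hν.indepIncrements.nat (hτ n)).comp (fun i m => h (τ n (i + 1)) ^ m)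
      (fun i => measurable_from_top)
    have hprod := hind.integral_finsetProd (fun i => hfm n i) (Finset.range (n + 1))
    refine hprod.trans ?_
    rw [← Finset.sum_neg_distrib, Real.exp_sum]
    refine Finset.prod_congr rfl fun i _ => ?_
    have hle : τ n i ≤ τ n (i + 1) := hτ n i.le_succ
    have hmi : 0 ≤ ∫ u in (τ n i : ℝ)..(τ n (i + 1)), r u :=
      intervalIntegral.integral_nonneg (by exact_mod_cast hle)
        fun u hu => hr0 u ((NNReal.coe_nonneg _).trans hu.1)
    have hlaw := hν.law _ _ hle
    have := integral_map (μ := P) (hXm n i).aemeasurable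
      (f := fun m : ℕ => h (τ n (i + 1)) ^ m) measurable_from_top.aestronglyMeasurable
    rw [hlaw, integral_pow_poissonMeasure, Real.coe_toNNReal _ hmi] at this
    exact this.symm
  have hlim2 : Tendsto (fun n => ∫ ω, A n ω ∂P) atTop
      (𝓝 (Real.exp (-∫ u in (0 : ℝ)..t, r u * (1 - h u)))) := by
    simp_rw [hAint]
    refine (Real.continuous_exp.tendsto _).comp (Tendsto.neg ?_)
    have hR : 0 ≤ ∫ u in (0 : ℝ)..t, r u :=
      intervalIntegral.integral_nonneg t.2 fun u hu => hr0 u hu.1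
    rw [Metric.tendsto_nhds]
    intro ε hε
    filter_upwards [hmesh (ε / ((∫ u in (0 : ℝ)..t, r u) + 1)) (by positivity)] with n hn
    have h1 := abs_sum_integral_sub_le (τ := fun i => (τ n i : ℝ)) (n := n + 1) (h := h)
      (fun i j hij => by exact_mod_cast hτ n hij) (by simp [hτ0]) (by simp [hτn]) hr0 hr hc
      (fun i hi u hu => hn i hi u hu.1 hu.2)
    refine lt_of_le_of_lt h1 ?_
    rw [div_mul_eq_mul_div, div_lt_iff₀ (by positivity)]
    nlinarith
  exact tendsto_nhds_unique hlim1 hlim2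

end Poisson

/-! ### Immigration times and Y(t) as measurable functionals -/

/-- The first passage time over level `k`, capped at `t`, as a measurable functional of the path. -/
noncomputable def cappedPassage (t : ℝ≥0) (x : ℝ≥0 → ℕ) (k : ℕ) : ℝ :=
  (min (t : ENNReal) (⨅ q : ℚ≥0, if k ≤ x (q : ℝ≥0) then ((q : ℝ≥0) : ENNReal) else ⊤)).toReal

lemma measurable_cappedPassage (t : ℝ≥0) (k : ℕ) : Measurable fun x => cappedPassage t x k := by
  refine Measurable.ennreal_toReal (measurable_const.min (Measurable.iInf fun q => ?_))
  exact Measurable.ite (measurableSet_le measurable_const (measurable_pi_apply _))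
    measurable_const measurable_const

lemma NNReal.exists_nnrat_btwn {a b : ℝ≥0} (h : a < b) : ∃ q : ℚ≥0, a < q ∧ (q : ℝ≥0) < b := by
  obtain ⟨q, hq1, hq2⟩ := _root_.exists_rat_btwn (show (a : ℝ) < b from h)
  have hq0 : (0 : ℚ) ≤ q := by
    have : (0 : ℝ) ≤ q := a.2.trans hq1.le
    exact_mod_cast this
  lift q to ℚ≥0 using hq0
  exact ⟨q, by rw [← NNReal.coe_lt_coe]; exact_mod_cast hq1,
    by rw [← NNReal.coe_lt_coe]; exact_mod_cast hq2⟩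

/-- For monotone paths the infimum over rational times is the infimum over all times, and the cap is
inactive when level k is reached by t. The countable form is measurable for the product σ-algebra on
paths, on which the independence of ν is stated. -/
lemma cappedPassage_eq_jumpTime {Ω : Type*} {ν : ℝ≥0 → Ω → ℕ}
    (hmono : ∀ ω, Monotone fun t => ν t ω) {t : ℝ≥0} {ω : Ω} {k : ℕ} (hk : k ≤ ν t ω) :
    cappedPassage t (fun u => ν u ω) k = jumpTime ν k ω := by
  have hle : jumpTime ν k ω ≤ t := csInf_le (OrderBot.bddBelow _) hk
  have hlow : ∀ u : ℝ≥0, k ≤ ν u ω → jumpTime ν k ω ≤ u :=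
    fun u hu => csInf_le (OrderBot.bddBelow _) hu
  have key : min (t : ENNReal)
      (⨅ q : ℚ≥0, if k ≤ ν (q : ℝ≥0) ω then ((q : ℝ≥0) : ENNReal) else ⊤) = jumpTime ν k ω := by
    apply le_antisymm
    · by_contra hcon
      rw [not_le] at hcon
      obtain ⟨b, hb1, hb2⟩ := ENNReal.lt_iff_exists_nnreal_btwn.1 hcon
      rw [ENNReal.coe_lt_coe] at hb1
      obtain ⟨u, hu, hub⟩ := exists_lt_of_csInf_lt ⟨t, hk⟩ hb1
      obtain ⟨q, hq1, hq2⟩ := NNReal.exists_nnrat_btwn hub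
      have hq : k ≤ ν (q : ℝ≥0) ω := le_trans hu (hmono ω hq1.le)
      have h1 : (⨅ q : ℚ≥0, if k ≤ ν (q : ℝ≥0) ω then ((q : ℝ≥0) : ENNReal) else ⊤) ≤
          ((q : ℝ≥0) : ENNReal) := (iInf_le _ q).trans_eq (if_pos hq)
      have h2 := hb2.trans_le ((min_le_right _ _).trans h1)
      rw [ENNReal.coe_lt_coe] at h2
      exact absurd hq2 (not_lt.2 h2.le)
    · refine le_min (by exact_mod_cast hle) (le_iInf fun q => ?_)
      split_ifs with h
      · exact_mod_cast hlow _ h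
      · exact le_top
  rw [cappedPassage, key]
  rfl

/-- The sum defining `Y(t)`, for given immigration times and family trees. -/
noncomputable def immigrationSum (t : ℝ) (n : ℕ) (σ : ℕ → ℝ) (i : ℕ → ℕ) (T : ℕ × ℕ → LifeTree) :
    ℕ :=
  ∑ k ∈ Finset.Icc 1 n, ∑ j ∈ Finset.Icc 1 (i k), (T (k, j)).Z (t - σ k)

/-- The random ranges of summation are handled by viewing each bound as a countable extra coordinate
and fixing it. Joint measurability is what Fubini needs below. -/
lemma measurable_immigrationSum (t : ℝ) :
    Measurable fun x : (ℕ × (ℕ → ℝ)) × ((ℕ → ℕ) × (ℕ × ℕ → LifeTree)) =>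
      immigrationSum t x.1.1 x.1.2 x.2.1 x.2.2 := by
  have hZ : ∀ k j, Measurable fun y : (ℕ → ℝ) × (ℕ × ℕ → LifeTree) =>
      (y.2 (k, j)).Z (t - y.1 k) := by
    intro k j
    have h1 : Measurable fun y : (ℕ → ℝ) × (ℕ × ℕ → LifeTree) => (y.2 (k, j), t - y.1 k) :=
      ((measurable_pi_apply (k, j)).comp measurable_snd).prodMk
        (measurable_const.sub ((measurable_pi_apply k).comp measurable_fst))
    have := LifeTree.measurable_Z.comp h1
    exact this
  have hin : ∀ k, Measurable fun z : ((ℕ → ℝ) × (ℕ × ℕ → LifeTree)) × ℕ =>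
      ∑ j ∈ Finset.Icc 1 z.2, (z.1.2 (k, j)).Z (t - z.1.1 k) := fun k =>
    measurable_from_prod_countable_left fun n =>
      Finset.measurable_fun_sum (Finset.Icc 1 n) fun j _ => hZ k j
  have hk : ∀ k, Measurable fun y : (ℕ → ℝ) × ((ℕ → ℕ) × (ℕ × ℕ → LifeTree)) =>
      ∑ j ∈ Finset.Icc 1 (y.2.1 k), (y.2.2 (k, j)).Z (t - y.1 k) := by
    intro k
    have h1 : Measurable fun y : (ℕ → ℝ) × ((ℕ → ℕ) × (ℕ × ℕ → LifeTree)) =>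
        ((y.1, y.2.2), y.2.1 k) :=
      (measurable_fst.prodMk (measurable_snd.comp measurable_snd)).prodMk
        ((measurable_pi_apply k).comp (measurable_fst.comp measurable_snd))
    have := (hin k).comp h1
    exact this
  have hn : Measurable fun z : ((ℕ → ℝ) × ((ℕ → ℕ) × (ℕ × ℕ → LifeTree))) × ℕ =>
      ∑ k ∈ Finset.Icc 1 z.2, ∑ j ∈ Finset.Icc 1 (z.1.2.1 k), (z.1.2.2 (k, j)).Z (t - z.1.1 k) :=
    measurable_from_prod_countable_left fun n =>
      Finset.measurable_fun_sum (Finset.Icc 1 n) fun k _ => hk k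
  have h1 : Measurable fun x : (ℕ × (ℕ → ℝ)) × ((ℕ → ℕ) × (ℕ × ℕ → LifeTree)) =>
      ((x.1.2, x.2), x.1.1) :=
    ((measurable_snd.comp measurable_fst).prodMk measurable_snd).prodMk
      (measurable_fst.comp measurable_fst)
  have := hn.comp h1
  exact this

/-! ### The generating function of Y(t) -/

section Model
variable {Ω : Type*} {μ : ℝ} {p b : PMF ℕ} {r : ℝ → ℝ}
  {ν : ℝ≥0 → Ω → ℕ} {I : ℕ → Ω → ℕ} {T : ℕ × ℕ → Ω → LifeTree}

/-- The number of immigration events and the immigration times up to time `t`. -/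
noncomputable def immigrationTimes (ν : ℝ≥0 → Ω → ℕ) (t : ℝ≥0) (ω : Ω) : ℕ × (ℕ → ℝ) :=
  (ν t ω, fun k => cappedPassage t (fun u => ν u ω) k)

lemma immigrationTimes_snd_eq (hmono : ∀ ω, Monotone fun t => ν t ω) {t : ℝ≥0} {ω : Ω} {k : ℕ}
    (hk : k ∈ Finset.Icc 1 (ν t ω)) : (immigrationTimes ν t ω).2 k = jumpTime ν k ω :=
  cappedPassage_eq_jumpTime hmono (Finset.mem_Icc.1 hk).2

lemma immigrationY_eq (hmono : ∀ ω, Monotone fun t => ν t ω) (t : ℝ≥0) (ω : Ω) :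
    immigrationY ν I T t ω = immigrationSum t (immigrationTimes ν t ω).1
      (immigrationTimes ν t ω).2 (fun k => I k ω) (fun kj => T kj ω) := by
  refine Finset.sum_congr rfl fun k hk => Finset.sum_congr rfl fun j _ => ?_
  rw [immigrationTimes_snd_eq hmono hk]

variable [MeasurableSpace Ω] {P : Measure Ω}

namespace IsImmigrationModel

lemma measurable_immigrationTimes (hM : IsImmigrationModel μ p b r ν I T P) (t : ℝ≥0) :
    Measurable (immigrationTimes ν t) := by
  have h1 : Measurable fun ω u => ν u ω := measurable_pi_lambda _ fun u => hM.poisson.measurable u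
  have h2 : ∀ k, Measurable fun ω => cappedPassage t (fun u => ν u ω) k := fun k => by
    have := (measurable_cappedPassage t k).comp h1
    exact this
  exact (hM.poisson.measurable t).prodMk (measurable_pi_lambda _ h2)

lemma measurable_immigrants (hM : IsImmigrationModel μ p b r ν I T P) :
    Measurable fun ω => ((fun k => I k ω), (fun kj => T kj ω)) :=
  (measurable_pi_lambda _ fun k => hM.measurable_I k).prodMk
    (measurable_pi_lambda _ fun kj => hM.measurable_T kj)

lemma measurable_Y (hM : IsImmigrationModel μ p b r ν I T P) (t : ℝ≥0) :
    Measurable (immigrationY ν I T t) := by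
  have h := (measurable_immigrationSum t).comp
    ((hM.measurable_immigrationTimes t).prodMk hM.measurable_immigrants)
  have e : immigrationY ν I T t = _ := funext fun ω => immigrationY_eq hM.poisson.mono t ω
  rw [e]
  exact h

/-- With times and family numbers frozen, the sum runs over a fixed finite set of pairs (k, j), and
the independence of the trees factorizes the expectation. -/
lemma integral_prod_T (hM : IsImmigrationModel μ p b r ν I T P) (s : ℝ) (t : ℝ) (n : ℕ)
    (σ : ℕ → ℝ) (i : ℕ → ℕ) :
    ∫ ω, s ^ immigrationSum t n σ i (fun kj => T kj ω) ∂P =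
      ∏ k ∈ Finset.Icc 1 n, branchingF μ p (t - σ k) s ^ i k := by
  classical
  set S : Finset (ℕ × ℕ) := (Finset.Icc 1 n).biUnion
    fun k => (Finset.Icc 1 (i k)).image (Prod.mk k) with hS
  have hmem : ∀ x : ℕ × ℕ, x ∈ S ↔ x.1 ∈ Finset.Icc 1 n ∧ x.2 ∈ Finset.Icc 1 (i x.1) := by
    rintro ⟨k, j⟩
    simp only [hS, Finset.mem_biUnion, Finset.mem_image, Prod.mk.injEq]
    constructor
    · rintro ⟨k', hk', j', hj', rfl, rfl⟩
      exact ⟨hk', hj'⟩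
    · rintro ⟨hk, hj⟩
      exact ⟨k, hk, j, hj, rfl, rfl⟩
  have h1 : ∀ ω, s ^ immigrationSum t n σ i (fun kj => T kj ω) =
      ∏ x ∈ S, s ^ (T x ω).Z (t - σ x.1) := by
    intro ω
    rw [Finset.prod_finset_product S (Finset.Icc 1 n) (fun k => Finset.Icc 1 (i k)) hmem, immigrationSum, ← Finset.prod_pow_eq_pow_sum]
    exact Finset.prod_congr rfl fun k _ => (Finset.prod_pow_eq_pow_sum _ _ _).symm
  have hZ : ∀ x : ℕ × ℕ, Measurable fun A : LifeTree => s ^ A.Z (t - σ x.1) := fun x =>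
    LifeTree.measurable_pow_Z_left s _
  have hind := hM.indep_T.comp (fun x A => s ^ A.Z (t - σ x.1)) hZ
  have h2 := hind.integral_finsetProd (fun x => (hZ x).comp (hM.measurable_T x)) S
  have h3 : ∀ x : ℕ × ℕ, ∫ ω, s ^ (T x ω).Z (t - σ x.1) ∂P = branchingF μ p (t - σ x.1) s := by
    intro x
    rw [branchingF, ← hM.law_T x, integral_map (hM.measurable_T x).aemeasurable
      (hZ x).aestronglyMeasurable]
  simp_rw [h1]
  refine h2.trans ?_
  rw [Finset.prod_finset_product S (Finset.Icc 1 n) (fun k => Finset.Icc 1 (i k)) hmem]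
  refine Finset.prod_congr rfl fun k _ => ?_
  refine (Finset.prod_congr rfl fun j _ => h3 (k, j)).trans ?_
  simp

lemma integral_prod_I (hM : IsImmigrationModel μ p b r ν I T P) {x : ℕ → ℝ}
    (hx : ∀ k, x k ∈ Icc (0 : ℝ) 1) (n : ℕ) :
    ∫ ω, ∏ k ∈ Finset.Icc 1 n, x k ^ I k ω ∂P = ∏ k ∈ Finset.Icc 1 n, pgf b (x k) := by
  have hm : ∀ k, Measurable fun m : ℕ => x k ^ m := fun k => measurable_from_top
  have hind := hM.indep_I.comp (fun k m => x k ^ m) hm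
  refine (hind.integral_finsetProd (fun k => (hm k).comp (hM.measurable_I k)) _).trans ?_
  refine Finset.prod_congr rfl fun k _ => ?_
  rw [← integral_pow_toMeasure b (hx k).1 (hx k).2, ← hM.law_I k,
    integral_map (hM.measurable_I k).aemeasurable (hm k).aestronglyMeasurable]
  rfl

/-- The conditional generating function of `Y(t)` given the immigration times. -/
lemma integral_immigrants (hM : IsImmigrationModel μ p b r ν I T P) [IsProbabilityMeasure P]
    (hμ : 0 < μ) {s : ℝ} (hs : 0 ≤ s) (hs1 : s ≤ 1) (t : ℝ) (n : ℕ) (σ : ℕ → ℝ) :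
    ∫ ω, s ^ immigrationSum t n σ (fun k => I k ω) (fun kj => T kj ω) ∂P =
      ∏ k ∈ Finset.Icc 1 n, pgf b (branchingF μ p (t - σ k) s) := by
  have hmI : Measurable fun ω k => I k ω := measurable_pi_lambda _ fun k => hM.measurable_I k
  have hmT : Measurable fun ω kj => T kj ω := measurable_pi_lambda _ fun kj => hM.measurable_T kj
  have hm : Measurable fun y : (ℕ → ℕ) × (ℕ × ℕ → LifeTree) =>
      s ^ immigrationSum t n σ y.1 y.2 := by
    have h1 := (measurable_immigrationSum t).comp (measurable_prodMk_left (x := (n, σ)))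
    have := (measurable_from_top (f := fun m : ℕ => s ^ m)).comp h1
    exact this
  have hprob1 : IsProbabilityMeasure (P.map fun ω k => I k ω) :=
    Measure.isProbabilityMeasure_map hmI.aemeasurable
  have hprob2 : IsProbabilityMeasure (P.map fun ω kj => T kj ω) :=
    Measure.isProbabilityMeasure_map hmT.aemeasurable
  have hlaw := (indepFun_iff_map_prod_eq_prod_map_map hmI.aemeasurable hmT.aemeasurable).1
    hM.indep_I_T
  have e1 := integral_map (μ := P) (hmI.prodMk hmT).aemeasurable hm.aestronglyMeasurable
  rw [← e1, hlaw, integral_prod _ (integrable_of_mem_Icc hm fun y =>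
    pow_mem_Icc_zero_one hs hs1 _)]
  have e2 : ∀ i : ℕ → ℕ, ∫ A, s ^ immigrationSum t n σ i A ∂(P.map fun ω kj => T kj ω) =
      ∏ k ∈ Finset.Icc 1 n, branchingF μ p (t - σ k) s ^ i k := by
    intro i
    have hmi : Measurable fun A => s ^ immigrationSum t n σ i A := by
      have := hm.comp (measurable_prodMk_left (x := i))
      exact this
    rw [← hM.integral_prod_T s t n σ i, integral_map hmT.aemeasurable hmi.aestronglyMeasurable]
  simp only [e2]
  have hm3 : Measurable fun i : ℕ → ℕ =>
      ∏ k ∈ Finset.Icc 1 n, branchingF μ p (t - σ k) s ^ i k :=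
    Finset.measurable_fun_prod _ fun k _ =>
      (measurable_from_top (f := fun m : ℕ => branchingF μ p (t - σ k) s ^ m)).comp
        (measurable_pi_apply k)
  rw [integral_map hmI.aemeasurable hm3.aestronglyMeasurable]
  exact hM.integral_prod_I (fun k => branchingF_mem_Icc p hμ hs hs1) n

/-- The generating function of `Y(t)`. -/
theorem integral_pow_Y (hM : IsImmigrationModel μ p b r ν I T P) [IsProbabilityMeasure P]
    (hμ : 0 < μ) (hp : ∫⁻ n, (n : ENNReal) ∂p.toMeasure ≤ 1) (hr0 : ∀ u, 0 ≤ u → 0 ≤ r u)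
    {s : ℝ} (hs : 0 ≤ s) (hs1 : s ≤ 1) (t : ℝ≥0) (hr : IntervalIntegrable r volume 0 t) :
    ∫ ω, s ^ immigrationY ν I T t ω ∂P =
      Real.exp (-∫ u in (0 : ℝ)..t, r u * qfun μ p b (t - u) s) := by
  have hmX := hM.measurable_immigrationTimes t
  have hmA := hM.measurable_immigrants
  -- Count and times are measurable functions of the path of ν, so they inherit its independence of
  -- the immigrants; Fubini then conditions on them.
  have hindep : IndepFun (immigrationTimes ν t)
      (fun ω => ((fun k => I k ω), (fun kj => T kj ω))) P := by
    have hΦ : Measurable fun x : ℝ≥0 → ℕ => (x t, fun k => cappedPassage t x k) :=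
      (measurable_pi_apply t).prodMk
        (measurable_pi_lambda _ fun k => measurable_cappedPassage t k)
    exact hM.indep_ν.comp hΦ measurable_id
  have hm : Measurable fun x : (ℕ × (ℕ → ℝ)) × ((ℕ → ℕ) × (ℕ × ℕ → LifeTree)) =>
      s ^ immigrationSum t x.1.1 x.1.2 x.2.1 x.2.2 := by
    have := (measurable_from_top (f := fun m : ℕ => s ^ m)).comp (measurable_immigrationSum t)
    exact this
  have hprob1 : IsProbabilityMeasure (P.map (immigrationTimes ν t)) :=
    Measure.isProbabilityMeasure_map hmX.aemeasurable
  have hprob2 : IsProbabilityMeasure (P.map fun ω => ((fun k => I k ω), (fun kj => T kj ω))) :=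
    Measure.isProbabilityMeasure_map hmA.aemeasurable
  have hlaw := (indepFun_iff_map_prod_eq_prod_map_map hmX.aemeasurable hmA.aemeasurable).1 hindep
  have e0 : ∀ ω, s ^ immigrationY ν I T t ω = s ^ immigrationSum t (immigrationTimes ν t ω).1
      (immigrationTimes ν t ω).2 (fun k => I k ω) (fun kj => T kj ω) := fun ω => by
    rw [immigrationY_eq hM.poisson.mono]
  have e1 := integral_map (μ := P) (hmX.prodMk hmA).aemeasurable hm.aestronglyMeasurable
  have e2 : ∀ x : ℕ × (ℕ → ℝ), ∫ y, s ^ immigrationSum t x.1 x.2 y.1 y.2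
      ∂(P.map fun ω => ((fun k => I k ω), (fun kj => T kj ω))) =
      ∏ k ∈ Finset.Icc 1 x.1, pgf b (branchingF μ p (t - x.2 k) s) := by
    intro x
    have hmx : Measurable fun y : (ℕ → ℕ) × (ℕ × ℕ → LifeTree) =>
        s ^ immigrationSum t x.1 x.2 y.1 y.2 := by
      have := hm.comp (measurable_prodMk_left (x := x))
      exact this
    rw [← hM.integral_immigrants hμ hs hs1, integral_map hmA.aemeasurable
      hmx.aestronglyMeasurable]
  have hFm := measurable_branchingF p hμ s
  have hgm : Measurable fun u : ℝ => pgf b (branchingF μ p u s) := by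
    unfold pgf
    refine measurable_of_tendsto_metrizable (f := fun N u => ∑ n ∈ Finset.range N,
      (b n).toReal * branchingF μ p u s ^ n) (fun N => by fun_prop) ?_
    rw [tendsto_pi_nhds]
    intro u
    have h := branchingF_mem_Icc p (t := u) hμ hs hs1
    exact (summable_pgf b h.1 h.2).hasSum.tendsto_sum_nat
  have hm3 : Measurable fun x : ℕ × (ℕ → ℝ) =>
      ∏ k ∈ Finset.Icc 1 x.1, pgf b (branchingF μ p (t - x.2 k) s) := by
    have h1 : Measurable fun z : (ℕ → ℝ) × ℕ =>
        ∏ k ∈ Finset.Icc 1 z.2, pgf b (branchingF μ p (t - z.1 k) s) :=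
      measurable_from_prod_countable_left fun n =>
        Finset.measurable_fun_prod (Finset.Icc 1 n) fun k _ => hgm.comp (measurable_const.sub (measurable_pi_apply k))
    have := h1.comp measurable_swap
    exact this
  simp_rw [e0]
  rw [← e1, hlaw, integral_prod _ (integrable_of_mem_Icc hm fun y =>
    pow_mem_Icc_zero_one hs hs1 _)]
  simp only [e2]
  rw [integral_map hmX.aemeasurable hm3.aestronglyMeasurable]
  have e3 : ∀ ω, ∏ k ∈ Finset.Icc 1 (immigrationTimes ν t ω).1,
      pgf b (branchingF μ p (t - (immigrationTimes ν t ω).2 k) s) =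
      ∏ k ∈ Finset.Icc 1 (ν t ω),
        (fun u : ℝ => pgf b (branchingF μ p (t - u) s)) (jumpTime ν k ω) := by
    intro ω
    refine Finset.prod_congr rfl fun k hk => ?_
    rw [immigrationTimes_snd_eq hM.poisson.mono hk]
  simp_rw [e3]
  -- The functional is applied to h(u) = g(F(t-u; s)), for which 1 - h(u) is q(t-u; s).
  rw [hM.poisson.integral_prod_jumpTime hr0 t hr
    (h := fun u : ℝ => pgf b (branchingF μ p (t - u) s))]
  · rfl
  · intro u
    have h := branchingF_mem_Icc p (t := t - u) hμ hs hs1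
    exact ⟨pgf_nonneg b h.1, pgf_le_one b h.1 h.2⟩
  · refine (continuousOn_pgf b).comp ((continuousOn_branchingF p hμ hp hs hs1).comp
      (by fun_prop) fun u hu => ?_) fun u _ => branchingF_mem_Icc p hμ hs hs1
    exact sub_nonneg.2 hu.2

end IsImmigrationModel
end Model

/-! ### The continuity theorem for Laplace transforms -/

section Laplace

/-- By Weierstrass, polynomials are uniformly dense in the continuous functions on [0, 1], so the
moments determine all integrals. -/
lemma ext_of_moments_unitInterval {ρ₁ ρ₂ : ProbabilityMeasure (Icc (0 : ℝ) 1)}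
    (h : ∀ n : ℕ, ∫ y, (y : ℝ) ^ n ∂(ρ₁ : Measure (Icc (0 : ℝ) 1)) =
      ∫ y, (y : ℝ) ^ n ∂(ρ₂ : Measure (Icc (0 : ℝ) 1))) : ρ₁ = ρ₂ := by
  have hint : ∀ (ρ : ProbabilityMeasure (Icc (0 : ℝ) 1)) (f : C(Icc (0 : ℝ) 1, ℝ)),
      Integrable f (ρ : Measure (Icc (0 : ℝ) 1)) := fun ρ f =>
    f.continuous.integrable_of_hasCompactSupport (HasCompactSupport.of_compactSpace _)
  have hpoly : ∀ (ρ : ProbabilityMeasure (Icc (0 : ℝ) 1)) (q : Polynomial ℝ),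
      ∫ y, q.eval (y : ℝ) ∂(ρ : Measure (Icc (0 : ℝ) 1)) =
        ∑ n ∈ q.support, q.coeff n * ∫ y, (y : ℝ) ^ n ∂(ρ : Measure (Icc (0 : ℝ) 1)) := by
    intro ρ q
    simp only [Polynomial.eval_eq_sum, Polynomial.sum]
    rw [integral_finsetSum _ fun n _ => ?_]
    · simp only [integral_const_mul]
    · exact hint ρ ⟨fun y => q.coeff n * (y : ℝ) ^ n, by fun_prop⟩
  apply Subtype.ext
  have : IsFiniteMeasure ρ₁.1 := inferInstanceAs (IsFiniteMeasure (ρ₁ : Measure (Icc (0 : ℝ) 1)))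
  have : IsFiniteMeasure ρ₂.1 := inferInstanceAs (IsFiniteMeasure (ρ₂ : Measure (Icc (0 : ℝ) 1)))
  refine ext_of_forall_integral_eq_of_IsFiniteMeasure fun f => ?_
  change ∫ y, f y ∂(ρ₁ : Measure (Icc (0 : ℝ) 1)) = ∫ y, f y ∂(ρ₂ : Measure (Icc (0 : ℝ) 1))
  refine eq_of_forall_dist_le fun ε hε => ?_
  obtain ⟨q, hq⟩ := exists_polynomial_near_continuousMap 0 1 f.toContinuousMap (ε / 2) (by positivity)
  have happ : ∀ y : Icc (0 : ℝ) 1, |q.eval (y : ℝ) - f y| ≤ ε / 2 := fun y => by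
    have := (ContinuousMap.norm_coe_le_norm
      (q.toContinuousMapOn (Icc 0 1) - f.toContinuousMap) y).trans hq.le
    simpa [Real.norm_eq_abs] using this
  have hclose : ∀ ρ : ProbabilityMeasure (Icc (0 : ℝ) 1),
      |∫ y, q.eval (y : ℝ) ∂(ρ : Measure (Icc (0 : ℝ) 1)) -
        ∫ y, f y ∂(ρ : Measure (Icc (0 : ℝ) 1))| ≤ ε / 2 := by
    intro ρ
    have hq' : Integrable (fun y : Icc (0 : ℝ) 1 => q.eval (y : ℝ)) (ρ : Measure (Icc (0 : ℝ) 1)) :=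
      hint ρ (q.toContinuousMapOn _)
    have hf' : Integrable (fun y => f y) (ρ : Measure (Icc (0 : ℝ) 1)) := hint ρ f.toContinuousMap
    rw [← integral_sub hq' hf']
    have := norm_integral_le_of_norm_le_const (μ := (ρ : Measure (Icc (0 : ℝ) 1)))
      (f := fun y : Icc (0 : ℝ) 1 => q.eval (y : ℝ) - f y) (C := ε / 2) (ae_of_all _ happ)
    simpa using this
  have h1 := hclose ρ₁
  have h2 := hclose ρ₂
  rw [hpoly] at h1 h2
  simp only [h] at h1
  rw [Real.dist_eq]
  rw [abs_le] at *
  constructor <;> linarith [h1.1, h1.2, h2.1, h2.2]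

/-- The change of variables `x ↦ e^{-x}` from `[0, ∞)` to `[0, 1]`. -/
noncomputable def expNeg (x : ℝ) : Icc (0 : ℝ) 1 :=
  ⟨Real.exp (-max x 0), (Real.exp_pos _).le, Real.exp_le_one_iff.2 (by simp)⟩

lemma measurable_expNeg : Measurable expNeg :=
  Measurable.subtype_mk (by fun_prop)

lemma le_expNeg_iff {x y : ℝ} (hx : 0 ≤ x) : Real.exp (-x) ≤ expNeg y ↔ y ≤ x := by
  simp [expNeg, Real.exp_le_exp, hx]

lemma expNeg_rpow {x : ℝ} (hx : 0 ≤ x) (c : ℝ) : (expNeg x : ℝ) ^ c = Real.exp (-(c * x)) := by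
  have h : (expNeg x : ℝ) = Real.exp (-x) := by simp [expNeg, hx]
  rw [h, ← Real.exp_mul]
  congr 1
  ring

lemma measurable_neg_log_unitInterval :
    Measurable fun y : Icc (0 : ℝ) 1 => -Real.log (y : ℝ) := by fun_prop

/-- The continuity theorem for Laplace transforms. -/
theorem exists_measure_of_tendsto_laplace {ι : Type*} {F : Filter ι} [F.NeBot]
    {m : ι → Measure ℝ} [∀ i, IsProbabilityMeasure (m i)] (hm : ∀ i, ∀ᵐ x ∂(m i), 0 ≤ x)
    {ψ : ℝ → ℝ} (hψ : Tendsto ψ (𝓝[>] 0) (𝓝 1))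
    (hlim : ∀ lam : ℝ, 0 < lam →
      Tendsto (fun i => ∫ x, Real.exp (-(lam * x)) ∂(m i)) F (𝓝 (ψ lam))) :
    ∃ D : Measure ℝ, IsProbabilityMeasure D ∧ D (Iio 0) = 0 ∧
      (∀ lam : ℝ, 0 < lam → ∫ x, Real.exp (-(lam * x)) ∂D = ψ lam) ∧
      ∀ x : ℝ, 0 ≤ x → D {x} = 0 → Tendsto (fun i => (m i).real (Iic x)) F (𝓝 (D.real (Iic x))) := by
  -- On [0, 1] the Laplace transform at c is the moment of real order c, and the probability
  -- measures form a compact space, so no separate tightness argument is needed.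
  set ρ : ι → ProbabilityMeasure (Icc (0 : ℝ) 1) := fun i =>
    ⟨(m i).map expNeg, Measure.isProbabilityMeasure_map measurable_expNeg.aemeasurable⟩ with hρ
  have hcont : ∀ c : ℝ, 0 < c → Continuous fun y : Icc (0 : ℝ) 1 => (y : ℝ) ^ c := fun c hc =>
    continuous_subtype_val.rpow_const fun y => Or.inr hc.le
  have hρc : ∀ (i : ι) (c : ℝ), 0 < c → ∫ y, (y : ℝ) ^ c ∂(ρ i : Measure (Icc (0 : ℝ) 1)) =
      ∫ x, Real.exp (-(c * x)) ∂(m i) := by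
    intro i c hc
    have := integral_map (μ := m i) measurable_expNeg.aemeasurable
      (f := fun y : Icc (0 : ℝ) 1 => (y : ℝ) ^ c) (hcont c hc).aestronglyMeasurable
    refine this.trans (integral_congr_ae ?_)
    filter_upwards [hm i] with x hx using expNeg_rpow hx c
  have hcontint : ∀ c : ℝ, 0 < c → Continuous fun σ : ProbabilityMeasure (Icc (0 : ℝ) 1) =>
      ∫ y, (y : ℝ) ^ c ∂(σ : Measure (Icc (0 : ℝ) 1)) := fun c hc =>
    ProbabilityMeasure.continuous_integral_boundedContinuousFunction
      (BoundedContinuousFunction.mkOfCompact ⟨_, hcont c hc⟩)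
  -- Moments are weakly continuous, so every cluster point has the moments ψ(c). The cluster point
  -- is therefore unique, and by compactness the laws converge to it.
  have hclust : ∀ σ : ProbabilityMeasure (Icc (0 : ℝ) 1), ClusterPt σ (map ρ F) →
      ∀ c : ℝ, 0 < c → ∫ y, (y : ℝ) ^ c ∂(σ : Measure (Icc (0 : ℝ) 1)) = ψ c := by
    intro σ hσ c hc
    have h1 : Tendsto (fun i => ∫ y, (y : ℝ) ^ c ∂(ρ i : Measure (Icc (0 : ℝ) 1))) F
        (𝓝 (ψ c)) := (hlim c hc).congr fun i => (hρc i c hc).symm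
    have h2 : MapClusterPt (∫ y, (y : ℝ) ^ c ∂(σ : Measure (Icc (0 : ℝ) 1))) F
        (fun i => ∫ y, (y : ℝ) ^ c ∂(ρ i : Measure (Icc (0 : ℝ) 1))) :=
      MapClusterPt.continuousAt_comp (u := ρ) (hcontint c hc).continuousAt hσ
    by_contra hne
    have h3 := ClusterPt.mono h2 h1
    rw [ClusterPt, (disjoint_nhds_nhds.2 hne).eq_bot] at h3
    exact h3.ne rfl
  obtain ⟨σ, hσ⟩ : ∃ σ, ClusterPt σ (map ρ F) := exists_clusterPt_of_compactSpace _
  have htend : Tendsto ρ F (𝓝 σ) := by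
    refine le_nhds_of_unique_clusterPt fun σ' hσ' => ext_of_moments_unitInterval fun n => ?_
    rcases Nat.eq_zero_or_pos n with rfl | hn
    · simp
    · have hn' : (0 : ℝ) < n := by exact_mod_cast hn
      have h1 := hclust σ hσ n hn'
      have h2 := hclust σ' hσ' n hn'
      simp only [Real.rpow_natCast] at h1 h2
      rw [h1, h2]
  have hσc := hclust σ hσ
  -- Mass at y = 0 is mass lost at x = ∞. Since y^c is at most the indicator of y ≠ 0, letting c → 0
  -- with ψ(c) → 1 excludes it.
  have hzero : (σ : Measure (Icc (0 : ℝ) 1)) {0} = 0 := by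
    have h1 : ∀ c : ℝ, 0 < c → ψ c ≤ (σ : Measure (Icc (0 : ℝ) 1)).real {0}ᶜ := by
      intro c hc
      rw [← hσc c hc, ← integral_indicator_one (measurableSet_singleton _).compl]
      refine integral_mono ((hcont c hc).integrable_of_hasCompactSupport
        (HasCompactSupport.of_compactSpace _)) ?_ fun y => ?_
      · exact (integrable_const (1 : ℝ)).indicator (measurableSet_singleton _).compl
      · by_cases hy : y = 0
        · simp [hy, hc.ne']
        · rw [indicator_of_mem (by simpa using hy)]
          exact Real.rpow_le_one y.2.1 y.2.2 hc.le
    have h2 : (1 : ℝ) ≤ (σ : Measure (Icc (0 : ℝ) 1)).real {0}ᶜ :=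
      le_of_tendsto hψ (by filter_upwards [self_mem_nhdsWithin] with c hc using h1 c hc)
    rw [probReal_compl_eq_one_sub (measurableSet_singleton _)] at h2
    have h3 : (σ : Measure (Icc (0 : ℝ) 1)).real {0} = 0 :=
      le_antisymm (by linarith) measureReal_nonneg
    exact (measureReal_eq_zero_iff).1 h3
  have hne : ∀ᵐ (y : Icc (0 : ℝ) 1) ∂(σ : Measure (Icc (0 : ℝ) 1)), 0 < (y : ℝ) := by
    have : ∀ᵐ y ∂(σ : Measure (Icc (0 : ℝ) 1)), y ∉ ({0} : Set (Icc (0 : ℝ) 1)) :=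
      measure_eq_zero_iff_ae_notMem.1 hzero
    filter_upwards [this] with y hy
    exact lt_of_le_of_ne y.2.1 fun h => hy (Subtype.ext h.symm)
  have hlog := measurable_neg_log_unitInterval
  -- The limit law is carried back by -log; the conventional value log 0 = 0 is harmless because the
  -- point 0 is null.
  refine ⟨(σ : Measure (Icc (0 : ℝ) 1)).map fun y : Icc (0 : ℝ) 1 => -Real.log (y : ℝ),
    Measure.isProbabilityMeasure_map hlog.aemeasurable, ?_, fun c hc => ?_, fun x hx hDx => ?_⟩
  · rw [Measure.map_apply hlog measurableSet_Iio]
    have : (fun y : Icc (0 : ℝ) 1 => -Real.log (y : ℝ)) ⁻¹' Iio 0 = ∅ := by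
      ext y
      simpa using Real.log_nonpos y.2.1 y.2.2
    rw [this, measure_empty]
  · rw [integral_map hlog.aemeasurable (by fun_prop), ← hσc c hc]
    refine integral_congr_ae ?_
    filter_upwards [hne] with y hy
    rw [Real.rpow_def_of_pos hy]
    congr 1
    ring
  · set e : Icc (0 : ℝ) 1 := expNeg x with he
    have hex : (e : ℝ) = Real.exp (-x) := by simp [he, expNeg, hx]
    -- The half-line x' ≤ x becomes y ≥ exp(-x), whose boundary corresponds to the single point x;
    -- this is where the absence of an atom enters.
    have hfront : (σ : Measure (Icc (0 : ℝ) 1)) (frontier (Ici e)) = 0 := by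
      refine measure_mono_null (frontier_Ici_subset e) ?_
      rw [Measure.map_apply hlog (measurableSet_singleton _)] at hDx
      refine measure_mono_null ?_ hDx
      rintro y rfl
      simp [hex]
    have h1 := ProbabilityMeasure.tendsto_measure_of_null_frontier_of_tendsto' htend hfront
    have h2 := (ENNReal.tendsto_toReal (measure_ne_top _ _)).comp h1
    have h3 : ((σ : Measure (Icc (0 : ℝ) 1)).map fun y : Icc (0 : ℝ) 1 => -Real.log (y : ℝ)).real (Iic x) =
        ((σ : Measure (Icc (0 : ℝ) 1)) (Ici e)).toReal := by
      rw [measureReal_def, Measure.map_apply hlog measurableSet_Iic]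
      congr 1
      refine measure_congr ?_
      filter_upwards [hne] with y hy
      have : -Real.log (y : ℝ) ≤ x ↔ e ≤ y := by
        rw [← Subtype.coe_le_coe, hex, ← Real.le_log_iff_exp_le hy]
        constructor <;> intro h <;> linarith
      exact propext this
    rw [h3]
    refine h2.congr fun i => ?_
    simp only [Function.comp, hρ, measureReal_def]
    congr 1
    refine (Measure.map_apply measurable_expNeg measurableSet_Ici).trans ?_
    congr 1
    ext y
    simp only [mem_preimage, mem_Ici, mem_Iic, ← Subtype.coe_le_coe, hex]
    exact le_expNeg_iff hx

end Laplace

/-! ### Absence of atoms in the limit law -/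

section NoAtoms

/-- A probability measure whose characteristic function vanishes at infinity has no atoms. -/
lemma measure_singleton_eq_zero_of_tendsto_charFun {D : Measure ℝ} [IsProbabilityMeasure D]
    (h : Tendsto (charFun D) (cocompact ℝ) (𝓝 0)) (x : ℝ) : D {x} = 0 := by
  set N : Measure ℝ := gaussianReal 0 1 with hN
  have hN0 : ∀ᵐ n ∂N, n ≠ 0 := by
    have : NullSingletonClass N := nullSingletonClass_gaussianReal one_ne_zero
    simp [ae_iff]
  -- The indicator of {x} is below the Gaussian bump exp(-T²(y-x)²/2), which is itself a
  -- characteristic function. Fubini turns its D-integral into a Gaussian average of the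
  -- characteristic function of D, which vanishes as T → ∞.
  have hbound : ∀ T : ℝ, D.real {x} ≤ ∫ n, ‖charFun D (T * n)‖ ∂N := by
    intro T
    have h1 : ∀ y : ℝ, charFun N (T * (y - x)) = ((Real.exp (-(T * (y - x)) ^ 2 / 2) : ℝ) : ℂ) := by
      intro y
      rw [hN, charFun_gaussianReal]
      push_cast
      congr 1
      simp
      ring
    have h2 : D.real {x} ≤ ∫ y, Real.exp (-(T * (y - x)) ^ 2 / 2) ∂D := by
      rw [← integral_indicator_one (measurableSet_singleton x)]
      refine integral_mono ((integrable_const (1 : ℝ)).indicator (measurableSet_singleton x)) ?_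
        fun y => ?_
      · refine integrable_of_mem_Icc (by fun_prop) fun y => ⟨(Real.exp_pos _).le, ?_⟩
        rw [Real.exp_le_one_iff]
        have := sq_nonneg (T * (y - x))
        linarith
      · by_cases hy : y = x
        · simp [hy]
        · rw [indicator_of_notMem (by simpa using hy)]
          exact (Real.exp_pos _).le
    have h3 : ((∫ y, Real.exp (-(T * (y - x)) ^ 2 / 2) ∂D : ℝ) : ℂ) =
        ∫ n, Complex.exp (-(T * n * x) * Complex.I) * charFun D (T * n) ∂N := by
      rw [← integral_complex_ofReal]
      simp_rw [← h1, charFun_apply_real, ← integral_const_mul]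
      rw [integral_integral_swap]
      · refine integral_congr_ae (ae_of_all _ fun n => integral_congr_ae (ae_of_all _ fun y => ?_))
        simp only
        rw [← Complex.exp_add]
        congr 1
        push_cast
        ring
      · refine Integrable.of_bound (C := 1) (by fun_prop) (ae_of_all _ fun z => ?_)
        simp only [Function.uncurry]
        rw [← Complex.ofReal_mul, Complex.norm_exp_ofReal_mul_I]
    have h4 : ‖((∫ y, Real.exp (-(T * (y - x)) ^ 2 / 2) ∂D : ℝ) : ℂ)‖ ≤
        ∫ n, ‖charFun D (T * n)‖ ∂N := by
      rw [h3]
      refine (norm_integral_le_integral_norm _).trans_eq (integral_congr_ae (ae_of_all _ fun n => ?_))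
      simp only
      rw [norm_mul]
      have : (-(T * n * x) * Complex.I : ℂ) = ((-(T * n * x) : ℝ) : ℂ) * Complex.I := by
        push_cast; ring
      rw [this, Complex.norm_exp_ofReal_mul_I, one_mul]
    refine h2.trans (le_trans ?_ h4)
    rw [Complex.norm_real]
    exact le_abs_self _
  have hlim : Tendsto (fun T : ℝ => ∫ n, ‖charFun D (T * n)‖ ∂N) atTop (𝓝 0) := by
    have := tendsto_integral_filter_of_dominated_convergence (μ := N) (l := (atTop : Filter ℝ))
      (F := fun T n => ‖charFun D (T * n)‖) (f := fun _ => (0 : ℝ)) (fun _ => 1)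
      (Eventually.of_forall fun T => by
        have := (continuous_charFun (μ := D)).comp (continuous_const_mul T)
        exact this.norm.aestronglyMeasurable)
      (Eventually.of_forall fun T => ae_of_all _ fun n => by
        rw [norm_norm]; exact norm_charFun_le_one _)
      (integrable_const 1)
      (by
        filter_upwards [hN0] with n hn
        have h1 : Tendsto (fun T : ℝ => T * n) atTop (cocompact ℝ) := by
          rcases lt_or_gt_of_ne hn with hn | hn
          · exact (tendsto_id.atTop_mul_const_of_neg hn).mono_right atBot_le_cocompact
          · exact (tendsto_id.atTop_mul_const hn).mono_right atTop_le_cocompact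
        have := (h.comp h1).norm
        simpa using this)
    simpa using this
  have h5 : D.real {x} ≤ 0 := ge_of_tendsto' hlim hbound
  exact (measureReal_eq_zero_iff).1 (le_antisymm h5 measureReal_nonneg)

/-- In the closed right half-plane |arg z| ≤ π/2, and γ ≤ 1 keeps |γ arg z| in the range where the
cosine is nonnegative. -/
lemma Complex.re_cpow_neg_nonneg {z : ℂ} (hz : 0 ≤ z.re) {γ : ℝ} (hγ : 0 ≤ γ)
    (hγ1 : γ ≤ 1) : 0 ≤ (z ^ (-(γ : ℂ))).re := by
  rcases eq_or_ne z 0 with rfl | hz0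
  · rcases eq_or_ne γ 0 with rfl | h
    · simp
    · rw [Complex.zero_cpow (by simpa using h)]; simp
  rw [Complex.cpow_def_of_ne_zero hz0, Complex.exp_re]
  refine mul_nonneg (Real.exp_pos _).le ?_
  have h1 : (Complex.log z * -(γ : ℂ)).im = -(z.arg * γ) := by
    simp [Complex.mul_im, Complex.log_im]
  rw [h1, Real.cos_neg]
  have h2 := abs_le.1 (Complex.abs_arg_le_pi_div_two_iff.2 hz)
  have h3 : |z.arg * γ| ≤ Real.pi / 2 := by
    rw [abs_mul, abs_of_nonneg hγ]
    exact (mul_le_of_le_one_right (abs_nonneg _) hγ1).trans (abs_le.2 h2)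
  exact Real.cos_nonneg_of_mem_Icc (abs_le.1 h3)

/-- The analytic continuation of the limiting Laplace transform. -/
noncomputable def limitLaplace (γ β : ℝ) (z : ℂ) : ℂ :=
  1 - (1 + z ^ (-(γ : ℂ))) ^ (-(β : ℂ))

variable {γ β : ℝ}

lemma one_add_cpow_mem_slitPlane (hγ : 0 ≤ γ) (hγ1 : γ ≤ 1) {z : ℂ} (hz : 0 ≤ z.re) :
    1 + z ^ (-(γ : ℂ)) ∈ Complex.slitPlane := by
  left
  have := Complex.re_cpow_neg_nonneg hz hγ hγ1
  simp only [Complex.add_re, Complex.one_re]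
  linarith

lemma differentiableAt_limitLaplace (hγ : 0 ≤ γ) (hγ1 : γ ≤ 1) {z : ℂ} (hz : 0 ≤ z.re)
    (hz' : z ∈ Complex.slitPlane) : DifferentiableAt ℂ (limitLaplace γ β) z := by
  unfold limitLaplace
  refine DifferentiableAt.const_sub ?_ 1
  exact ((differentiableAt_id.cpow_const hz').const_add 1).cpow_const
    (one_add_cpow_mem_slitPlane hγ hγ1 hz)

lemma limitLaplace_ofReal {x : ℝ} (hx : 0 < x) :
    limitLaplace γ β x = ((1 - (1 + x ^ (-γ)) ^ (-β) : ℝ) : ℂ) := by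
  have h1 : (0 : ℝ) ≤ 1 + x ^ (-γ) := by positivity
  rw [limitLaplace]
  push_cast
  rw [Complex.ofReal_cpow h1]
  push_cast
  rw [Complex.ofReal_cpow hx.le]
  push_cast
  rfl

/-- On the imaginary axis z^(-γ) has modulus |t|^(-γ) → 0, and 1 - (1 + w)^(-β) is continuous at w =
0 with value 0. -/
lemma tendsto_limitLaplace (hγ : 0 < γ) :
    Tendsto (fun t : ℝ => limitLaplace γ β (-(t * Complex.I))) (cocompact ℝ) (𝓝 0) := by
  have h1 : Tendsto (fun t : ℝ => (-(t * Complex.I) : ℂ) ^ (-(γ : ℂ))) (cocompact ℝ) (𝓝 0) := by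
    rw [tendsto_zero_iff_norm_tendsto_zero]
    have h2 : Tendsto (fun t : ℝ => |t| ^ (-γ)) (cocompact ℝ) (𝓝 0) :=
      (tendsto_rpow_neg_atTop hγ).comp (tendsto_norm_cocompact_atTop (E := ℝ))
    refine squeeze_zero' (Eventually.of_forall fun t => norm_nonneg _) ?_ (by
      simpa using h2.mul_const (Real.exp (Real.pi * γ)))
    filter_upwards [(tendsto_norm_cocompact_atTop (E := ℝ)).eventually_gt_atTop 0] with t ht
    have ht0 : (-(t * Complex.I) : ℂ) ≠ 0 := by
      have : t ≠ 0 := norm_pos_iff.1 ht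
      simpa using this
    rw [← Complex.ofReal_neg, Complex.norm_cpow_of_ne_zero ht0]
    simpa using le_mul_of_one_le_right (Real.rpow_nonneg (abs_nonneg t) (-γ))
      (Real.one_le_exp (mul_nonneg Real.pi_pos.le hγ.le))
  have h3 : ContinuousAt (fun w : ℂ => 1 - (1 + w) ^ (-(β : ℂ))) 0 := by
    refine continuousAt_const.sub (ContinuousAt.cpow ?_ continuousAt_const (by simp))
    fun_prop
  have h4 := h3.tendsto.comp h1
  simpa [Function.comp_def, limitLaplace] using h4

/-- The limiting law has no atoms. -/
theorem measure_singleton_eq_zero_of_laplace (hγ : 0 < γ) (hγ1 : γ ≤ 1) {D : Measure ℝ}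
    [IsProbabilityMeasure D] (hD : D (Iio 0) = 0)
    (hL : ∀ lam : ℝ, 0 < lam →
      ∫ x, Real.exp (-(lam * x)) ∂D = 1 - (1 + lam ^ (-γ)) ^ (-β)) (x : ℝ) : D {x} = 0 := by
  have hD0 : ∀ᵐ y ∂D, 0 ≤ y := by
    rw [ae_iff]; simpa [← Iio_def] using hD
  have hset : Iic (0 : ℝ) ⊆ integrableExpSet id D := by
    intro c hc
    refine Integrable.of_bound (C := 1) (by fun_prop) ?_
    filter_upwards [hD0] with y hy
    rw [Real.norm_eq_abs, Real.abs_exp, Real.exp_le_one_iff]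
    exact mul_nonpos_of_nonpos_of_nonneg hc hy
  have hint : Iio (0 : ℝ) ⊆ interior (integrableExpSet id D) := by
    rw [← interior_Iic]; exact interior_mono hset
  have hU : {z : ℂ | z.re < 0} = Complex.re ⁻¹' Iio 0 := rfl
  have hopen : IsOpen {z : ℂ | z.re < 0} := isOpen_Iio.preimage Complex.continuous_re
  have hpre : IsPreconnected {z : ℂ | z.re < 0} := (convex_halfSpace_re_lt 0).isPreconnected
  have han1 : AnalyticOnNhd ℂ (complexMGF id D) {z : ℂ | z.re < 0} :=
    analyticOnNhd_complexMGF.mono fun z hz => hint hz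
  have han2 : AnalyticOnNhd ℂ (fun z => limitLaplace γ β (-z)) {z : ℂ | z.re < 0} := by
    refine DifferentiableOn.analyticOnNhd (fun z hz => ?_) hopen
    have hz : z.re < 0 := hz
    have h1 : DifferentiableAt ℂ (limitLaplace γ β) (-z) :=
      differentiableAt_limitLaplace hγ.le hγ1 (by simpa using hz.le) (Or.inl (by simpa using hz))
    exact (h1.comp z differentiableAt_id.neg).differentiableWithinAt
  have hreal : ∀ c : ℝ, c < 0 → complexMGF id D c = limitLaplace γ β (-c) := by
    intro c hc
    rw [complexMGF_ofReal, ← Complex.ofReal_neg, limitLaplace_ofReal (neg_pos.2 hc),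
      ← hL _ (neg_pos.2 hc)]
    simp [mgf]
  -- Both sides are analytic for Re z < 0 and agree on the negative real axis, hence near the
  -- accumulation point -1; the identity theorem gives the rest.
  have heq : EqOn (complexMGF id D) (fun z => limitLaplace γ β (-z)) {z : ℂ | z.re < 0} := by
    refine han1.eqOn_of_preconnected_of_frequently_eq han2 hpre (z₀ := ((-1 : ℝ) : ℂ)) (by simp) ?_
    have h1 : ∃ᶠ c : ℝ in 𝓝[≠] (-1), complexMGF id D c = limitLaplace γ β (-c) := by
      refine Eventually.frequently ?_
      have : ∀ᶠ c : ℝ in 𝓝[≠] (-1), c < 0 := nhdsWithin_le_nhds (gt_mem_nhds (by norm_num))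
      filter_upwards [this] with c hc using hreal c hc
    have h2 : Tendsto (fun c : ℝ => (c : ℂ)) (𝓝[≠] (-1)) (𝓝[≠] ((-1 : ℝ) : ℂ)) := by
      refine tendsto_nhdsWithin_iff.2 ⟨?_, ?_⟩
      · exact (Complex.continuous_ofReal.tendsto _).mono_left nhdsWithin_le_nhds
      · filter_upwards [self_mem_nhdsWithin] with c hc
        exact fun h => hc (Complex.ofReal_injective h)
    exact h2.frequently h1
  -- Boundary values: approach i t along -ε + i t, with the integrands dominated by 1. The point t =
  -- 0 is excluded because z^(-γ) lies on its branch cut there.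
  have hchar : ∀ t : ℝ, t ≠ 0 → charFun D t = limitLaplace γ β (-(t * Complex.I)) := by
    intro t ht
    have hz : Tendsto (fun ε : ℝ => (-ε : ℂ) + t * Complex.I) (𝓝[>] 0) (𝓝 (t * Complex.I)) := by
      have : Continuous fun ε : ℝ => (-ε : ℂ) + t * Complex.I := by fun_prop
      simpa using (this.tendsto 0).mono_left nhdsWithin_le_nhds
    have h1 : Tendsto (fun ε : ℝ => complexMGF id D ((-ε : ℂ) + t * Complex.I)) (𝓝[>] 0)
        (𝓝 (charFun D t)) := by
      rw [← complexMGF_id_mul_I]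
      refine tendsto_integral_filter_of_dominated_convergence (fun _ => 1) ?_ ?_
        (integrable_const 1) ?_
      · exact Eventually.of_forall fun ε => by fun_prop
      · filter_upwards [self_mem_nhdsWithin] with ε hε
        filter_upwards [hD0] with y hy
        have hε : 0 < ε := hε
        rw [Complex.norm_exp, Real.exp_le_one_iff]
        simp
        positivity
      · refine ae_of_all _ fun y => ?_
        have : Continuous fun z : ℂ => Complex.exp (z * (id y : ℝ)) := by fun_prop
        exact (this.tendsto _).comp hz
    have h2 : Tendsto (fun ε : ℝ => complexMGF id D ((-ε : ℂ) + t * Complex.I)) (𝓝[>] 0)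
        (𝓝 (limitLaplace γ β (-(t * Complex.I)))) := by
      have hc : ContinuousAt (limitLaplace γ β) (-(t * Complex.I)) :=
        (differentiableAt_limitLaplace hγ.le hγ1 (by simp) (Or.inr (by simpa using ht))).continuousAt
      refine (hc.tendsto.comp hz.neg).congr' ?_
      filter_upwards [self_mem_nhdsWithin] with ε hε
      have hε : 0 < ε := hε
      exact (heq (show ((-ε : ℂ) + t * Complex.I).re < 0 by simpa using hε)).symm
    exact tendsto_nhds_unique h1 h2
  refine measure_singleton_eq_zero_of_tendsto_charFun ?_ x
  refine (tendsto_limitLaplace (β := β) hγ).congr' ?_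
  filter_upwards [(tendsto_norm_cocompact_atTop (E := ℝ)).eventually_gt_atTop 0] with t ht
  exact (hchar t (norm_pos_iff.1 ht)).symm

end NoAtoms

/-! ### Conditioning on non-extinction -/

section Elementary

lemma tendsto_one_sub_exp_div {ι : Type*} {F : Filter ι} {a b : ι → ℝ} {κ : ℝ}
    (hb : Tendsto b F (𝓝 0)) (hb0 : ∀ᶠ i in F, b i ≠ 0)
    (hab : Tendsto (fun i => a i / b i) F (𝓝 κ)) :
    Tendsto (fun i => (1 - Real.exp (-a i)) / (1 - Real.exp (-b i))) F (𝓝 κ) := by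
  set f : ℝ → ℝ := fun x => 1 - Real.exp (-x) with hf
  have hd : HasDerivAt f 1 0 := by
    have := ((hasDerivAt_neg (0 : ℝ)).exp).const_sub 1
    simpa using this
  -- The factorization 1 - exp(-x) = x d(x), with d continuous at 0 and d(0) = 1, reduces the
  -- quotient to a/b and needs no case distinction when a vanishes.
  have hg : ContinuousAt (dslope f 0) 0 :=
    continuousAt_dslope_same.2 hd.differentiableAt
  have hg0 : dslope f 0 0 = 1 := by rw [dslope_same, hd.deriv]
  have hfg : ∀ x, f x = x * dslope f 0 x := by
    intro x
    have := sub_smul_dslope f 0 x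
    simp only [sub_zero, smul_eq_mul] at this
    rw [this]
    simp [hf]
  have ha : Tendsto a F (𝓝 0) := by
    have h1 := hab.mul hb
    rw [mul_zero] at h1
    refine h1.congr' ?_
    filter_upwards [hb0] with i hi
    field_simp
  have h1 : Tendsto (fun i => dslope f 0 (a i)) F (𝓝 1) := by
    have := hg.tendsto.comp ha
    rwa [hg0] at this
  have h2 : Tendsto (fun i => dslope f 0 (b i)) F (𝓝 1) := by
    have := hg.tendsto.comp hb
    rwa [hg0] at this
  have h3 := hab.mul (h1.div h2 one_ne_zero)
  rw [div_one, mul_one] at h3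
  refine h3.congr fun i => ?_
  change a i / b i * (dslope f 0 (a i) / dslope f 0 (b i)) = f (a i) / f (b i)
  rw [hfg (a i), hfg (b i), div_mul_div_comm]

/-- Generating functions conditioned on non-extinction. -/
lemma integral_pow_cond_pos {Ω : Type*} [MeasurableSpace Ω] {P : Measure Ω}
    [IsProbabilityMeasure P] {Y : Ω → ℕ} (hY : Measurable Y) {s : ℝ} (hs : 0 ≤ s) (hs1 : s ≤ 1)
    (hpos : ∫ ω, (0 : ℝ) ^ Y ω ∂P < 1) :
    ∫ ω, s ^ Y ω ∂(cond P {ω | 0 < Y ω}) =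
      1 - (1 - ∫ ω, s ^ Y ω ∂P) / (1 - ∫ ω, (0 : ℝ) ^ Y ω ∂P) := by
  set A := {ω | 0 < Y ω} with hA
  have hAm : MeasurableSet A := hY (measurableSet_Ioi (a := 0))
  have hm : Measurable fun ω => s ^ Y ω :=
    (measurable_from_top (f := fun n : ℕ => s ^ n)).comp hY
  have hint : Integrable (fun ω => s ^ Y ω) P :=
    integrable_of_mem_Icc hm fun ω => pow_mem_Icc_zero_one hs hs1 _
  have h0 : ∫ ω, (0 : ℝ) ^ Y ω ∂P = P.real Aᶜ := by
    rw [← integral_indicator_one hAm.compl]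
    refine integral_congr_ae (ae_of_all _ fun ω => ?_)
    by_cases h : Y ω = 0
    · simp [hA, h]
    · simp [hA, h, Nat.pos_of_ne_zero h]
  -- Off the event Y > 0 the integrand is s^0 = 1, for s = 0 as well.
  have hc : ∫ ω in Aᶜ, s ^ Y ω ∂P = P.real Aᶜ := by
    rw [← setIntegral_one_eq_measureReal]
    refine setIntegral_congr_fun hAm.compl fun ω hω => ?_
    have : Y ω = 0 := by simpa [hA] using hω
    simp [this]
  have hsplit := integral_add_compl hAm hint
  have hPA : P.real A = 1 - P.real Aᶜ := by
    rw [probReal_compl_eq_one_sub hAm]; ring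
  rw [h0] at hpos ⊢
  have hne : 1 - P.real Aᶜ ≠ 0 := by linarith
  rw [ProbabilityTheory.cond, integral_smul_measure, smul_eq_mul, ENNReal.toReal_inv, ← measureReal_def, hPA]
  field_simp
  linarith

end Elementary

/-! ### The convolution for θ < 1 -/

section Convolution
variable {θ : ℝ} {r LR : ℝ → ℝ}

/-- By monotonicity (t/2) ψ(t) is at most the integral of ψ over [t/2, t], a difference of two
quantities with the same limit. -/
lemma tendsto_mul_of_antitoneOn_integrableOn {ψ : ℝ → ℝ} (hψ : AntitoneOn ψ (Ici 0))
    (hψ0 : ∀ u, 0 ≤ u → 0 ≤ ψ u) (hψi : IntegrableOn ψ (Ioi 0)) :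
    Tendsto (fun t => t * ψ t) atTop (𝓝 0) := by
  have hI : Tendsto (fun t => ∫ u in (0 : ℝ)..t, ψ u) atTop (𝓝 (∫ u in Ioi 0, ψ u)) :=
    intervalIntegral_tendsto_integral_Ioi 0 hψi tendsto_id
  have hI2 := hI.comp (tendsto_id.const_mul_atTop (show (0 : ℝ) < 1 / 2 by norm_num))
  have hlim := (hI.sub hI2).const_mul 2
  rw [sub_self, mul_zero] at hlim
  refine squeeze_zero' ?_ ?_ hlim
  · filter_upwards [eventually_ge_atTop 0] with t ht using mul_nonneg ht (hψ0 t ht)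
  · filter_upwards [eventually_ge_atTop 0] with t ht
    have hint : ∀ a b : ℝ, 0 ≤ a → 0 ≤ b → IntervalIntegrable ψ volume a b := by
      intro a b ha hb
      rw [intervalIntegrable_iff]
      exact hψi.mono_set fun x hx => (le_min ha hb).trans_lt hx.1
    have h1 : (∫ u in (0 : ℝ)..t, ψ u) - ∫ u in (0 : ℝ)..(1 / 2 * t), ψ u =
        ∫ u in (1 / 2 * t)..t, ψ u :=
      intervalIntegral.integral_interval_sub_left (hint _ _ le_rfl ht)
        (hint _ _ le_rfl (by positivity))
    have h2 : ∫ u in (1 / 2 * t)..t, ψ t ≤ ∫ u in (1 / 2 * t)..t, ψ u :=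
      intervalIntegral.integral_mono_on (by linarith) (by simp) (hint _ _ (by positivity) ht)
        fun u hu => hψ (mem_Ici.2 (le_trans (by positivity) hu.1)) ht hu.2
    rw [intervalIntegral.integral_const, smul_eq_mul] at h2
    simp only [Function.comp, id]
    rw [h1]
    linarith

/-- Convolution of a regularly varying function of index `-θ > -1` with an integrable function
dominated by a monotone integrable one. -/
theorem tendsto_convolution_div_of_lt_one (hLR : SlowlyVarying LR) (hθ : 0 ≤ θ) (hθ1 : θ < 1)
    (hr : ∀ t : ℝ, 0 < t → r t = t ^ (-θ) * LR t) (hr0 : ∀ t : ℝ, 0 ≤ t → 0 ≤ r t)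
    (hrint : ∀ t : ℝ, 0 ≤ t → IntervalIntegrable r volume 0 t)
    {φ ψ : ℝ → ℝ} (hψ : AntitoneOn ψ (Ici 0)) (hψi : IntegrableOn ψ (Ioi 0))
    (hφm : Measurable φ) (hφ0 : ∀ u, 0 ≤ u → 0 ≤ φ u) (hφψ : ∀ u, 0 ≤ u → φ u ≤ ψ u) :
    Tendsto (fun t => (∫ u in (0 : ℝ)..t, r u * φ (t - u)) / r t) atTop
      (𝓝 (∫ u in Ioi 0, φ u)) := by
  have hψ0 : ∀ u, 0 ≤ u → 0 ≤ ψ u := fun u hu => (hφ0 u hu).trans (hφψ u hu)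
  have hrpos := hLR.eventually_rpow_mul_pos hr
  obtain ⟨C, hC0, hC⟩ := hLR.eventually_forall_le_const_mul hθ hr (a := 1 / 2) (b := 1) (by norm_num)
  obtain ⟨M, hM0, hM⟩ := eventually_integral_le_of_tendsto_ratio hr0 hrint hrpos hC
    (k := (1 / 2 : ℝ) ^ (-θ)) (by
      rw [one_div, Real.inv_rpow (by norm_num), Real.rpow_neg (by norm_num), inv_inv]
      calc (2 : ℝ) ^ θ < 2 ^ (1 : ℝ) := Real.rpow_lt_rpow_of_exponent_lt (by norm_num) hθ1
        _ = 2 := Real.rpow_one 2) (hLR.tendsto_ratio_rpow hθ hr (by norm_num))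
  have hhalf : Tendsto (fun t : ℝ => 1 / 2 * t) atTop atTop :=
    tendsto_id.const_mul_atTop (by norm_num)
  -- For u ≤ t/2 the ratio r(t-u)/r(t) tends to 1 and is bounded by C, so Cψ dominates.
  have hA : Tendsto (fun t => ∫ u in Ioi (0 : ℝ),
      (Ioc 0 (1 / 2 * t)).indicator (fun u => r (t - u) / r t * φ u) u) atTop
      (𝓝 (∫ u in Ioi 0, φ u)) := by
    refine tendsto_integral_filter_of_dominated_convergence (fun u => C * ψ u) ?_ ?_
      (hψi.const_mul C) ?_
    · filter_upwards [eventually_ge_atTop 0] with t ht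
      have h1 : IntegrableOn (fun u => r (t - u)) (Ioc 0 (1 / 2 * t)) := by
        have h2 := ((hrint t ht).comp_sub_left t).symm
        simp only [sub_self, sub_zero] at h2
        rw [intervalIntegrable_iff, uIoc_of_le ht] at h2
        exact h2.mono_set (Ioc_subset_Ioc_right (by linarith))
      have h3 : AEStronglyMeasurable (fun u => r (t - u) / r t * φ u)
          (volume.restrict (Ioc 0 (1 / 2 * t))) := by
        have h4 := (h1.aestronglyMeasurable.mul_const (r t)⁻¹).mul
          (hφm.aestronglyMeasurable (μ := volume.restrict (Ioc 0 (1 / 2 * t))))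
        exact h4
      exact ((aestronglyMeasurable_indicator_iff measurableSet_Ioc).2 h3).mono_measure
        Measure.restrict_le_self
    · filter_upwards [hC, hrpos, eventually_gt_atTop 0] with t h1 h2 h3
      refine (ae_restrict_iff' measurableSet_Ioi).2 (ae_of_all _ fun u hu => ?_)
      have hu : 0 < u := hu
      have hψu := hψ0 u hu.le
      by_cases hmem : u ∈ Ioc 0 (1 / 2 * t)
      · rw [indicator_of_mem hmem, norm_mul, norm_div, Real.norm_of_nonneg (hφ0 u hu.le),
          Real.norm_of_nonneg h2.le, Real.norm_of_nonneg (hr0 _ (by linarith [hmem.2]))]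
        have h4 := h1 ((t - u) / t) ⟨by rw [le_div_iff₀ h3]; linarith [hmem.2],
          by rw [div_le_one h3]; linarith⟩
        rw [div_mul_cancel₀ _ h3.ne', ← div_le_iff₀ h2] at h4
        exact mul_le_mul h4 (hφψ u hu.le) (hφ0 u hu.le) hC0.le
      · rw [indicator_of_notMem hmem, norm_zero]
        positivity
    · refine (ae_restrict_iff' measurableSet_Ioi).2 (ae_of_all _ fun u hu => ?_)
      have hu : 0 < u := hu
      have hc : Tendsto (fun t : ℝ => (t - u) / t) atTop (𝓝 1) := by
        have h1 : Tendsto (fun t : ℝ => 1 - u / t) atTop (𝓝 (1 - 0)) :=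
          tendsto_const_nhds.sub (tendsto_const_nhds.div_atTop tendsto_id)
        rw [sub_zero] at h1
        refine h1.congr' ?_
        filter_upwards [eventually_gt_atTop 0] with t ht
        field_simp
      have hcθ : Tendsto (fun t : ℝ => ((t - u) / t) ^ (-θ)) atTop (𝓝 1) := by
        have := hc.rpow_const (p := -θ) (Or.inl one_ne_zero)
        rwa [Real.one_rpow] at this
      have hratio : Tendsto (fun t => r (t - u) / r t) atTop (𝓝 1) := by
        have hdiff : Tendsto (fun t => r (t - u) / r t - ((t - u) / t) ^ (-θ)) atTop (𝓝 0) := by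
          rw [Metric.tendsto_nhds]
          intro ε hε
          filter_upwards [hLR.eventually_forall_abs_sub_rpow_lt hθ hr (a := 1 / 2) (b := 1)
            (by norm_num) hε, eventually_gt_atTop 0,
            hc.eventually (lt_mem_nhds (show (1 / 2 : ℝ) < 1 by norm_num))] with t h1 h2 h3
          have := h1 ((t - u) / t) ⟨h3.le, by rw [div_le_one h2]; linarith⟩
          rw [div_mul_cancel₀ _ h2.ne'] at this
          rwa [Real.dist_eq, sub_zero]
        have := hdiff.add hcθ
        simpa using this
      have h4 := hratio.mul_const (φ u)
      rw [one_mul] at h4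
      refine h4.congr' ?_
      filter_upwards [hhalf.eventually_ge_atTop u] with t ht
      rw [indicator_of_mem (show u ∈ Ioc 0 (1 / 2 * t) from ⟨hu, ht⟩)]
  -- For u ≥ t/2, φ is at most ψ(t/2), while the integral of r over [0, t/2] is O(t r(t)) because θ
  -- < 1. The quotient is thus O(t ψ(t/2)), which vanishes.
  have hB : Tendsto (fun t => (∫ u in (1 / 2 * t)..t, r (t - u) * φ u) / r t) atTop (𝓝 0) := by
    have h1 := ((tendsto_mul_of_antitoneOn_integrableOn hψ hψ0 hψi).comp hhalf).const_mul (M * C)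
    rw [mul_zero] at h1
    refine squeeze_zero' ?_ ?_ h1
    · filter_upwards [hrpos, eventually_ge_atTop 0] with t h2 h3
      refine div_nonneg (intervalIntegral.integral_nonneg (by linarith) fun u hu => ?_) h2.le
      exact mul_nonneg (hr0 _ (by linarith [hu.2])) (hφ0 _ (le_trans (by positivity) hu.1))
    · filter_upwards [hrpos, eventually_ge_atTop 0, hhalf.eventually hM, hC] with t h2 h3 h4 h5
      have hint : IntervalIntegrable (fun u => r (t - u)) volume (1 / 2 * t) t := by
        have := (hrint (1 / 2 * t) (by positivity)).symm.comp_sub_left t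
        convert this using 1 <;> ring
      have h6 : ∫ u in (1 / 2 * t)..t, r (t - u) * φ u ≤
          ∫ u in (1 / 2 * t)..t, r (t - u) * ψ (1 / 2 * t) := by
        refine intervalIntegral.integral_mono_on_of_le_Ioo (by linarith) ?_
          (hint.mul_const _) fun u hu => ?_
        · refine (hint.mul_const (ψ (1 / 2 * t))).mono_fun' ?_ ?_
          · rw [intervalIntegrable_iff] at hint
            exact hint.aestronglyMeasurable.mul hφm.aestronglyMeasurable
          · refine (ae_restrict_iff' measurableSet_uIoc).2 (ae_of_all _ fun u hu => ?_)
            rw [uIoc_of_le (by linarith)] at hu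
            have hu0 : 0 ≤ u := le_trans (by positivity) hu.1.le
            dsimp only
            rw [Real.norm_of_nonneg (mul_nonneg (hr0 _ (by linarith [hu.2])) (hφ0 _ hu0))]
            exact mul_le_mul_of_nonneg_left ((hφψ u hu0).trans
              (hψ (mem_Ici.2 (by positivity)) hu0 hu.1.le)) (hr0 _ (by linarith [hu.2]))
        · have hu0 : 0 ≤ u := le_trans (by positivity) hu.1.le
          exact mul_le_mul_of_nonneg_left ((hφψ u hu0).trans
              (hψ (mem_Ici.2 (by positivity)) hu0 hu.1.le)) (hr0 _ (by linarith [hu.2]))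
      rw [intervalIntegral.integral_mul_const, intervalIntegral.integral_comp_sub_left
        (fun u => r u), sub_self, show t - 1 / 2 * t = 1 / 2 * t by ring] at h6
      have h7 := h5 (1 / 2) (by norm_num)
      have hψt := hψ0 (1 / 2 * t) (by positivity)
      rw [div_le_iff₀ h2]
      calc _ ≤ (∫ u in (0 : ℝ)..(1 / 2 * t), r u) * ψ (1 / 2 * t) := h6
        _ ≤ (M * (1 / 2 * t * r (1 / 2 * t))) * ψ (1 / 2 * t) := by gcongr
        _ ≤ (M * (1 / 2 * t * (C * r t))) * ψ (1 / 2 * t) := by gcongr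
        _ = _ := by simp only [Function.comp]; ring
  have hsum := hA.add hB
  rw [add_zero] at hsum
  refine hsum.congr' ?_
  filter_upwards [eventually_ge_atTop 0, hrpos] with t ht hrt
  have hint : IntervalIntegrable (fun u => r (t - u) * φ u) volume 0 t := by
    have h1 : IntervalIntegrable (fun u => r (t - u)) volume 0 t := by
      have := ((hrint t ht).comp_sub_left t).symm
      simpa using this
    refine (h1.mul_const (ψ 0)).mono_fun' ?_ ?_
    · rw [intervalIntegrable_iff] at h1
      exact h1.aestronglyMeasurable.mul hφm.aestronglyMeasurable
    · refine (ae_restrict_iff' measurableSet_uIoc).2 (ae_of_all _ fun u hu => ?_)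
      rw [uIoc_of_le ht] at hu
      dsimp only
      rw [Real.norm_of_nonneg (mul_nonneg (hr0 _ (by linarith [hu.2])) (hφ0 _ hu.1.le))]
      exact mul_le_mul_of_nonneg_left ((hφψ u hu.1.le).trans
        (hψ (mem_Ici.2 le_rfl) hu.1.le hu.1.le)) (hr0 _ (by linarith [hu.2]))
  have hsub : ∫ u in (0 : ℝ)..t, r u * φ (t - u) = ∫ u in (0 : ℝ)..t, r (t - u) * φ u := by
    have := intervalIntegral.integral_comp_sub_left (a := 0) (b := t)
      (fun u => r u * φ (t - u)) t
    simp only [sub_sub_cancel, sub_self, sub_zero] at this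
    exact this.symm
  have hhalf_mem : 1 / 2 * t ∈ uIcc 0 t := by
    rw [uIcc_of_le ht]; constructor <;> linarith
  rw [hsub, ← intervalIntegral.integral_add_adjacent_intervals
    (hint.mono_set (uIcc_subset_uIcc_left hhalf_mem))
    (hint.mono_set (uIcc_subset_uIcc_right hhalf_mem)), add_div]
  congr 1
  rw [setIntegral_indicator measurableSet_Ioc, inter_eq_self_of_subset_right Ioc_subset_Ioi_self,
    intervalIntegral.integral_of_le (by positivity), ← integral_div]
  refine setIntegral_congr_fun measurableSet_Ioc fun u _ => ?_
  ring

end Convolution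

/-! ### The convolution for θ ≥ 1 -/

section IntegratedIntensity
variable {θ : ℝ} {r LR : ℝ → ℝ}

/-- If the index of regular variation is at most `-1`, then `t * r t` is negligible compared
with the integral of `r`. -/
lemma SlowlyVarying.eventually_mul_le_integral (hLR : SlowlyVarying LR) (hθ : 1 ≤ θ)
    (hr : ∀ t : ℝ, 0 < t → r t = t ^ (-θ) * LR t) (hr0 : ∀ t : ℝ, 0 ≤ t → 0 ≤ r t)
    (hrint : ∀ t : ℝ, 0 ≤ t → IntervalIntegrable r volume 0 t) (N : ℝ) :
    ∀ᶠ t in atTop, N * (t * r t) ≤ ∫ u in (0 : ℝ)..t, r u := by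
  -- On [δt, t] uniform convergence with tolerance 1 gives r(u) ≥ r(t)(t/u - 1), whose integral is t
  -- r(t)(log(1/δ) - 1 + δ). The choice log(1/δ) = N + 1 makes this at least N t r(t).
  set δ := Real.exp (-(N + 1)) with hδ
  have hδ0 : 0 < δ := Real.exp_pos _
  rcases le_or_gt N 0 with hN | hN
  · filter_upwards [eventually_ge_atTop 0] with t ht
    refine (mul_nonpos_of_nonpos_of_nonneg hN (mul_nonneg ht (hr0 t ht))).trans ?_
    exact intervalIntegral.integral_nonneg ht fun u hu => hr0 u hu.1
  have hδ1 : δ < 1 := by rw [hδ, Real.exp_lt_one_iff]; linarith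
  filter_upwards [hLR.eventually_forall_abs_sub_rpow_lt (zero_le_one.trans hθ) hr (b := 1) hδ0
    one_pos, hLR.eventually_rpow_mul_pos hr, eventually_gt_atTop 0] with t h1 h2 h3
  have hδt : δ * t ≤ t := by nlinarith
  have hδt0 : 0 < δ * t := by positivity
  have hi1 : IntervalIntegrable r volume 0 (δ * t) := hrint _ hδt0.le
  have hi2 : IntervalIntegrable r volume (δ * t) t := hi1.symm.trans (hrint t h3.le)
  have hi3 : IntervalIntegrable (fun u => r t * (t * u⁻¹ - 1)) volume (δ * t) t := by
    refine ContinuousOn.intervalIntegrable ?_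
    rw [uIcc_of_le hδt]
    have : ContinuousOn (fun u : ℝ => u⁻¹) (Icc (δ * t) t) :=
      continuousOn_inv₀.mono fun u hu => (hδt0.trans_le hu.1).ne'
    exact continuousOn_const.mul ((continuousOn_const.mul this).sub continuousOn_const)
  have h4 : ∫ u in (δ * t)..t, r t * (t * u⁻¹ - 1) ≤ ∫ u in (δ * t)..t, r u := by
    refine intervalIntegral.integral_mono_on hδt hi3 hi2 fun u hu => ?_
    have hu0 : 0 < u := hδt0.trans_le hu.1
    have hc0 : 0 < u / t := by positivity
    have hc1 : u / t ≤ 1 := by rw [div_le_one h3]; exact hu.2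
    have h5 := (abs_lt.1 (h1 (u / t) ⟨by rw [le_div_iff₀ h3]; exact hu.1, hc1⟩)).1
    rw [div_mul_cancel₀ _ h3.ne'] at h5
    have h6 : (u / t) ^ (-1 : ℝ) ≤ (u / t) ^ (-θ) :=
      Real.rpow_le_rpow_of_exponent_ge hc0 hc1 (by linarith)
    rw [Real.rpow_neg_one, inv_div, div_eq_mul_inv] at h6
    have h7 : t * u⁻¹ - 1 ≤ r u / r t := by linarith
    rw [le_div_iff₀ h2] at h7
    linarith
  have h5 : ∫ u in (δ * t)..t, r t * (t * u⁻¹ - 1) = r t * (t * (N + 1) - (t - δ * t)) := by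
    rw [intervalIntegral.integral_const_mul, intervalIntegral.integral_sub, 
      intervalIntegral.integral_const_mul, integral_inv_of_pos hδt0 h3, intervalIntegral.integral_const]
    · have : t / (δ * t) = Real.exp (N + 1) := by
        rw [hδ, Real.exp_neg]; field_simp
      rw [this, Real.log_exp]
      simp
    · refine (ContinuousOn.intervalIntegrable ?_).const_mul _
      rw [uIcc_of_le hδt]
      exact continuousOn_inv₀.mono fun u hu => (hδt0.trans_le hu.1).ne'
    · simp
  rw [← intervalIntegral.integral_add_adjacent_intervals hi1 hi2]
  have h6 : 0 ≤ ∫ u in (0 : ℝ)..(δ * t), r u :=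
    intervalIntegral.integral_nonneg hδt0.le fun u hu => hr0 u hu.1
  have h7 : 0 ≤ r t * (δ * t) := by positivity
  nlinarith

lemma SlowlyVarying.eventually_integral_pos (hLR : SlowlyVarying LR) (hθ : 1 ≤ θ)
    (hr : ∀ t : ℝ, 0 < t → r t = t ^ (-θ) * LR t) (hr0 : ∀ t : ℝ, 0 ≤ t → 0 ≤ r t)
    (hrint : ∀ t : ℝ, 0 ≤ t → IntervalIntegrable r volume 0 t) :
    ∀ᶠ t in atTop, 0 < ∫ u in (0 : ℝ)..t, r u := by
  filter_upwards [hLR.eventually_mul_le_integral hθ hr hr0 hrint 1,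
    hLR.eventually_rpow_mul_pos hr, eventually_gt_atTop 0] with t h1 h2 h3
  exact lt_of_lt_of_le (by positivity) h1

lemma SlowlyVarying.tendsto_mul_div_integral (hLR : SlowlyVarying LR) (hθ : 1 ≤ θ)
    (hr : ∀ t : ℝ, 0 < t → r t = t ^ (-θ) * LR t) (hr0 : ∀ t : ℝ, 0 ≤ t → 0 ≤ r t)
    (hrint : ∀ t : ℝ, 0 ≤ t → IntervalIntegrable r volume 0 t) :
    Tendsto (fun t => t * r t / ∫ u in (0 : ℝ)..t, r u) atTop (𝓝 0) := by
  rw [Metric.tendsto_nhds]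
  intro ε hε
  filter_upwards [hLR.eventually_mul_le_integral hθ hr hr0 hrint (2 / ε),
    hLR.eventually_integral_pos hθ hr hr0 hrint, eventually_ge_atTop 0] with t h1 h2 h3
  have h4 : 0 ≤ t * r t := mul_nonneg h3 (hr0 t h3)
  rw [Real.dist_eq, sub_zero, abs_of_nonneg (div_nonneg h4 h2.le), div_lt_iff₀ h2]
  rw [div_mul_eq_mul_div, div_le_iff₀ hε] at h1
  nlinarith

/-- The integral of a regularly varying function of index at most `-1` is slowly varying. -/
lemma SlowlyVarying.tendsto_integral_two_mul_div (hLR : SlowlyVarying LR) (hθ : 1 ≤ θ)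
    (hr : ∀ t : ℝ, 0 < t → r t = t ^ (-θ) * LR t) (hr0 : ∀ t : ℝ, 0 ≤ t → 0 ≤ r t)
    (hrint : ∀ t : ℝ, 0 ≤ t → IntervalIntegrable r volume 0 t) :
    Tendsto (fun t => (∫ u in (0 : ℝ)..(2 * t), r u) / ∫ u in (0 : ℝ)..t, r u) atTop (𝓝 1) := by
  obtain ⟨C, hC0, hC⟩ := hLR.eventually_forall_le_const_mul (zero_le_one.trans hθ) hr
    (a := 1) (b := 2) one_pos
  have hlim := ((hLR.tendsto_mul_div_integral hθ hr hr0 hrint).const_mul C).const_add 1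
  rw [mul_zero, add_zero] at hlim
  refine tendsto_of_tendsto_of_tendsto_of_le_of_le' tendsto_const_nhds hlim ?_ ?_
  · filter_upwards [hLR.eventually_integral_pos hθ hr hr0 hrint, eventually_ge_atTop 0]
      with t h1 h2
    rw [one_le_div h1]
    refine intervalIntegral.integral_mono_interval le_rfl h2 (by linarith) ?_
      (hrint _ (by positivity))
    exact (ae_restrict_iff' measurableSet_Ioc).2 (ae_of_all _ fun u hu => hr0 u hu.1.le)
  · filter_upwards [hLR.eventually_integral_pos hθ hr hr0 hrint, eventually_gt_atTop 0, hC]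
      with t h1 h2 h3
    have hi1 := hrint t h2.le
    have hi2 : IntervalIntegrable r volume t (2 * t) := hi1.symm.trans (hrint _ (by positivity))
    have h4 : ∫ u in t..(2 * t), r u ≤ ∫ u in t..(2 * t), C * r t := by
      refine intervalIntegral.integral_mono_on (by linarith) hi2 (by simp) fun u hu => ?_
      have := h3 (u / t) ⟨by rw [le_div_iff₀ h2]; linarith [hu.1],
        by rw [div_le_iff₀ h2]; exact hu.2⟩
      rwa [div_mul_cancel₀ _ h2.ne'] at this
    rw [intervalIntegral.integral_const, smul_eq_mul] at h4
    rw [← intervalIntegral.integral_add_adjacent_intervals hi1 hi2, add_div, div_self h1.ne',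
      ← mul_div_assoc]
    gcongr
    linarith

/-- Convolution of a regularly varying function of index at most `-1` with monotone functions,
the integral of the dominating one being at most of the order of its argument times its value. -/
theorem tendsto_convolution_div_of_one_le (hLR : SlowlyVarying LR) (hθ : 1 ≤ θ)
    (hr : ∀ t : ℝ, 0 < t → r t = t ^ (-θ) * LR t) (hr0 : ∀ t : ℝ, 0 ≤ t → 0 ≤ r t)
    (hrint : ∀ t : ℝ, 0 ≤ t → IntervalIntegrable r volume 0 t)
    {ψ : ℝ → ℝ} (hψ : AntitoneOn ψ (Ici 0)) (hψpos : ∀ u, 0 ≤ u → 0 < ψ u) {M : ℝ}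
    (hM : ∀ᶠ t in atTop, ∫ u in (0 : ℝ)..t, ψ u ≤ M * (t * ψ t))
    {φ : ℝ → ℝ → ℝ} (hφ : ∀ t, AntitoneOn (φ t) (Ici 0)) (hφm : ∀ t, Measurable (φ t))
    (hφ0 : ∀ t u, 0 ≤ u → 0 ≤ φ t u) (hφψ : ∀ t u, 0 ≤ u → φ t u ≤ ψ u)
    {κ : ℝ → ℝ} (hκ : ContinuousAt κ 1)
    (hlim : ∀ τ, 0 < τ → τ ≤ 1 → Tendsto (fun t => φ t (τ * t) / ψ t) atTop (𝓝 (κ τ))) :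
    Tendsto (fun t => (∫ u in (0 : ℝ)..t, r u * φ t (t - u)) / ((∫ u in (0 : ℝ)..t, r u) * ψ t))
      atTop (𝓝 (κ 1)) := by
  have hint : ∀ t, 0 ≤ t → IntervalIntegrable (fun u => r u * φ t (t - u)) volume 0 t := by
    intro t ht
    refine ((hrint t ht).mul_const (φ t 0)).mono_fun' ?_ ?_
    · have h1 := hrint t ht
      rw [intervalIntegrable_iff] at h1
      have h2 : Measurable fun u => φ t (t - u) := (hφm t).comp (measurable_const.sub measurable_id)
      exact h1.aestronglyMeasurable.mul h2.aestronglyMeasurable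
    · refine (ae_restrict_iff' measurableSet_uIoc).2 (ae_of_all _ fun u hu => ?_)
      rw [uIoc_of_le ht] at hu
      have hu' : 0 ≤ t - u := by linarith [hu.2]
      dsimp only
      rw [Real.norm_of_nonneg (mul_nonneg (hr0 _ hu.1.le) (hφ0 _ _ hu'))]
      exact mul_le_mul_of_nonneg_left (hφ t (mem_Ici.2 le_rfl) hu' hu') (hr0 _ hu.1.le)
  have hRpos := hLR.eventually_integral_pos hθ hr hr0 hrint
  refine tendsto_order.2 ⟨fun a ha => ?_, fun a ha => ?_⟩
  -- Lower bound: φ_t(t-u) ≥ φ_t(t) by monotonicity.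
  · filter_upwards [(hlim 1 one_pos le_rfl).eventually (lt_mem_nhds ha), hRpos,
      eventually_gt_atTop 0] with t h1 h2 h3
    rw [one_mul] at h1
    refine h1.trans_le ?_
    have hψt := hψpos t h3.le
    rw [div_le_div_iff₀ hψt (by positivity)]
    have h4 : ∫ u in (0 : ℝ)..t, r u * φ t t ≤ ∫ u in (0 : ℝ)..t, r u * φ t (t - u) := by
      refine intervalIntegral.integral_mono_on h3.le ((hrint t h3.le).mul_const _) (hint t h3.le)
        fun u hu => mul_le_mul_of_nonneg_left ?_ (hr0 u hu.1)
      exact hφ t (mem_Ici.2 (by linarith [hu.2])) h3.le (by linarith [hu.1])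
    rw [intervalIntegral.integral_mul_const] at h4
    nlinarith
  -- Upper bound: cut at u = (1-τ)t. Before the cut φ_t(t-u) ≤ φ_t(τt); after it r ≤ C r(t), and the
  -- contribution is at most C M t r(t) ψ(t) = o(R(t) ψ(t)). Finally τ < 1 is taken close to 1, by
  -- continuity of κ.
  · obtain ⟨τ, hτa, hτ0, hτ1⟩ : ∃ τ, κ τ < a ∧ 0 < τ ∧ τ < 1 := by
      have h1 : ∀ᶠ τ in 𝓝[<] (1 : ℝ), κ τ < a :=
        (hκ.tendsto.mono_left nhdsWithin_le_nhds).eventually (gt_mem_nhds ha)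
      have h2 : ∀ᶠ τ in 𝓝[<] (1 : ℝ), 0 < τ := nhdsWithin_le_nhds (lt_mem_nhds one_pos)
      obtain ⟨τ, h⟩ := ((h1.and h2).and self_mem_nhdsWithin).exists
      exact ⟨τ, h.1.1, h.1.2, h.2⟩
    obtain ⟨C, hC0, hC⟩ := hLR.eventually_forall_le_const_mul (zero_le_one.trans hθ) hr
      (a := 1 - τ) (b := 1) (by linarith)
    have hup := (hlim τ hτ0 hτ1.le).add
      ((hLR.tendsto_mul_div_integral hθ hr hr0 hrint).const_mul (C * M))
    rw [mul_zero, add_zero] at hup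
    filter_upwards [hup.eventually (gt_mem_nhds hτa), hRpos, eventually_gt_atTop 0, hC, hM]
      with t h1 h2 h3 h4 h5
    refine lt_of_le_of_lt ?_ h1
    have hψt := hψpos t h3.le
    have hmem : (1 - τ) * t ∈ uIcc 0 t := by
      rw [uIcc_of_le h3.le]; constructor <;> nlinarith
    have hmem' := hmem
    rw [uIcc_of_le h3.le] at hmem'
    have hi1 := (hint t h3.le).mono_set (uIcc_subset_uIcc_left hmem)
    have hi2 := (hint t h3.le).mono_set (uIcc_subset_uIcc_right hmem)
    have hr1 := (hrint t h3.le).mono_set (uIcc_subset_uIcc_left hmem)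
    have hψint : IntervalIntegrable ψ volume 0 t := by
      refine AntitoneOn.intervalIntegrable ?_
      rw [uIcc_of_le h3.le]
      exact hψ.mono fun u hu => hu.1
    have hψint' : IntervalIntegrable (fun u => ψ (t - u)) volume 0 t := by
      have := (hψint.comp_sub_left t).symm
      simpa using this
    have h6 : ∫ u in (0 : ℝ)..((1 - τ) * t), r u * φ t (t - u) ≤
        φ t (τ * t) * ∫ u in (0 : ℝ)..t, r u := by
      calc _ ≤ ∫ u in (0 : ℝ)..((1 - τ) * t), r u * φ t (τ * t) := by
            refine intervalIntegral.integral_mono_on hmem'.1 hi1 (hr1.mul_const _)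
              fun u hu => mul_le_mul_of_nonneg_left ?_ (hr0 u hu.1)
            exact hφ t (mem_Ici.2 (by positivity)) (mem_Ici.2 (by linarith [hu.2, hmem'.2]))
              (by linarith [hu.2])
        _ = φ t (τ * t) * ∫ u in (0 : ℝ)..((1 - τ) * t), r u := by
            rw [intervalIntegral.integral_mul_const, mul_comm]
        _ ≤ _ := by
            refine mul_le_mul_of_nonneg_left ?_ (hφ0 _ _ (by positivity))
            refine intervalIntegral.integral_mono_interval le_rfl hmem'.1 hmem'.2 ?_
              (hrint t h3.le)
            exact (ae_restrict_iff' measurableSet_Ioc).2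
              (ae_of_all _ fun u hu => hr0 u hu.1.le)
    have h7 : ∫ u in ((1 - τ) * t)..t, r u * φ t (t - u) ≤ C * r t * (M * (t * ψ t)) := by
      calc _ ≤ ∫ u in ((1 - τ) * t)..t, C * r t * ψ (t - u) := by
            refine intervalIntegral.integral_mono_on hmem'.2 hi2
              ((hψint'.mono_set (uIcc_subset_uIcc_right hmem)).const_mul _) fun u hu => ?_
            have hu0 : 0 ≤ t - u := by linarith [hu.2]
            have h8 := h4 (u / t) ⟨by rw [le_div_iff₀ h3]; exact hu.1,
              by rw [div_le_one h3]; exact hu.2⟩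
            rw [div_mul_cancel₀ _ h3.ne'] at h8
            exact mul_le_mul h8 (hφψ t _ hu0) (hφ0 t _ hu0)
              (mul_nonneg hC0.le (hr0 t h3.le))
        _ = C * r t * ∫ u in (0 : ℝ)..(τ * t), ψ u := by
            rw [intervalIntegral.integral_const_mul, intervalIntegral.integral_comp_sub_left
              (fun u => ψ u), sub_self, show t - (1 - τ) * t = τ * t by ring]
        _ ≤ _ := by
            refine mul_le_mul_of_nonneg_left (le_trans ?_ h5) (mul_nonneg hC0.le (hr0 t h3.le))
            refine intervalIntegral.integral_mono_interval le_rfl (by positivity)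
              (by nlinarith) ?_ hψint
            exact (ae_restrict_iff' measurableSet_Ioc).2
              (ae_of_all _ fun u hu => (hψpos u hu.1.le).le)
    rw [← intervalIntegral.integral_add_adjacent_intervals hi1 hi2]
    calc _ ≤ (φ t (τ * t) * (∫ u in (0 : ℝ)..t, r u) + C * r t * (M * (t * ψ t))) /
          ((∫ u in (0 : ℝ)..t, r u) * ψ t) := by gcongr
      _ = _ := by field_simp

/-- The product of the integral with a regularly varying monotone function tends to zero. -/
lemma SlowlyVarying.tendsto_integral_mul_zero (hLR : SlowlyVarying LR) (hθ : 1 ≤ θ)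
    (hr : ∀ t : ℝ, 0 < t → r t = t ^ (-θ) * LR t) (hr0 : ∀ t : ℝ, 0 ≤ t → 0 ≤ r t)
    (hrint : ∀ t : ℝ, 0 ≤ t → IntervalIntegrable r volume 0 t)
    {ψ : ℝ → ℝ} (hψ : AntitoneOn ψ (Ici 0)) (hψpos : ∀ u, 0 ≤ u → 0 < ψ u) {k : ℝ} (hk : k < 1)
    (hlim : Tendsto (fun t => ψ (2 * t) / ψ t) atTop (𝓝 k)) :
    Tendsto (fun t => (∫ u in (0 : ℝ)..t, r u) * ψ t) atTop (𝓝 0) := by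
  have hR2 := hLR.tendsto_integral_two_mul_div hθ hr hr0 hrint
  have hRpos := hLR.eventually_integral_pos hθ hr hr0 hrint
  -- The integral is slowly varying, so the product inherits the doubling factor k < 1 of ψ. The
  -- constant 2 works because eventually R(2t) ≤ 2R(t) and ψ decreases.
  refine tendsto_zero_of_tendsto_ratio ?_ (C := 2) ?_ hk ?_
  · filter_upwards [hRpos, eventually_ge_atTop 0] with t h1 h2 using mul_pos h1 (hψpos t h2)
  · filter_upwards [hRpos, eventually_gt_atTop 0,
      hR2.eventually (gt_mem_nhds (show (1 : ℝ) < 2 by norm_num))] with t h1 h2 h3 c hc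
    rw [div_lt_iff₀ h1] at h3
    have h4 : ∫ u in (0 : ℝ)..(c * t), r u ≤ ∫ u in (0 : ℝ)..(2 * t), r u := by
      refine intervalIntegral.integral_mono_interval le_rfl (by nlinarith [hc.1])
        (by nlinarith [hc.2]) ?_ (hrint _ (by positivity))
      exact (ae_restrict_iff' measurableSet_Ioc).2 (ae_of_all _ fun u hu => hr0 u hu.1.le)
    have hct : 0 ≤ c * t := by nlinarith [hc.1]
    have h5 : ψ (c * t) ≤ ψ t := hψ (mem_Ici.2 h2.le) (mem_Ici.2 hct) (by nlinarith [hc.1])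
    rw [← mul_assoc]
    exact mul_le_mul (h4.trans h3.le) h5 (hψpos _ hct).le (by positivity)
  · have := hR2.mul hlim
    rw [one_mul] at this
    refine this.congr fun t => ?_
    rw [div_mul_div_comm]

end IntegratedIntensity

/-! ### L'Hôpital's rule for a divergent denominator -/

section LHopital

/-- For ℓ < k < a the function N - kV is eventually decreasing, so N/V ≤ k + const/V, and V
diverges. No assumption on the limit of N is needed. -/
lemma eventually_div_lt_of_tendsto_deriv_div {N V n v : ℝ → ℝ}
    (hN : ∀ᶠ x in atTop, HasDerivAt N (n x) x) (hV : ∀ᶠ x in atTop, HasDerivAt V (v x) x)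
    (hv : ∀ᶠ x in atTop, 0 < v x) (hVtop : Tendsto V atTop atTop) {ℓ a : ℝ}
    (hlim : Tendsto (fun x => n x / v x) atTop (𝓝 ℓ)) (ha : ℓ < a) :
    ∀ᶠ x in atTop, N x / V x < a := by
  obtain ⟨k, hk1, hk2⟩ := exists_between ha
  obtain ⟨Y, hY⟩ := eventually_atTop.1 (hN.and (hV.and (hv.and (hlim.eventually (gt_mem_nhds hk1)))))
  have hD : ∀ x, Y ≤ x → HasDerivAt (fun x => N x - k * V x) (n x - k * v x) x := fun x hx =>
    (hY x hx).1.sub ((hY x hx).2.1.const_mul k)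
  have hanti : AntitoneOn (fun x => N x - k * V x) (Ici Y) := by
    refine antitoneOn_of_deriv_nonpos (convex_Ici Y)
      (fun x hx => (hD x hx).continuousAt.continuousWithinAt) ?_ ?_
    · rw [interior_Ici]
      exact fun x hx => (hD x (le_of_lt hx)).differentiableAt.differentiableWithinAt
    · rw [interior_Ici]
      intro x hx
      have hx : Y < x := hx
      have h1 := hY x hx.le
      rw [(hD x hx.le).deriv]
      have := (div_lt_iff₀ h1.2.2.1).1 h1.2.2.2
      linarith
  have h2 : Tendsto (fun x => k + (N Y - k * V Y) / V x) atTop (𝓝 k) := by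
    have := (tendsto_const_nhds (x := N Y - k * V Y)).div_atTop hVtop
    simpa using this.const_add k
  filter_upwards [h2.eventually (gt_mem_nhds hk2), hVtop.eventually_gt_atTop 0,
    eventually_ge_atTop Y] with x h3 h4 h5
  refine lt_of_le_of_lt ?_ h3
  have h6 : N x - k * V x ≤ N Y - k * V Y := hanti self_mem_Ici h5 h5
  rw [div_le_iff₀ h4, add_mul, div_mul_cancel₀ _ h4.ne']
  linarith

/-- L'Hôpital's rule at infinity for a denominator tending to infinity. -/
lemma tendsto_div_of_tendsto_deriv_div {N V n v : ℝ → ℝ}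
    (hN : ∀ᶠ x in atTop, HasDerivAt N (n x) x) (hV : ∀ᶠ x in atTop, HasDerivAt V (v x) x)
    (hv : ∀ᶠ x in atTop, 0 < v x) (hVtop : Tendsto V atTop atTop) {ℓ : ℝ}
    (hlim : Tendsto (fun x => n x / v x) atTop (𝓝 ℓ)) :
    Tendsto (fun x => N x / V x) atTop (𝓝 ℓ) := by
  refine tendsto_order.2 ⟨fun a ha => ?_,
    fun a ha => eventually_div_lt_of_tendsto_deriv_div hN hV hv hVtop hlim ha⟩
  have h := eventually_div_lt_of_tendsto_deriv_div (N := fun x => -N x) (n := fun x => -n x)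
    (hN.mono fun x hx => hx.neg) hV hv hVtop (ℓ := -ℓ) (a := -a)
    (by simpa only [neg_div] using hlim.neg) (neg_lt_neg ha)
  filter_upwards [h] with x hx
  rw [neg_div] at hx
  linarith

end LHopital

/-! ### Regular variation of V and asymptotic inversion -/

section VRegular
variable {p : PMF ℕ}

lemma hasDerivAt_Vfun (hf : ∀ u : ℝ, 0 ≤ u → u < 1 → u < pgf p u) {x : ℝ} (hx : 1 < x) :
    HasDerivAt (Vfun p) (1 / (pgf p (1 - 1 / x) - (1 - 1 / x)) * (1 / x ^ 2)) x := by
  have hx0 : 0 < x := by linarith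
  have hmem := one_sub_one_div_mem_Ico hx.le
  have hpos : 0 < 1 - 1 / x := by
    have : 1 / x < 1 := (div_lt_one hx0).2 hx
    linarith
  have hcont : ContinuousAt (fun u => 1 / (pgf p u - u)) (1 - 1 / x) :=
    (continuousOn_one_div_pgf_sub p hf).continuousAt (Ico_mem_nhds hpos hmem.2)
  have hmeas : StronglyMeasurableAtFilter (fun u => 1 / (pgf p u - u)) (𝓝 (1 - 1 / x)) volume :=
    ⟨Ico 0 1, Ico_mem_nhds hpos hmem.2,
      (continuousOn_one_div_pgf_sub p hf).aestronglyMeasurable measurableSet_Ico⟩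
  have h1 := intervalIntegral.integral_hasDerivAt_right
    (intervalIntegrable_one_div_pgf_sub p hf ⟨le_rfl, one_pos⟩ hmem) hmeas hcont
  have h2 : HasDerivAt (fun x : ℝ => 1 - 1 / x) (1 / x ^ 2) x := by
    have := (hasDerivAt_inv hx0.ne').const_sub 1
    simpa [one_div] using this
  exact h1.comp x h2

/-- Since f ≤ 1, f(u) - u is at most 1 - u, whose reciprocal integrates to log x. Hence V is
unbounded. -/
lemma log_le_Vfun (hf : ∀ u : ℝ, 0 ≤ u → u < 1 → u < pgf p u) {x : ℝ} (hx : 1 ≤ x) :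
    Real.log x ≤ Vfun p x := by
  have hmem := one_sub_one_div_mem_Ico hx
  have hx0 : 0 < x := by linarith
  have h1 : ∫ u in (0 : ℝ)..(1 - 1 / x), 1 / (1 - u) = Real.log x := by
    rw [intervalIntegral.integral_comp_sub_left (fun u => 1 / u)]
    simp only [sub_sub_cancel, sub_zero]
    rw [integral_one_div_of_pos (by positivity) one_pos, one_div_one_div]
  rw [← h1]
  refine intervalIntegral.integral_mono_on hmem.1 ?_
    (intervalIntegrable_one_div_pgf_sub p hf ⟨le_rfl, one_pos⟩ hmem) fun u hu => ?_
  · refine ContinuousOn.intervalIntegrable ?_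
    rw [uIcc_of_le hmem.1]
    refine continuousOn_const.div (by fun_prop) fun u hu => ?_
    have := hu.2.trans_lt hmem.2
    linarith
  · have hu1 := hu.2.trans_lt hmem.2
    have := pgf_le_one p hu.1 hu1.le
    exact one_div_le_one_div_of_le (sub_pos.2 (hf u hu.1 hu1)) (by linarith)

lemma tendsto_Vfun_atTop (hf : ∀ u : ℝ, 0 ≤ u → u < 1 → u < pgf p u) :
    Tendsto (Vfun p) atTop atTop :=
  tendsto_atTop_mono' _ ((eventually_ge_atTop 1).mono fun _ hx => log_le_Vfun hf hx)
    Real.tendsto_log_atTop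

/-- `V` is regularly varying with index `γ`. -/
lemma tendsto_Vfun_ratio (hf : ∀ u : ℝ, 0 ≤ u → u < 1 → u < pgf p u) {γ : ℝ} {L : ℝ → ℝ}
    (hL : SlowlyVarying L)
    (hfL : ∀ s : ℝ, 0 ≤ s → s < 1 → pgf p s = s + (1 - s) ^ (γ + 1) * L (1 / (1 - s)))
    {c : ℝ} (hc : 0 < c) :
    Tendsto (fun x => Vfun p (c * x) / Vfun p x) atTop (𝓝 (c ^ γ)) := by
  set v : ℝ → ℝ := fun x => 1 / (pgf p (1 - 1 / x) - (1 - 1 / x)) * (1 / x ^ 2) with hv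
  have hcx : Tendsto (fun x : ℝ => c * x) atTop atTop := tendsto_id.const_mul_atTop hc
  -- The derivative of V is x^(γ-1)/L(x), regularly varying of index γ - 1; L'Hôpital transfers the
  -- ratio limit to V.
  have hvL : ∀ x, 1 < x → v x = x ^ (γ - 1) / L x := by
    intro x hx
    have hx0 : 0 < x := by linarith
    have hmem := one_sub_one_div_mem_Ico hx.le
    have h1 := hfL _ hmem.1 hmem.2
    rw [sub_sub_cancel, one_div_one_div] at h1
    rw [hv]
    dsimp only
    rw [h1, add_sub_cancel_left, one_div x, Real.inv_rpow hx0.le, ← Real.rpow_natCast x 2,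
      show γ - 1 = γ + 1 - (2 : ℕ) by push_cast; ring, Real.rpow_sub hx0]
    simp only [one_div, mul_inv, inv_inv]
    field_simp
  refine tendsto_div_of_tendsto_deriv_div (n := fun x => c * v (c * x)) (v := v) ?_ ?_ ?_
    (tendsto_Vfun_atTop hf) ?_
  · filter_upwards [hcx.eventually_gt_atTop 1] with x hx
    have h1 := (hasDerivAt_Vfun hf hx).comp x ((hasDerivAt_id x).const_mul c)
    rw [mul_one, mul_comm] at h1
    exact h1
  · filter_upwards [eventually_gt_atTop 1] with x hx using hasDerivAt_Vfun hf hx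
  · filter_upwards [eventually_gt_atTop 1] with x hx
    have hmem := one_sub_one_div_mem_Ico hx.le
    have := sub_pos.2 (hf _ hmem.1 hmem.2)
    have hx0 : 0 < x := by linarith
    exact mul_pos (one_div_pos.2 this) (by positivity)
  · have h1 := ((hL.tendsto_ratio c hc).inv₀ one_ne_zero).const_mul (c ^ γ)
    rw [inv_one, mul_one] at h1
    refine h1.congr' ?_
    filter_upwards [eventually_gt_atTop 1, hcx.eventually_gt_atTop 1] with x hx hx2
    have hx0 : 0 < x := by linarith
    rw [hvL x hx, hvL _ hx2, Real.mul_rpow hc.le hx0.le, Real.rpow_sub_one hc.ne']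
    have := (Real.rpow_pos_of_pos hx0 (γ - 1)).ne'
    rw [inv_div]
    field_simp

/-- Passing to 1/V makes the lemmas on decreasing functions applicable. The range starts at 2
because V(1) = 0 and division by zero would break monotonicity. -/
lemma antitoneOn_one_div_Vfun (hf : ∀ u : ℝ, 0 ≤ u → u < 1 → u < pgf p u) :
    AntitoneOn (fun x => 1 / Vfun p x) (Ici 2) := by
  intro x hx y hy hxy
  have hx : 2 ≤ x := hx
  have h1 : 0 < Vfun p x := by
    rw [← Vfun_one p]
    exact strictMonoOn_Vfun p hf (by simp) (mem_Ici.2 (by linarith)) (by linarith)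
  exact one_div_le_one_div_of_le h1 ((strictMonoOn_Vfun p hf).monotoneOn
    (mem_Ici.2 (by linarith)) (mem_Ici.2 (by linarith)) hxy)

lemma tendsto_one_div_Vfun_ratio (hf : ∀ u : ℝ, 0 ≤ u → u < 1 → u < pgf p u) {γ : ℝ} {L : ℝ → ℝ}
    (hL : SlowlyVarying L)
    (hfL : ∀ s : ℝ, 0 ≤ s → s < 1 → pgf p s = s + (1 - s) ^ (γ + 1) * L (1 / (1 - s)))
    (c : ℝ) (hc : 0 < c) :
    Tendsto (fun x => (1 / Vfun p (c * x)) / (1 / Vfun p x)) atTop (𝓝 (c ^ (-γ))) := by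
  have h := (tendsto_Vfun_ratio hf hL hfL hc).inv₀ (Real.rpow_pos_of_pos hc γ).ne'
  rw [← Real.rpow_neg hc.le] at h
  refine h.congr fun x => ?_
  rw [inv_div, div_div_div_eq, one_mul, mul_one]

variable {ι : Type*} {F : Filter ι} {w w' : ι → ℝ} {γ : ℝ} {L : ℝ → ℝ}

lemma tendsto_Vfun_div_Vfun (hf : ∀ u : ℝ, 0 ≤ u → u < 1 → u < pgf p u)
    (hL : SlowlyVarying L)
    (hfL : ∀ s : ℝ, 0 ≤ s → s < 1 → pgf p s = s + (1 - s) ^ (γ + 1) * L (1 / (1 - s)))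
    (hw : Tendsto w F atTop) {ρ : ℝ} (hρ : 0 < ρ)
    (hw' : Tendsto (fun i => w' i / w i) F (𝓝 ρ)) :
    Tendsto (fun i => Vfun p (w' i) / Vfun p (w i)) F (𝓝 (ρ ^ γ)) := by
  have h := tendsto_div_of_tendsto_ratio_of_antitoneOn (antitoneOn_one_div_Vfun hf)
    (((tendsto_Vfun_atTop hf).eventually_gt_atTop 0).mono fun x hx => one_div_pos.2 hx)
    (tendsto_one_div_Vfun_ratio hf hL hfL) hw hρ hw'
  have h2 := h.inv₀ (Real.rpow_pos_of_pos hρ (-γ)).ne'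
  rw [← Real.rpow_neg hρ.le, neg_neg] at h2
  refine h2.congr fun i => ?_
  rw [inv_div, div_div_div_eq, one_mul, mul_one]

lemma tendsto_div_of_tendsto_Vfun_div (hf : ∀ u : ℝ, 0 ≤ u → u < 1 → u < pgf p u)
    (hL : SlowlyVarying L) (hγ : 0 < γ)
    (hfL : ∀ s : ℝ, 0 ≤ s → s < 1 → pgf p s = s + (1 - s) ^ (γ + 1) * L (1 / (1 - s)))
    (hw : Tendsto w F atTop) (hw1 : ∀ᶠ i in F, 1 ≤ w' i) {ρ : ℝ} (hρ : 0 < ρ)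
    (hw' : Tendsto (fun i => Vfun p (w' i) / Vfun p (w i)) F (𝓝 (ρ ^ γ))) :
    Tendsto (fun i => w' i / w i) F (𝓝 ρ) := by
  have hργ := Real.rpow_pos_of_pos hρ γ
  have hVw := (tendsto_Vfun_atTop hf).comp hw
  have htop : Tendsto (fun i => Vfun p (w' i)) F atTop := by
    refine (hw'.pos_mul_atTop hργ hVw).congr' ?_
    filter_upwards [hVw.eventually_gt_atTop 0] with i hi
    have hi : 0 < Vfun p (w i) := hi
    simp only [Function.comp]
    field_simp
  refine tendsto_div_of_tendsto_div_of_antitoneOn hγ (antitoneOn_one_div_Vfun hf)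
    (((tendsto_Vfun_atTop hf).eventually_gt_atTop 0).mono fun x hx => one_div_pos.2 hx)
    (tendsto_one_div_Vfun_ratio hf hL hfL) hw ?_ hρ ?_
  -- Divergence of V(w') forces w' into the range where 1/V is monotone.
  · filter_upwards [htop.eventually_gt_atTop (Vfun p 2), hw1] with i h1 h2
    exact ((strictMonoOn_Vfun p hf).lt_iff_lt (mem_Ici.2 one_le_two) h2).1 h1 |>.le
  · have h2 := hw'.inv₀ hργ.ne'
    rw [← Real.rpow_neg hρ.le] at h2
    refine h2.congr fun i => ?_
    rw [inv_div, div_div_div_eq, one_mul, mul_one]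

end VRegular

/-! ### Regular variation of q -/

section QRegular
variable {μ : ℝ} {p b : PMF ℕ} {s t u : ℝ}

lemma qfun_mem_Icc (hμ : 0 < μ) (hs : 0 ≤ s) (hs1 : s ≤ 1) : qfun μ p b t s ∈ Icc (0 : ℝ) 1 := by
  have h := branchingF_mem_Icc p (t := t) hμ hs hs1
  have h1 := pgf_nonneg b h.1
  have h2 := pgf_le_one b h.1 h.2
  constructor <;> rw [qfun] <;> linarith

lemma qfun_le_qfun_zero (hμ : 0 < μ) (hs : 0 ≤ s) (hs1 : s ≤ 1) :
    qfun μ p b t s ≤ qfun μ p b t 0 := by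
  have h := branchingF_mem_Icc p (t := t) hμ le_rfl zero_le_one
  have := pgf_mono b h.1 (branchingF_mono_right p hμ le_rfl hs hs1)
    (branchingF_mem_Icc p (t := t) hμ hs hs1).2
  rw [qfun, qfun]
  linarith

lemma measurable_qfun (hμ : 0 < μ) (hs : 0 ≤ s) (hs1 : s ≤ 1) :
    Measurable fun t => qfun μ p b t s :=
  measurable_const.sub (measurable_pgf_branchingF p b hμ hs hs1)

lemma antitoneOn_qfun (hμ : 0 < μ) (hp : ∫⁻ n, (n : ENNReal) ∂p.toMeasure ≤ 1)
    (hf : ∀ u : ℝ, 0 ≤ u → u < 1 → u < pgf p u) (hs : 0 ≤ s) (hs1 : s < 1) :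
    AntitoneOn (fun t => qfun μ p b t s) (Ici 0) := by
  intro t ht u hu htu
  have := pgf_mono b (branchingF_mem_Icc p (t := t) hμ hs hs1.le).1
    (monotoneOn_branchingF p hμ hp hf hs hs1 ht hu htu)
    (branchingF_mem_Icc p (t := u) hμ hs hs1.le).2
  simp only [qfun]
  linarith

lemma qfun_pos (hμ : 0 < μ) (hp : ∫⁻ n, (n : ENNReal) ∂p.toMeasure ≤ 1)
    (hg : ∀ u : ℝ, 0 ≤ u → u < 1 → pgf b u < 1) (hs : 0 ≤ s) (hs1 : s < 1) (ht : 0 ≤ t) :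
    0 < qfun μ p b t s :=
  sub_pos.2 (hg _ (branchingF_mem_Icc p hμ hs hs1.le).1 (branchingF_lt_one p hμ hp hs hs1 ht))

lemma one_le_one_div_one_sub_branchingF (hμ : 0 < μ)
    (hp : ∫⁻ n, (n : ENNReal) ∂p.toMeasure ≤ 1) (hs : 0 ≤ s) (hs1 : s < 1) (ht : 0 ≤ t) :
    1 ≤ 1 / (1 - branchingF μ p t s) := by
  have h1 := (branchingF_mem_Icc p (t := t) hμ hs hs1.le).1
  have h2 := branchingF_lt_one p hμ hp hs hs1 ht
  rw [le_div_iff₀ (by linarith)]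
  linarith

lemma Vfun_branchingF_zero (hμ : 0 < μ) (hp : ∫⁻ n, (n : ENNReal) ∂p.toMeasure ≤ 1)
    (hf : ∀ u : ℝ, 0 ≤ u → u < 1 → u < pgf p u) (ht : 0 ≤ t) :
    Vfun p (1 / (1 - branchingF μ p t 0)) = μ * t := by
  rw [Vfun_branchingF p hμ hp hf le_rfl one_pos ht, sub_zero, div_one, Vfun_one, zero_add]

lemma tendsto_one_div_one_sub_branchingF (hμ : 0 < μ)
    (hp : ∫⁻ n, (n : ENNReal) ∂p.toMeasure ≤ 1)
    (hf : ∀ u : ℝ, 0 ≤ u → u < 1 → u < pgf p u) :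
    Tendsto (fun t => 1 / (1 - branchingF μ p t 0)) atTop atTop := by
  refine tendsto_atTop.2 fun B => ?_
  filter_upwards [eventually_ge_atTop 0,
    (tendsto_id.const_mul_atTop hμ).eventually_gt_atTop (Vfun p (max B 1))] with t h1 h2
  have h2 : Vfun p (max B 1) < μ * t := h2
  rw [← Vfun_branchingF_zero hμ hp hf h1] at h2
  exact (le_max_left _ _).trans (((strictMonoOn_Vfun p hf).lt_iff_lt (mem_Ici.2 (le_max_right _ _))
    (one_le_one_div_one_sub_branchingF hμ hp le_rfl one_pos h1)).1 h2).le

/-- Regular variation of the immigration function along the trajectories of `F`. -/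
theorem tendsto_qfun_div (hμ : 0 < μ) (hp : ∫⁻ n, (n : ENNReal) ∂p.toMeasure ≤ 1)
    (hf : ∀ u : ℝ, 0 ≤ u → u < 1 → u < pgf p u) {α γ : ℝ} (hγ : 0 < γ) {L l : ℝ → ℝ}
    (hL : SlowlyVarying L) (hl : SlowlyVarying l)
    (hfL : ∀ s : ℝ, 0 ≤ s → s < 1 → pgf p s = s + (1 - s) ^ (γ + 1) * L (1 / (1 - s)))
    (hgl : ∀ s : ℝ, 0 ≤ s → s < 1 → pgf b s = 1 - (1 - s) ^ α * l (1 / (1 - s)))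
    (hα : 0 < α) {σ : ℝ → ℝ} (hσ0 : ∀ t, 0 ≤ σ t) (hσ1 : ∀ t, σ t < 1) {a τ : ℝ} (ha : 0 ≤ a)
    (hτ : 0 < τ) (hσ : Tendsto (fun t => Vfun p (1 / (1 - σ t)) / (μ * t)) atTop (𝓝 a)) :
    Tendsto (fun t => qfun μ p b (τ * t) (σ t) / qfun μ p b t 0) atTop
      (𝓝 ((a + τ) ^ (-(α / γ)))) := by
  -- Then q = G(1/(1-F)), and G is decreasing on [1, ∞) because the generating function increases,
  -- so the squeeze for decreasing functions applies.
  set G : ℝ → ℝ := fun x => x ^ (-α) * l x with hG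
  have hGq : ∀ x, x ∈ Ico (0 : ℝ) 1 → G (1 / (1 - x)) = 1 - pgf b x := by
    intro x hx
    have : 0 < 1 - x := by linarith [hx.2]
    rw [hG, hgl x hx.1 hx.2]
    dsimp only
    rw [one_div, Real.inv_rpow this.le, Real.rpow_neg this.le, inv_inv]
    ring
  have hGanti : AntitoneOn G (Ici 1) := by
    intro x hx y hy hxy
    have hx' := one_sub_one_div_mem_Ico (mem_Ici.1 hx)
    have hy' := one_sub_one_div_mem_Ico (mem_Ici.1 hy)
    have h1 := hGq _ hx'
    have h2 := hGq _ hy'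
    rw [sub_sub_cancel, one_div_one_div] at h1 h2
    rw [h1, h2]
    have hx0 : 0 < x := zero_lt_one.trans_le hx
    have := pgf_mono b hx'.1 (sub_le_sub_left (one_div_le_one_div_of_le hx0 hxy) 1) hy'.2.le
    linarith
  have hGr : ∀ t : ℝ, 0 < t → G t = t ^ (-α) * l t := fun _ _ => rfl
  set w : ℝ → ℝ := fun t => 1 / (1 - branchingF μ p t 0) with hw
  have hwtop : Tendsto w atTop atTop := tendsto_one_div_one_sub_branchingF hμ hp hf
  have haτ : 0 < a + τ := by linarith
  have hρ : 0 < (a + τ) ^ (1 / γ) := Real.rpow_pos_of_pos haτ _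
  have hργ : ((a + τ) ^ (1 / γ)) ^ γ = a + τ := by
    rw [← Real.rpow_mul haτ.le, one_div_mul_cancel hγ.ne', Real.rpow_one]
  have hργ' : ((a + τ) ^ (1 / γ)) ^ (-α) = (a + τ) ^ (-(α / γ)) := by
    rw [← Real.rpow_mul haτ.le]
    congr 1
    ring
  -- V linearizes the flow: the numerator is V(1/(1-σ(t))) + μτt and the denominator is μt, so the
  -- limit is a + τ. Inverting V takes the power 1/γ.
  have hVlim : Tendsto (fun t => Vfun p (1 / (1 - branchingF μ p (τ * t) (σ t))) / Vfun p (w t))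
      atTop (𝓝 (((a + τ) ^ (1 / γ)) ^ γ)) := by
    rw [hργ]
    refine (hσ.add_const τ).congr' ?_
    filter_upwards [eventually_gt_atTop 0] with t ht
    rw [hw, Vfun_branchingF p hμ hp hf (hσ0 t) (hσ1 t) (by positivity),
      Vfun_branchingF_zero hμ hp hf ht.le]
    field_simp
  have hdiv := tendsto_div_of_tendsto_Vfun_div hf hL hγ hfL hwtop
    (by
      filter_upwards [eventually_ge_atTop 0] with t ht
      exact one_le_one_div_one_sub_branchingF hμ hp (hσ0 t) (hσ1 t) (by positivity)) hρ hVlim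
  have hGdiv := tendsto_div_of_tendsto_ratio_of_antitoneOn hGanti
    (hl.eventually_rpow_mul_pos hGr)
    (fun c hc => hl.tendsto_ratio_rpow hα.le hGr hc) hwtop hρ hdiv
  rw [hργ'] at hGdiv
  refine hGdiv.congr' ?_
  filter_upwards [eventually_ge_atTop 0] with t ht
  rw [hw, hGq _ ⟨(branchingF_mem_Icc p hμ (hσ0 t) (hσ1 t).le).1,
    branchingF_lt_one p hμ hp (hσ0 t) (hσ1 t) (by positivity)⟩,
    hGq _ ⟨(branchingF_mem_Icc p hμ le_rfl zero_le_one).1,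
    branchingF_lt_one p hμ hp le_rfl one_pos ht⟩, qfun, qfun]

/-- The argument `exp (-λ / w)` enters `V` like `w / λ`. -/
lemma tendsto_Vfun_exp_div {ι : Type*} {F : Filter ι} {w : ι → ℝ}
    (hf : ∀ u : ℝ, 0 ≤ u → u < 1 → u < pgf p u) {γ : ℝ} {L : ℝ → ℝ} (hL : SlowlyVarying L)
    (hfL : ∀ s : ℝ, 0 ≤ s → s < 1 → pgf p s = s + (1 - s) ^ (γ + 1) * L (1 / (1 - s)))
    (hw : Tendsto w F atTop) {lam : ℝ} (hlam : 0 < lam) :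
    Tendsto (fun i => Vfun p (1 / (1 - Real.exp (-(lam / w i)))) / Vfun p (w i)) F
      (𝓝 (lam ^ (-γ))) := by
  have hinv : Tendsto (fun i => (w i)⁻¹) F (𝓝 0) := tendsto_inv_atTop_zero.comp hw
  have hw0 := hw.eventually_gt_atTop 0
  have h1 : Tendsto (fun i => (1 - Real.exp (-(lam / w i))) / (1 - Real.exp (-(w i)⁻¹))) F
      (𝓝 lam) := by
    refine tendsto_one_sub_exp_div hinv (hw0.mono fun i hi => (inv_pos.2 hi).ne') ?_
    refine tendsto_const_nhds.congr' (hw0.mono fun i hi => ?_)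
    field_simp
  have h2 : Tendsto (fun i => (1 - Real.exp (-(w i)⁻¹)) / (w i)⁻¹) F (𝓝 1) := by
    have hd : HasDerivAt (fun x : ℝ => 1 - Real.exp (-x)) 1 0 := by
      have := ((hasDerivAt_neg (0 : ℝ)).exp).const_sub 1
      simpa using this
    have h3 := hd.tendsto_slope.comp (tendsto_nhdsWithin_iff.2
      ⟨hinv, hw0.mono fun i hi => (inv_pos.2 hi).ne'⟩)
    refine h3.congr fun i => ?_
    simp [slope_def_field]
  have h3 := ((h1.mul h2).inv₀ (by simpa using hlam.ne'))
  rw [mul_one] at h3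
  have h4 := tendsto_Vfun_div_Vfun (w' := fun i => 1 / (1 - Real.exp (-(lam / w i)))) hf hL hfL hw
    (inv_pos.2 hlam) (h3.congr' ?_)
  · rwa [Real.inv_rpow hlam.le, ← Real.rpow_neg hlam.le] at h4
  · filter_upwards [hw0] with i hi
    have : 0 < 1 - Real.exp (-(w i)⁻¹) := by
      rw [sub_pos, Real.exp_lt_one_iff]
      simpa using hi
    rw [div_mul_div_cancel₀ this.ne', inv_div]
    ring

end QRegular

/-! ### Extending the expansions at s = 1 to all of [0, 1) -/

section Hypotheses

lemma tendsto_one_div_one_sub_nhdsLT_one :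
    Tendsto (fun s : ℝ => 1 / (1 - s)) (𝓝[<] 1) atTop := by
  have h : Tendsto (fun s : ℝ => 1 - s) (𝓝[<] 1) (𝓝[>] 0) := by
    refine tendsto_nhdsWithin_iff.2 ⟨?_, ?_⟩
    · have : Tendsto (fun s : ℝ => 1 - s) (𝓝 1) (𝓝 (1 - 1)) := Continuous.tendsto (by fun_prop) 1
      rw [sub_self] at this
      exact this.mono_left nhdsWithin_le_nhds
    · filter_upwards [self_mem_nhdsWithin] with s hs
      exact sub_pos.2 (show s < 1 from hs)
  exact (tendsto_inv_nhdsGT_zero.comp h).congr fun s => (one_div _).symm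

lemma SlowlyVarying.eventually_rpow_mul_nhdsLT_one_pos {L : ℝ → ℝ} (hL : SlowlyVarying L) (γ : ℝ) :
    ∀ᶠ s in 𝓝[<] (1 : ℝ), 0 < (1 - s) ^ γ * L (1 / (1 - s)) := by
  filter_upwards [tendsto_one_div_one_sub_nhdsLT_one.eventually hL.eventually_pos,
    self_mem_nhdsWithin] with s h1 h2
  exact mul_pos (Real.rpow_pos_of_pos (sub_pos.2 h2) _) h1

lemma eventually_nonneg_and_lt_one_nhdsLT_one : ∀ᶠ s in 𝓝[<] (1 : ℝ), 0 ≤ s ∧ s < 1 := by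
  filter_upwards [nhdsWithin_le_nhds (lt_mem_nhds one_pos), self_mem_nhdsWithin] with s h1 h2
  exact ⟨le_of_lt h1, h2⟩

/-- Positivity of `L` is only given near infinity, that is for s near 1; the chord slope argument
carries the inequality down to 0. -/
lemma lt_pgf_of_slowlyVarying {p : PMF ℕ} {γ : ℝ} {L : ℝ → ℝ} (hL : SlowlyVarying L)
    (hf : ∀ s : ℝ, 0 ≤ s → s < 1 → pgf p s = s + (1 - s) ^ (γ + 1) * L (1 / (1 - s)))
    (u : ℝ) (hu : 0 ≤ u) (hu1 : u < 1) : u < pgf p u := by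
  refine lt_pgf_of_frequently p (Eventually.frequently ?_) hu hu1
  filter_upwards [hL.eventually_rpow_mul_nhdsLT_one_pos (γ + 1),
    eventually_nonneg_and_lt_one_nhdsLT_one] with s h1 h2
  rw [hf s h2.1 h2.2]
  linarith

lemma pgf_lt_one_of_slowlyVarying {b : PMF ℕ} {α : ℝ} {l : ℝ → ℝ} (hl : SlowlyVarying l)
    (hg : ∀ s : ℝ, 0 ≤ s → s < 1 → pgf b s = 1 - (1 - s) ^ α * l (1 / (1 - s)))
    (u : ℝ) (hu : 0 ≤ u) (hu1 : u < 1) : pgf b u < 1 := by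
  refine pgf_lt_one_of_frequently b (Eventually.frequently ?_) hu hu1
  filter_upwards [hl.eventually_rpow_mul_nhdsLT_one_pos α,
    eventually_nonneg_and_lt_one_nhdsLT_one] with s h1 h2
  rw [hg s h2.1 h2.2]
  linarith

end Hypotheses

/-! ### The convolution of r with q for θ ≥ 1 -/

section ConvolutionQ
variable {μ θ α γ : ℝ} {p b : PMF ℕ} {L l r LR : ℝ → ℝ}

lemma tendsto_qfun_mul_div_qfun (hμ : 0 < μ) (hα : 0 < α) (hγ : 0 < γ)
    (hL : SlowlyVarying L) (hl : SlowlyVarying l)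
    (hf : ∀ s : ℝ, 0 ≤ s → s < 1 → pgf p s = s + (1 - s) ^ (γ + 1) * L (1 / (1 - s)))
    (hg : ∀ s : ℝ, 0 ≤ s → s < 1 → pgf b s = 1 - (1 - s) ^ α * l (1 / (1 - s)))
    {τ : ℝ} (hτ : 0 < τ) :
    Tendsto (fun t => qfun μ p b (τ * t) 0 / qfun μ p b t 0) atTop (𝓝 (τ ^ (-(α / γ)))) := by
  have hfs := lt_pgf_of_slowlyVarying hL hf
  have h := tendsto_qfun_div (b := b) hμ
    (lintegral_natCast_le_one p fun t h0 h1 => (hfs t h0 h1).le) hfs hγ hL hl hf hg hα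
    (σ := fun _ => 0) (fun _ => le_rfl) (fun _ => one_pos) le_rfl hτ (by simp [Vfun_one])
  simpa using h

/-- The argument σ(t) moves with t; domination by q(·;0) is uniform in it. Since α/γ < 1, the
integral of q(·;0) over [0, t] is O(t q(t;0)), as the convolution theorem requires. -/
lemma tendsto_convolution_qfun_div (hμ : 0 < μ) (hα : 0 < α) (hγ : 0 < γ) (hαγ : α / γ < 1)
    (hθ : 1 ≤ θ) (hL : SlowlyVarying L) (hl : SlowlyVarying l)
    (hf : ∀ s : ℝ, 0 ≤ s → s < 1 → pgf p s = s + (1 - s) ^ (γ + 1) * L (1 / (1 - s)))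
    (hg : ∀ s : ℝ, 0 ≤ s → s < 1 → pgf b s = 1 - (1 - s) ^ α * l (1 / (1 - s)))
    (hLR : SlowlyVarying LR) (hr0 : ∀ t : ℝ, 0 ≤ t → 0 ≤ r t)
    (hrint : ∀ t : ℝ, 0 ≤ t → IntervalIntegrable r volume 0 t)
    (hr : ∀ t : ℝ, 0 < t → r t = t ^ (-θ) * LR t)
    {σ : ℝ → ℝ} (hσ0 : ∀ t, 0 ≤ σ t) (hσ1 : ∀ t, σ t < 1) {a : ℝ} (ha : 0 ≤ a)
    (hσ : Tendsto (fun t => Vfun p (1 / (1 - σ t)) / (μ * t)) atTop (𝓝 a)) :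
    Tendsto (fun t => (∫ u in (0 : ℝ)..t, r u * qfun μ p b (t - u) (σ t)) /
      ((∫ u in (0 : ℝ)..t, r u) * qfun μ p b t 0)) atTop (𝓝 ((a + 1) ^ (-(α / γ)))) := by
  have hfs := lt_pgf_of_slowlyVarying hL hf
  have hp := lintegral_natCast_le_one p fun t h0 h1 => (hfs t h0 h1).le
  have hanti : AntitoneOn (fun t => qfun μ p b t 0) (Ici 0) :=
    antitoneOn_qfun hμ hp hfs le_rfl one_pos
  have hpos : ∀ t, 0 ≤ t → 0 < qfun μ p b t 0 := fun t ht =>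
    qfun_pos hμ hp (pgf_lt_one_of_slowlyVarying hl hg) le_rfl one_pos ht
  have hratio := tendsto_qfun_mul_div_qfun (p := p) (b := b) hμ hα hγ hL hl hf hg
    (show (0 : ℝ) < 1 / 2 by norm_num)
  obtain ⟨M, -, hM⟩ := eventually_integral_le_of_tendsto_ratio (a := fun t => qfun μ p b t 0)
    (fun t ht => (hpos t ht).le)
    (fun t ht => (hanti.mono (by rw [uIcc_of_le ht]; exact fun x hx => hx.1)).intervalIntegrable)
    -- Monotonicity makes a single ratio sufficient: q(ct;0) ≤ q(t/2;0) for c in [1/2, 1], so any C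
    -- above (1/2)^(-α/γ) works.
    ((eventually_ge_atTop 0).mono hpos) (C := (1 / 2 : ℝ) ^ (-(α / γ)) + 1) (by
      filter_upwards [hratio.eventually (gt_mem_nhds (lt_add_one _)), eventually_gt_atTop 0]
        with t h1 h2 c hc
      have h3 := (div_lt_iff₀ (hpos t h2.le)).1 h1
      refine le_trans (hanti (mem_Ici.2 (by positivity)) (mem_Ici.2 ?_) ?_) h3.le
      · nlinarith [hc.1]
      · nlinarith [hc.1]) (k := (1 / 2 : ℝ) ^ (-(α / γ))) (by
      rw [one_div, Real.inv_rpow (by norm_num), Real.rpow_neg (by norm_num), inv_inv]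
      calc (2 : ℝ) ^ (α / γ) < 2 ^ (1 : ℝ) := Real.rpow_lt_rpow_of_exponent_lt (by norm_num) hαγ
        _ = 2 := Real.rpow_one 2) hratio
  refine tendsto_convolution_div_of_one_le (κ := fun τ => (a + τ) ^ (-(α / γ)))
    (φ := fun t u => qfun μ p b u (σ t)) hLR hθ hr hr0 hrint hanti hpos hM
    (fun t => antitoneOn_qfun hμ hp hfs (hσ0 t) (hσ1 t))
    (fun t => measurable_qfun hμ (hσ0 t) (hσ1 t).le)
    (fun t u _ => (qfun_mem_Icc hμ (hσ0 t) (hσ1 t).le).1)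
    (fun t u _ => qfun_le_qfun_zero hμ (hσ0 t) (hσ1 t).le) ?_
    (fun τ hτ _ => tendsto_qfun_div hμ hp hfs hγ hL hl hf hg hα hσ0 hσ1 ha hτ hσ)
  exact (continuousAt_const.add continuousAt_id).rpow_const (Or.inl (by simp; linarith))

end ConvolutionQ

/-! ### The conditional limit theorems -/

section Immigration
variable {Ω : Type*} [MeasurableSpace Ω] {P : Measure Ω} [IsProbabilityMeasure P]
  {μ θ α γ : ℝ} {p b : PMF ℕ} {L l r LR : ℝ → ℝ}
  {ν : ℝ≥0 → Ω → ℕ} {I : ℕ → Ω → ℕ} {T : ℕ × ℕ → Ω → LifeTree}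

lemma measure_pos_of_integral_zero_pow_lt_one {Y : Ω → ℕ} (h : ∫ ω, (0 : ℝ) ^ Y ω ∂P < 1) :
    P {ω | 0 < Y ω} ≠ 0 := by
  intro h0
  have h1 : ∀ᵐ ω ∂P, Y ω = 0 := by
    rw [ae_iff]
    simpa [Nat.pos_iff_ne_zero] using h0
  have h2 : ∫ ω, (0 : ℝ) ^ Y ω ∂P = 1 := by
    rw [integral_congr_ae (g := fun _ => (1 : ℝ)) (h1.mono fun ω hω => by simp [hω])]
    simp
  linarith

/-- The conditional generating function in terms of the exponents of the generating functions,
which tend to zero. -/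
lemma IsImmigrationModel.tendsto_integral_pow_cond (hM : IsImmigrationModel μ p b r ν I T P)
    (hμ : 0 < μ) (hp : ∫⁻ n, (n : ENNReal) ∂p.toMeasure ≤ 1) (hr0 : ∀ u, 0 ≤ u → 0 ≤ r u)
    (hrint : ∀ t : ℝ, 0 ≤ t → IntervalIntegrable r volume 0 t)
    {σ : ℝ → ℝ} (hσ0 : ∀ t, 0 ≤ σ t) (hσ1 : ∀ t, σ t ≤ 1) {κ : ℝ}
    (hpos : ∀ᶠ t in atTop, 0 < ∫ u in (0 : ℝ)..t, r u * qfun μ p b (t - u) 0)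
    (hzero : Tendsto (fun t => ∫ u in (0 : ℝ)..t, r u * qfun μ p b (t - u) 0) atTop (𝓝 0))
    (hlim : Tendsto (fun t => (∫ u in (0 : ℝ)..t, r u * qfun μ p b (t - u) (σ t)) /
      ∫ u in (0 : ℝ)..t, r u * qfun μ p b (t - u) 0) atTop (𝓝 κ)) :
    (∀ᶠ t : ℝ≥0 in atTop, P {ω | 0 < immigrationY ν I T t ω} ≠ 0) ∧
    Tendsto (fun t : ℝ≥0 => ∫ ω, σ t ^ immigrationY ν I T t ω
      ∂(ProbabilityTheory.cond P {ω | 0 < immigrationY ν I T t ω})) atTop (𝓝 (1 - κ)) := by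
  have hcoe : Tendsto (fun t : ℝ≥0 => (t : ℝ)) atTop atTop := NNReal.tendsto_coe_atTop.2 tendsto_id
  have hlt : ∀ᶠ t : ℝ≥0 in atTop, ∫ ω, (0 : ℝ) ^ immigrationY ν I T t ω ∂P < 1 := by
    filter_upwards [hcoe.eventually hpos] with t ht
    rw [hM.integral_pow_Y hμ hp hr0 le_rfl zero_le_one t (hrint t t.2), Real.exp_lt_one_iff]
    linarith
  refine ⟨hlt.mono fun t ht => measure_pos_of_integral_zero_pow_lt_one ht, ?_⟩
  have h := ((tendsto_one_sub_exp_div hzero (hpos.mono fun t ht => ht.ne') hlim).const_sub 1).comp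
    hcoe
  refine h.congr' ?_
  filter_upwards [hlt] with t ht
  rw [integral_pow_cond_pos (hM.measurable_Y t) (hσ0 t) (hσ1 t) ht,
    hM.integral_pow_Y hμ hp hr0 le_rfl zero_le_one t (hrint t t.2),
    hM.integral_pow_Y hμ hp hr0 (hσ0 t) (hσ1 t) t (hrint t t.2)]
  rfl

/-- The conditional Laplace transforms of the normalized population size converge. -/
lemma IsImmigrationModel.tendsto_integral_exp_cond (hM : IsImmigrationModel μ p b r ν I T P)
    (hμ : 0 < μ) (hα : 0 < α) (hγ : 0 < γ) (hαγ : α / γ < 1)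
    (hθ : 1 ≤ θ) (hL : SlowlyVarying L) (hl : SlowlyVarying l)
    (hf : ∀ s : ℝ, 0 ≤ s → s < 1 → pgf p s = s + (1 - s) ^ (γ + 1) * L (1 / (1 - s)))
    (hg : ∀ s : ℝ, 0 ≤ s → s < 1 → pgf b s = 1 - (1 - s) ^ α * l (1 / (1 - s)))
    (hLR : SlowlyVarying LR) (hr0 : ∀ t : ℝ, 0 ≤ t → 0 ≤ r t)
    (hrint : ∀ t : ℝ, 0 ≤ t → IntervalIntegrable r volume 0 t)
    (hr : ∀ t : ℝ, 0 < t → r t = t ^ (-θ) * LR t) {lam : ℝ} (hlam : 0 < lam) :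
    (∀ᶠ t : ℝ≥0 in atTop, P {ω | 0 < immigrationY ν I T t ω} ≠ 0) ∧
    Tendsto (fun t : ℝ≥0 => ∫ ω, Real.exp (-(lam * (immigrationY ν I T t ω / Wfun p (μ * t))))
      ∂(ProbabilityTheory.cond P {ω | 0 < immigrationY ν I T t ω})) atTop
      (𝓝 (1 - (1 + lam ^ (-γ)) ^ (-(α / γ)))) := by
  have hfs := lt_pgf_of_slowlyVarying hL hf
  have hp := lintegral_natCast_le_one p fun t h0 h1 => (hfs t h0 h1).le
  have hpos : ∀ t, 0 ≤ t → 0 < qfun μ p b t 0 := fun t ht =>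
    qfun_pos hμ hp (pgf_lt_one_of_slowlyVarying hl hg) le_rfl one_pos ht
  have hV0 : Tendsto (fun t => Vfun p (1 / (1 - 0)) / (μ * t)) atTop (𝓝 0) := by simp [Vfun_one]
  have hB := tendsto_convolution_qfun_div hμ hα hγ hαγ hθ hL hl hf hg hLR hr0 hrint hr
    (σ := fun _ => 0) (fun _ => le_rfl) (fun _ => one_pos) le_rfl hV0
  rw [zero_add, Real.one_rpow] at hB
  have hRq := hLR.tendsto_integral_mul_zero hθ hr hr0 hrint
    (antitoneOn_qfun (b := b) hμ hp hfs le_rfl one_pos) hpos (k := (2 : ℝ) ^ (-(α / γ)))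
    (Real.rpow_lt_one_of_one_lt_of_neg one_lt_two (neg_lt_zero.2 (div_pos hα hγ)))
    (tendsto_qfun_mul_div_qfun hμ hα hγ hL hl hf hg two_pos)
  have hRqpos : ∀ᶠ t in atTop, 0 < (∫ u in (0 : ℝ)..t, r u) * qfun μ p b t 0 := by
    filter_upwards [hLR.eventually_integral_pos hθ hr hr0 hrint, eventually_ge_atTop 0]
      with t h1 h2 using mul_pos h1 (hpos t h2)
  have hBpos : ∀ᶠ t in atTop, 0 < ∫ u in (0 : ℝ)..t, r u * qfun μ p b (t - u) 0 := by
    filter_upwards [hRqpos, hB.eventually (lt_mem_nhds one_pos)] with t h1 h2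
    exact (div_pos_iff_of_pos_right h1).1 h2
  have hB0 : Tendsto (fun t => ∫ u in (0 : ℝ)..t, r u * qfun μ p b (t - u) 0) atTop (𝓝 0) := by
    have h := hB.mul hRq
    rw [one_mul] at h
    refine h.congr' (hRqpos.mono fun t ht => ?_)
    rw [div_mul_cancel₀ _ ht.ne']
  -- The absolute value makes w positive for every real t, so that exp(-λ/w(t)) lies in [0, 1)
  -- everywhere; for t ≥ 0 it is W(μt).
  set w : ℝ → ℝ := fun t => 1 / (1 - branchingF μ p |t| 0) with hw
  have hw0 : ∀ t, 0 < w t := fun t => zero_lt_one.trans_le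
    (one_le_one_div_one_sub_branchingF hμ hp le_rfl one_pos (abs_nonneg t))
  have hwtop : Tendsto w atTop atTop :=
    (tendsto_one_div_one_sub_branchingF hμ hp hfs).comp tendsto_abs_atTop_atTop
  have hσ0 : ∀ t, 0 ≤ Real.exp (-(lam / w t)) := fun t => (Real.exp_pos _).le
  have hσ1 : ∀ t, Real.exp (-(lam / w t)) < 1 := fun t => by
    rw [Real.exp_lt_one_iff, neg_lt_zero]
    exact div_pos hlam (hw0 t)
  have hV : Tendsto (fun t => Vfun p (1 / (1 - Real.exp (-(lam / w t)))) / (μ * t)) atTop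
      (𝓝 (lam ^ (-γ))) := by
    refine (tendsto_Vfun_exp_div hfs hL hf hwtop hlam).congr' ?_
    filter_upwards [eventually_ge_atTop 0] with t ht
    have h1 : Vfun p (w t) = μ * t := by
      rw [hw]
      dsimp only
      rw [abs_of_nonneg ht, Vfun_branchingF_zero hμ hp hfs ht]
    rw [h1]
  have hA := tendsto_convolution_qfun_div hμ hα hγ hαγ hθ hL hl hf hg hLR hr0 hrint hr
    hσ0 hσ1 (Real.rpow_nonneg hlam.le _) hV
  -- Both exponents are normalized by the same R(t) q(t;0), and the one at s = 0 has limit 1.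
  have hAB := hA.div hB one_ne_zero
  rw [div_one] at hAB
  obtain ⟨h1, h2⟩ := hM.tendsto_integral_pow_cond hμ hp hr0 hrint hσ0 (fun t => (hσ1 t).le)
    hBpos hB0 (hAB.congr' (hRqpos.mono fun t ht => div_div_div_cancel_right₀ ht.ne' _ _))
  refine ⟨h1, ?_⟩
  rw [add_comm 1]
  refine h2.congr fun t => ?_
  have h3 : Wfun p (μ * t) = w t := by
    rw [Wfun_mul p hμ hp hfs t.coe_nonneg, hw]
    dsimp only
    rw [abs_of_nonneg t.coe_nonneg]
  refine integral_congr_ae (ae_of_all _ fun ω => ?_)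
  dsimp only
  rw [h3, ← Real.exp_nat_mul]
  congr 1
  ring

/-- Continuity at 0 with value 1: no mass of the conditional laws escapes to infinity. -/
lemma tendsto_one_sub_rpow_div (hα : 0 < α) (hγ : 0 < γ) :
    Tendsto (fun lam : ℝ => 1 - lam ^ α / (1 + lam ^ γ) ^ (α / γ)) (𝓝[>] 0) (𝓝 1) := by
  have h1 : Tendsto (fun lam : ℝ => lam ^ α) (𝓝 0) (𝓝 0) := by
    have := (Real.continuousAt_rpow_const 0 α (Or.inr hα.le)).tendsto
    rwa [Real.zero_rpow hα.ne'] at this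
  have h2 : Tendsto (fun lam : ℝ => lam ^ γ) (𝓝 0) (𝓝 0) := by
    have := (Real.continuousAt_rpow_const 0 γ (Or.inr hγ.le)).tendsto
    rwa [Real.zero_rpow hγ.ne'] at this
  have h3 := (h2.const_add 1).rpow_const (p := α / γ) (Or.inl (by norm_num))
  rw [add_zero, Real.one_rpow] at h3
  have h4 := (h1.div h3 one_ne_zero).const_sub 1
  rw [zero_div, sub_zero] at h4
  exact h4.mono_left nhdsWithin_le_nhds

lemma rpow_div_one_add_rpow (hγ : 0 < γ) {lam : ℝ} (hlam : 0 < lam) :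
    lam ^ α / (1 + lam ^ γ) ^ (α / γ) = (1 + lam ^ (-γ)) ^ (-(α / γ)) := by
  have hg := Real.rpow_pos_of_pos hlam γ
  have h1 : 1 + lam ^ (-γ) = (lam ^ γ / (1 + lam ^ γ))⁻¹ := by
    rw [Real.rpow_neg hlam.le, inv_div]
    field_simp
    ring
  rw [h1, Real.inv_rpow (by positivity), Real.rpow_neg (by positivity), inv_inv,
    Real.div_rpow hg.le (by positivity), ← Real.rpow_mul hlam.le, mul_div_cancel₀ _ hγ.ne']

theorem IsImmigrationModel.exists_limit_law (hM : IsImmigrationModel μ p b r ν I T P)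
    (hμ : 0 < μ) (hα : 0 < α) (hγ : 0 < γ) (hγ1 : γ ≤ 1) (hαγ : α / γ < 1)
    (hθ : 1 ≤ θ) (hL : SlowlyVarying L) (hl : SlowlyVarying l)
    (hf : ∀ s : ℝ, 0 ≤ s → s < 1 → pgf p s = s + (1 - s) ^ (γ + 1) * L (1 / (1 - s)))
    (hg : ∀ s : ℝ, 0 ≤ s → s < 1 → pgf b s = 1 - (1 - s) ^ α * l (1 / (1 - s)))
    (hLR : SlowlyVarying LR) (hr0 : ∀ t : ℝ, 0 ≤ t → 0 ≤ r t)
    (hrint : ∀ t : ℝ, 0 ≤ t → IntervalIntegrable r volume 0 t)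
    (hr : ∀ t : ℝ, 0 < t → r t = t ^ (-θ) * LR t) :
    ∃ D : Measure ℝ, IsProbabilityMeasure D ∧ D (Iio 0) = 0 ∧
      (∀ lam : ℝ, 0 < lam →
        ∫ x, Real.exp (-(lam * x)) ∂D = 1 - lam ^ α / (1 + lam ^ γ) ^ (α / γ)) ∧
      ∀ x : ℝ, 0 ≤ x →
        Tendsto (fun t : ℝ≥0 =>
          (ProbabilityTheory.cond P {ω | 0 < immigrationY ν I T t ω}).real
            {ω | (immigrationY ν I T t ω : ℝ) / Wfun p (μ * t) ≤ x})
          atTop (𝓝 (D.real (Iic x))) := by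
  classical
  have hfs := lt_pgf_of_slowlyVarying hL hf
  have hp := lintegral_natCast_le_one p fun t h0 h1 => (hfs t h0 h1).le
  set X : ℝ≥0 → Ω → ℝ := fun t ω => (immigrationY ν I T t ω : ℝ) / Wfun p (μ * t) with hX
  have hXm : ∀ t, Measurable (X t) := fun t => by
    have h := (measurable_from_top (f := fun n : ℕ => (n : ℝ))).comp (hM.measurable_Y t)
    exact h.div_const _
  have hX0 : ∀ t ω, 0 ≤ X t ω := fun t ω => by
    have : 0 < Wfun p (μ * t) := by
      rw [Wfun_mul p hμ hp hfs t.coe_nonneg]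
      exact zero_lt_one.trans_le (one_le_one_div_one_sub_branchingF hμ hp le_rfl one_pos t.coe_nonneg)
    exact div_nonneg (Nat.cast_nonneg _) this.le
  -- the conditional law, replaced by `P` if the condition has probability zero
  set ρ : ℝ≥0 → Measure Ω := fun t => if P {ω | 0 < immigrationY ν I T t ω} = 0 then P else
    ProbabilityTheory.cond P {ω | 0 < immigrationY ν I T t ω} with hρ
  have hρprob : ∀ t, IsProbabilityMeasure (ρ t) := fun t => by
    by_cases h : P {ω | 0 < immigrationY ν I T t ω} = 0
    · simp only [hρ, if_pos h]; infer_instance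
    · simp only [hρ, if_neg h]; exact cond_isProbabilityMeasure h
  have hmprob : ∀ t, IsProbabilityMeasure ((ρ t).map (X t)) := fun t =>
    Measure.isProbabilityMeasure_map (hXm t).aemeasurable
  have hlap : ∀ lam : ℝ, 0 < lam → (∀ᶠ t in atTop, P {ω | 0 < immigrationY ν I T t ω} ≠ 0) ∧
      Tendsto (fun t => ∫ x, Real.exp (-(lam * x)) ∂((ρ t).map (X t))) atTop
        (𝓝 (1 - lam ^ α / (1 + lam ^ γ) ^ (α / γ))) := fun lam hlam => by
    obtain ⟨h1, h2⟩ := hM.tendsto_integral_exp_cond hμ hα hγ hαγ hθ hL hl hf hg hLR hr0 hrint hr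
      hlam
    refine ⟨h1, ?_⟩
    rw [rpow_div_one_add_rpow hγ hlam]
    refine h2.congr' (h1.mono fun t ht => ?_)
    dsimp only
    rw [integral_map (hXm t).aemeasurable (Continuous.aestronglyMeasurable (by fun_prop))]
    simp only [hρ, if_neg ht, hX]
  obtain ⟨D, hD, hD0, hDL, hDlim⟩ := exists_measure_of_tendsto_laplace
    (m := fun t => (ρ t).map (X t))
    (fun t => (ae_map_iff (hXm t).aemeasurable measurableSet_Ici).2 (ae_of_all _ (hX0 t)))
    (tendsto_one_sub_rpow_div hα hγ) fun lam hlam => (hlap lam hlam).2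
  refine ⟨D, hD, hD0, hDL, fun x hx => ?_⟩
  -- Without atoms every x ≥ 0 is a continuity point; at x = 0 this matters, since 0 is the edge of
  -- the support.
  have hatom : D {x} = 0 := measure_singleton_eq_zero_of_laplace hγ hγ1 hD0
    (β := α / γ) (fun lam hlam => by rw [hDL lam hlam, rpow_div_one_add_rpow hγ hlam]) x
  refine (hDlim x hx hatom).congr' ((hlap 1 one_pos).1.mono fun t ht => ?_)
  rw [map_measureReal_apply (hXm t) measurableSet_Iic]
  simp only [hρ, if_neg ht]
  rfl

/-- Both exponents are compared with r(t): divided by it they tend to Δ(s) and Q, and r(t) itself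
vanishes, so linearizing the exponentials leaves Δ(s)/Q. -/
theorem IsImmigrationModel.tendsto_integral_pow_cond_of_integrableOn
    (hM : IsImmigrationModel μ p b r ν I T P)
    (hμ : 0 < μ) (hθ : 0 < θ) (hθ1 : θ < 1) (hL : SlowlyVarying L) (hl : SlowlyVarying l)
    (hf : ∀ s : ℝ, 0 ≤ s → s < 1 → pgf p s = s + (1 - s) ^ (γ + 1) * L (1 / (1 - s)))
    (hg : ∀ s : ℝ, 0 ≤ s → s < 1 → pgf b s = 1 - (1 - s) ^ α * l (1 / (1 - s)))
    (hLR : SlowlyVarying LR) (hr0 : ∀ t : ℝ, 0 ≤ t → 0 ≤ r t)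
    (hrint : ∀ t : ℝ, 0 ≤ t → IntervalIntegrable r volume 0 t)
    (hr : ∀ t : ℝ, 0 < t → r t = t ^ (-θ) * LR t)
    (hQ : IntegrableOn (fun u => qfun μ p b u 0) (Ioi 0)) :
    0 < Qconst μ p b ∧
      ∀ s : ℝ, 0 ≤ s → s ≤ 1 →
        IntegrableOn (fun u => qfun μ p b u s) (Ioi 0) ∧
        Tendsto (fun t : ℝ≥0 => ∫ ω, s ^ immigrationY ν I T t ω
            ∂(ProbabilityTheory.cond P {ω | 0 < immigrationY ν I T t ω}))
          atTop (𝓝 (1 - Deltafun μ p b s / Qconst μ p b)) := by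
  have hfs := lt_pgf_of_slowlyVarying hL hf
  have hp := lintegral_natCast_le_one p fun t h0 h1 => (hfs t h0 h1).le
  have hpos : ∀ t, 0 ≤ t → 0 < qfun μ p b t 0 := fun t ht =>
    qfun_pos hμ hp (pgf_lt_one_of_slowlyVarying hl hg) le_rfl one_pos ht
  have hQpos : 0 < Qconst μ p b := by
    rw [Qconst, setIntegral_pos_iff_support_of_nonneg_ae _ hQ]
    · have : Function.support (fun u => qfun μ p b u 0) ∩ Ioi 0 = Ioi 0 :=
        inter_eq_self_of_subset_right fun u hu => (hpos u (le_of_lt hu)).ne'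
      rw [this]
      simp
    · exact (ae_restrict_iff' measurableSet_Ioi).2 (ae_of_all _ fun u hu => (hpos u (le_of_lt hu)).le)
  have hconv : ∀ s : ℝ, 0 ≤ s → s ≤ 1 →
      Tendsto (fun t => (∫ u in (0 : ℝ)..t, r u * qfun μ p b (t - u) s) / r t) atTop
        (𝓝 (Deltafun μ p b s)) := fun s hs hs1 =>
    tendsto_convolution_div_of_lt_one hLR hθ.le hθ1 hr hr0 hrint
      (antitoneOn_qfun hμ hp hfs le_rfl one_pos) hQ (measurable_qfun hμ hs hs1)
      (fun u _ => (qfun_mem_Icc hμ hs hs1).1) (fun u _ => qfun_le_qfun_zero hμ hs hs1)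
  have hB : Tendsto (fun t => (∫ u in (0 : ℝ)..t, r u * qfun μ p b (t - u) 0) / r t) atTop
      (𝓝 (Qconst μ p b)) := hconv 0 le_rfl zero_le_one
  have hrpos := hLR.eventually_rpow_mul_pos hr
  -- Here θ > 0 is used: doubling t multiplies r by nearly 2^(-θ) < 1.
  have hrzero : Tendsto r atTop (𝓝 0) := by
    obtain ⟨C, -, hC⟩ := hLR.eventually_forall_le_const_mul hθ.le hr (a := 1) (b := 2) one_pos
    exact tendsto_zero_of_tendsto_ratio hrpos hC
      (Real.rpow_lt_one_of_one_lt_of_neg one_lt_two (neg_lt_zero.2 hθ))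
      (hLR.tendsto_ratio_rpow hθ.le hr two_pos)
  have hBpos : ∀ᶠ t in atTop, 0 < ∫ u in (0 : ℝ)..t, r u * qfun μ p b (t - u) 0 := by
    filter_upwards [hrpos, hB.eventually (lt_mem_nhds hQpos)] with t h1 h2
    exact (div_pos_iff_of_pos_right h1).1 h2
  have hB0 : Tendsto (fun t => ∫ u in (0 : ℝ)..t, r u * qfun μ p b (t - u) 0) atTop (𝓝 0) := by
    have h := hB.mul hrzero
    rw [mul_zero] at h
    refine h.congr' (hrpos.mono fun t ht => ?_)
    rw [div_mul_cancel₀ _ ht.ne']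
  refine ⟨hQpos, fun s hs hs1 => ⟨?_, ?_⟩⟩
  · refine hQ.mono' (measurable_qfun hμ hs hs1).aestronglyMeasurable (ae_of_all _ fun u => ?_)
    rw [Real.norm_of_nonneg (qfun_mem_Icc hμ hs hs1).1]
    exact qfun_le_qfun_zero hμ hs hs1
  · exact (hM.tendsto_integral_pow_cond hμ hp hr0 hrint (σ := fun _ => s) (fun _ => hs)
      (fun _ => hs1) hBpos hB0 (((hconv s hs hs1).div hB hQpos.ne').congr'
        (hrpos.mono fun t ht => div_div_div_cancel_right₀ ht.ne' _ _))).2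

end Immigration

theorem theorem5p4 {Ω : Type*} [MeasurableSpace Ω] (P : Measure Ω) [IsProbabilityMeasure P]
    (μ θ α γ : ℝ) (hμ : 0 < μ) (hθ : 0 < θ)
    (hα : 0 < α) (hα1 : α ≤ 1) (hγ : 0 < γ) (hγ1 : γ ≤ 1)
    -- offspring law `p` (p.g.f. `f`) and immigrant law `b` (p.g.f. `g`)
    (p b : PMF ℕ) (L l : ℝ → ℝ) (hL : SlowlyVarying L) (hl : SlowlyVarying l)
    (hf : ∀ s : ℝ, 0 ≤ s → s < 1 → pgf p s = s + (1 - s) ^ (γ + 1) * L (1 / (1 - s)))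
    (hg : ∀ s : ℝ, 0 ≤ s → s < 1 → pgf b s = 1 - (1 - s) ^ α * l (1 / (1 - s)))
    -- intensity of the immigration
    (r LR : ℝ → ℝ) (hLR : SlowlyVarying LR) (hr0 : ∀ t : ℝ, 0 ≤ t → 0 ≤ r t)
    (hrint : ∀ t : ℝ, 0 ≤ t → IntervalIntegrable r volume 0 t)
    (hr : ∀ t : ℝ, 0 < t → r t = t ^ (-θ) * LR t)
    -- the process
    (ν : ℝ≥0 → Ω → ℕ) (I : ℕ → Ω → ℕ) (T : ℕ × ℕ → Ω → LifeTree)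
    (hmodel : IsImmigrationModel μ p b r ν I T P) :
    (1 ≤ θ → α / γ < 1 →
      ∃ D : Measure ℝ, IsProbabilityMeasure D ∧ D (Set.Iio 0) = 0 ∧
        (∀ lam : ℝ, 0 < lam →
          ∫ x, Real.exp (-(lam * x)) ∂D = 1 - lam ^ α / (1 + lam ^ γ) ^ (α / γ)) ∧
        ∀ x : ℝ, 0 ≤ x →
          Tendsto (fun t : ℝ≥0 =>
            (cond P {ω | 0 < immigrationY ν I T t ω}).real
              {ω | (immigrationY ν I T t ω : ℝ) / Wfun p (μ * t) ≤ x})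
            atTop (𝓝 (D.real (Set.Iic x)))) ∧
    (θ < 1 → 1 ≤ α / γ → IntegrableOn (fun u => qfun μ p b u 0) (Set.Ioi 0) →
      0 < Qconst μ p b ∧
      ∀ s : ℝ, 0 ≤ s → s ≤ 1 →
        IntegrableOn (fun u => qfun μ p b u s) (Set.Ioi 0) ∧
        Tendsto (fun t : ℝ≥0 =>
          ∫ ω, s ^ immigrationY ν I T t ω ∂(cond P {ω | 0 < immigrationY ν I T t ω}))
          atTop (𝓝 (1 - Deltafun μ p b s / Qconst μ p b))) :=
  ⟨fun hθ1 hαγ => hmodel.exists_limit_law hμ hα hγ hγ1 hαγ hθ1 hL hl hf hg hLR hr0 hrint hr,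
    fun hθ1 _ hQ => hmodel.tendsto_integral_pow_cond_of_integrableOn hμ hθ hθ1 hL hl hf hg hLR
      hr0 hrint hr hQ⟩
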